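/- Let $p,q\ge 1$. Let $C(p,q)$ be the real Clifford algebra of the quadratic form $Q(a)=a_1^2+\dots+a_p^2-a_{p+1}^2-\dots-a_{p+q}^2$ on $E=\mathbb{R}^{p+q}$, with the convention $a\cdot a=Q(a)$ for $a\in E$; let $v_1^+,\dots,v_p^+,v_1^-,\dots,v_q^-$ be the images of the standard basis vectors, and $C_{\mathrm{even}}(p,q)$ the even subalgebra. Let $a\mapsto{}^t a$ be the anti-automorphism of $C(p,q)$ that is the identity on $E$, let $a\mapsto a^*$ be the anti-automorphism with $(v_i^+)^*=v_i^+$ and $(v_j^-)^*=-v_j^-$, and put $J_+=v_1^+\cdots v_p^+$, $J_-=v_1^-\cdots v_q^-$. Define $$G(p,q)=\{a\in C_{\mathrm{even}}(p,q):{}^t a\,a=1\},\qquad \mathrm{Aut}(J_\pm)=\{a\in C(p,q): a^*J_\pm a=J_\pm\}.$$ All groups carry the topology induced from the finite-dimensional real algebra containing them, and $\cong$ between groups means isomorphism of topological (equivalently, Lie) groups. $H^{(2)}$ denotes $H\times H$. $Sp(n,\mathbb{R})$ and $Sp(n,\mathbb{C})$ consist of $2n\times 2n$ matrices, $O^*(4n)$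 is the isometry group of the non-degenerate quaternionic skew-Hermitian form on $\mathbb{H}^{2n}$, and $Sp(n,n)$ that of the quaternionic Hermitian form of signature $(n,n)$. **(A)** The algebra $C_{\mathrm{even}}(p,q)$ and the group $G(p,q)$ are, up to isomorphism, given by the following table, in which $n=2^{(p+q-\alpha)/2}$ (an integer, except that $n=\tfrac12$ if $p=q=1$, where only $2n$ occurs): $$\begin{array}{c|c|c|c|l} p-q \bmod 8 & \alpha & C_{\mathrm{even}}(p,q) & p+q \bmod 8 & G(p,q)\\ \hline 0 & 4 & M(2n,\mathbb{R})\oplus M(2n,\mathbb{R}) & 0 & O(n,n)^{(2)}\\ & & & \pm2 & GL(2n,\mathbb{R})\\ & & & 4 & Sp(n,\mathbb{R})^{(2)}\\ \hline \pm1 & 3 & M(2n,\mathbb{R}) & \pm1 & O(n,n)\\ & & & \pm3 & Sp(n,\mathbb{R})\\ \hline \pm2 & 4 & M(2n,\mathbb{C}) & 0 & O(2n,\mathbb{C})\\ & & & \pm2 & U(n,n)\\ & & & 4 & Sp(n,\mathbb{C})\\ \hline \pm3 & 5 & M(2n,\mathbb{H}) & \pm1 & O^*(4n)\\ & & & \pm3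 & Sp(n,n)\\ \hline 4 & 6 & M(2n,\mathbb{H})\oplus M(2n,\mathbb{H}) & 0 & O^*(4n)^{(2)}\\ & & & \pm2 & GL(2n,\mathbb{H})\\ & & & 4 & Sp(n,n)^{(2)} \end{array}$$ Thus the type of $G(p,q)$ depends only on $p-q$ and $p+q$ modulo $8$. **(B)** Put $n=2^{(p+q-\alpha)/2}$ with $\alpha$ as in the following table. The group $C(p,q)\cap\mathrm{Aut}(J_+)=\mathrm{Aut}(J_+)$ is isomorphic to $$\begin{array}{c|c|c|c} p-q-1 \bmod 8 & \alpha & p\bmod 4\in\{0,1\} & p\bmod 4\in\{2,3\}\\ \hline 0 & 3 & O(n,n)^{(2)} & Sp(n,\mathbb{R})^{(2)}\\ \pm1 & 2 & O(n,n) & Sp(n,\mathbb{R})\\ \pm2 & 3 & U(n,n) & U(n,n)\\ \pm3 & 4 & Sp(n,n) & O^*(4n)\\ 4 & 5 & Sp(n,n)^{(2)} & O^*(4n)^{(2)} \end{array}$$ The group $C(p,q)\cap\mathrm{Aut}(J_-)=\mathrm{Aut}(J_-)$ is given by the same table with $p \bmod 4$ replaced by $q+1 \bmod 4$ (and $p-q-1$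 and $\alpha$ unchanged). **(C)** If $p$ and $q$ are odd, then $G(p,q)=C_{\mathrm{even}}(p,q)\cap\mathrm{Aut}(J_+)=C_{\mathrm{even}}(p,q)\cap\mathrm{Aut}(J_-)$, and with $n=2^{(p+q-\alpha)/2}$ this group is isomorphic to: $GL(n,\mathbb{R})$, $\alpha=2$, if $p-q\equiv0 \bmod 8$; $GL(n,\mathbb{H})$, $\alpha=4$, if $p-q\equiv4\bmod 8$ (in both cases $p+q\equiv\pm2 \bmod 8$); $O(n,\mathbb{C})$, $\alpha=2$, if $p-q\equiv\pm2$ and $p+q\equiv0\bmod 8$; $Sp(n,\mathbb{C})$, $\alpha=4$, if $p-q\equiv\pm2$ and $p+q\equiv4\bmod 8$. -/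

import Mathlib

open CliffordAlgebra
open scoped Quaternion

noncomputable section

namespace IndefClifford

/-! ## The Clifford algebra `C(p,q)` -/

/-- The quadratic form `Q(a) = ∑_{i<p} (aᵢ⁺)² - ∑_{j<q} (aⱼ⁻)²` on `ℝ^{p+q}`; coordinates are indexed by
`Fin p ⊕ Fin q`, the first summand carrying the positive directions. -/
abbrev stdForm (p q : ℕ) : QuadraticForm ℝ (Fin p ⊕ Fin q → ℝ) :=
  QuadraticMap.weightedSumSquares ℝ (Sum.elim (fun _ => (1 : ℝ)) (fun _ => (-1 : ℝ)))

/-- The Clifford algebra `C(p,q)`, generated by `ℝ^{p+q}` with the relations `a * a = Q(a)`. -/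
abbrev Cl (p q : ℕ) : Type := CliffordAlgebra (stdForm p q)

/-- `C(p,q)` carries its topology as a finite-dimensional real vector space. -/
instance (p q : ℕ) : TopologicalSpace (Cl p q) := moduleTopology ℝ (Cl p q)

instance (p q : ℕ) : IsModuleTopology ℝ (Cl p q) := ⟨rfl⟩

/-- The even subalgebra `C_even(p,q)`. -/
abbrev ClEven (p q : ℕ) : Subalgebra ℝ (Cl p q) := CliffordAlgebra.even (stdForm p q)

/-- The generator `v⁺ᵢ`. -/
def vPlus {p q : ℕ} (i : Fin p) : Cl p q := ι (stdForm p q) (Pi.single (Sum.inl i) 1)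

/-- The generator `v⁻ⱼ`. -/
def vMinus {p q : ℕ} (j : Fin q) : Cl p q := ι (stdForm p q) (Pi.single (Sum.inr j) 1)

/-- `J₊ = v⁺₁ ⋯ v⁺ₚ`. -/
def JPlus (p q : ℕ) : Cl p q := (List.ofFn fun i : Fin p => vPlus i).prod

/-- `J₋ = v⁻₁ ⋯ v⁻_q`. -/
def JMinus (p q : ℕ) : Cl p q := (List.ofFn fun j : Fin q => vMinus j).prod

/-- The isometry of `ℝ^{p,q}` that fixes every `v⁺ᵢ` and sends every `v⁻ⱼ` to `-v⁻ⱼ`. -/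
def flipMinus (p q : ℕ) : stdForm p q →qᵢ stdForm p q where
  toFun x := Sum.elim (fun i => x (Sum.inl i)) (fun j => -x (Sum.inr j))
  map_add' x y := by
    ext k; rcases k with i | j
    · simp
    · simp [add_comm]
  map_smul' c x := by
    ext k; rcases k with i | j <;> simp
  map_app' x := by
    simp [QuadraticMap.weightedSumSquares_apply]

theorem flipMinus_apply {p q : ℕ} (x : Fin p ⊕ Fin q → ℝ) :
    flipMinus p q x = Sum.elim (fun i => x (Sum.inl i)) (fun j => -x (Sum.inr j)) := rfl

/-- The algebra automorphism `T_{0,q}` of `C(p,q)` with `v⁺ᵢ ↦ v⁺ᵢ` and `v⁻ⱼ ↦ -v⁻ⱼ`. -/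
def TMinus (p q : ℕ) : Cl p q →ₐ[ℝ] Cl p q := CliffordAlgebra.map (flipMinus p q)

/-- The anti-automorphism `a ↦ a* = T_{0,q}(ᵗa)`, where `ᵗa` is `CliffordAlgebra.reverse a`. -/
def starConj {p q : ℕ} (a : Cl p q) : Cl p q := TMinus p q (reverse a)

theorem starConj_one {p q : ℕ} : starConj (1 : Cl p q) = 1 := by
  simp [starConj]

theorem starConj_mul {p q : ℕ} (a b : Cl p q) :
    starConj (a * b) = starConj b * starConj a := by
  simp [starConj]

/-! ## The groups inside `C(p,q)`

Each is the set in question with the multiplication of `C(p,q)` and the subspace topology. -/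

/-- `G(p,q) = {a ∈ C_even(p,q) : ᵗa a = 1}`. -/
def G (p q : ℕ) : Submonoid (Cl p q) where
  carrier := {a | a ∈ ClEven p q ∧ reverse a * a = 1}
  one_mem' := ⟨one_mem _, by simp⟩
  mul_mem' := by
    rintro a b ⟨ha, ha'⟩ ⟨hb, hb'⟩
    refine ⟨mul_mem ha hb, ?_⟩
    rw [reverse.map_mul, mul_assoc, ← mul_assoc _ a b, ha', one_mul, hb']

/-- `{a ∈ C(p,q) : a* J a = J}`; this is `Aut(J₊)` for `J = J₊` and `Aut(J₋)` for `J = J₋`. -/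
def AutJ {p q : ℕ} (J : Cl p q) : Submonoid (Cl p q) where
  carrier := {a | starConj a * J * a = J}
  one_mem' := by simp [starConj_one]
  mul_mem' := by
    intro a b (ha : _ = _) (hb : _ = _)
    change starConj (a * b) * J * (a * b) = J
    calc starConj (a * b) * J * (a * b)
        = starConj b * (starConj a * J * a) * b := by rw [starConj_mul]; noncomm_ring
      _ = J := by rw [ha, hb]

/-! ## Classical groups -/

/-- Matrices over `F` that preserve the sesquilinear form `(x, y) ↦ x* B y`. -/
def formGroup {m F : Type*} [Fintype m] [DecidableEq m] [Ring F] [StarRing F]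
    (B : Matrix m m F) : Submonoid (Matrix m m F) where
  carrier := {A | A.conjTranspose * B * A = B}
  one_mem' := by simp
  mul_mem' := by
    intro X Y (hX : _ = _) (hY : _ = _)
    change (X * Y).conjTranspose * B * (X * Y) = B
    calc (X * Y).conjTranspose * B * (X * Y)
        = Y.conjTranspose * (X.conjTranspose * B * X) * Y := by
          rw [Matrix.conjTranspose_mul]; simp only [Matrix.mul_assoc]
      _ = B := by rw [hX, hY]

/-- The matrix `diag(1,…,1,-1,…,-1)` with `n` entries of each sign. -/
def signMatrix (n : ℕ) (F : Type*) [Ring F] : Matrix (Fin n ⊕ Fin n) (Fin n ⊕ Fin n) F :=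
  Matrix.fromBlocks 1 0 0 (-1)

/-- `O(n,n)` (over `ℝ` the conjugate transpose is the transpose). -/
abbrev Onn (n : ℕ) : Submonoid (Matrix (Fin n ⊕ Fin n) (Fin n ⊕ Fin n) ℝ) :=
  formGroup (signMatrix n ℝ)

/-- `U(n,n)`. -/
abbrev Unn (n : ℕ) : Submonoid (Matrix (Fin n ⊕ Fin n) (Fin n ⊕ Fin n) ℂ) :=
  formGroup (signMatrix n ℂ)

/-- `Sp(n,n)`: the isometries of the quaternionic Hermitian form of signature `(n,n)`. -/
abbrev Spnn (n : ℕ) : Submonoid (Matrix (Fin n ⊕ Fin n) (Fin n ⊕ Fin n) ℍ[ℝ]) :=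
  formGroup (signMatrix n ℍ[ℝ])

/-- `O*(2m)`: the isometries of the quaternionic skew-Hermitian form `∑ x̄ᵢ 𝐣 yᵢ` on `ℍᵐ`. -/
abbrev OStar (m : ℕ) : Submonoid (Matrix (Fin m) (Fin m) ℍ[ℝ]) :=
  formGroup (Matrix.diagonal fun _ => (⟨0, 0, 1, 0⟩ : ℍ[ℝ]))

/-- `Sp(n,ℝ)`, inside the `2n × 2n` matrices. -/
abbrev SpR (n : ℕ) : Submonoid (Matrix (Fin n ⊕ Fin n) (Fin n ⊕ Fin n) ℝ) :=
  Matrix.symplecticGroup (Fin n) ℝ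

/-- `Sp(n,ℂ)`, inside the `2n × 2n` matrices. -/
abbrev SpC (n : ℕ) : Submonoid (Matrix (Fin n ⊕ Fin n) (Fin n ⊕ Fin n) ℂ) :=
  Matrix.symplecticGroup (Fin n) ℂ

/-- `O(m,ℂ) = {A : A Aᵀ = 1}` (the transpose, not the conjugate transpose). -/
abbrev OC (m : ℕ) : Submonoid (Matrix (Fin m) (Fin m) ℂ) := Matrix.orthogonalGroup (Fin m) ℂ

theorem mem_OC_iff {m : ℕ} {A : Matrix (Fin m) (Fin m) ℂ} :
    A ∈ OC m ↔ A * A.transpose = 1 := Matrix.mem_orthogonalGroup_iff (Fin m) ℂ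

/-- `GL(m,ℝ)`. -/
abbrev GLR (m : ℕ) : Type := (Matrix (Fin m) (Fin m) ℝ)ˣ

/-- `GL(m,ℍ)`. -/
abbrev GLH (m : ℕ) : Type := (Matrix (Fin m) (Fin m) ℍ[ℝ])ˣ

/-! ## Isomorphism and congruences -/

/-- There is an isomorphism of topological groups. All groups here are closed subgroups of the unit
groups of finite-dimensional real algebras, so this is the same as isomorphism of Lie groups. -/
abbrev LieIso (A B : Type*) [Mul A] [Mul B] [TopologicalSpace A] [TopologicalSpace B] : Prop :=
  Nonempty (A ≃ₜ* B)

/-- There is an isomorphism of unital `ℝ`-algebras. -/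
abbrev AlgIso (A B : Type*) [Ring A] [Ring B] [Algebra ℝ A] [Algebra ℝ B] : Prop :=
  Nonempty (A ≃ₐ[ℝ] B)

/-- `x ≡ ± r (mod 8)`. -/
abbrev PM8 (x r : ℤ) : Prop := x ≡ r [ZMOD 8] ∨ x ≡ -r [ZMOD 8]

/-- The `m × m` matrix algebra over `F`. -/
abbrev Mat (m : ℕ) (F : Type) : Type := Matrix (Fin m) (Fin m) F

/-- The list of isomorphism types of `C(p,q) ∩ Aut(J)`, depending on `p`, `q` and on a sign: the sign
condition `herm` says that `J² = 1` and `skew` that `J² = -1`, expressed by congruences mod 4. -/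
def AutTable (p q : ℕ) (H : Submonoid (Cl p q)) (herm skew : Prop) : Prop :=
  ((p : ℤ) - q - 1 ≡ 0 [ZMOD 8] → ∃ m n : ℕ, p + q = 2 * m + 3 ∧ n = 2 ^ m ∧
    (herm → LieIso H (Onn n × Onn n)) ∧ (skew → LieIso H (SpR n × SpR n))) ∧
  (PM8 ((p : ℤ) - q - 1) 1 → ∃ m n : ℕ, p + q = 2 * m + 2 ∧ n = 2 ^ m ∧
    (herm → LieIso H (Onn n)) ∧ (skew → LieIso H (SpR n))) ∧
  (PM8 ((p : ℤ) - q - 1) 2 → ∃ m n : ℕ, p + q = 2 * m + 3 ∧ n = 2 ^ m ∧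
    LieIso H (Unn n)) ∧
  (PM8 ((p : ℤ) - q - 1) 3 → ∃ m n : ℕ, p + q = 2 * m + 4 ∧ n = 2 ^ m ∧
    (herm → LieIso H (Spnn n)) ∧ (skew → LieIso H (OStar (2 * n)))) ∧
  ((p : ℤ) - q - 1 ≡ 4 [ZMOD 8] → ∃ m n : ℕ, p + q = 2 * m + 5 ∧ n = 2 ^ m ∧
    (herm → LieIso H (Spnn n × Spnn n)) ∧
    (skew → LieIso H (OStar (2 * n) × OStar (2 * n))))

end IndefClifford

end

/-! The involution a ↦ a* makes C(p,q) a real star algebra generated by a frame: anticommuting zᵢ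
with zᵢ² = sᵢ = ±1 and zᵢ* = sᵢ zᵢ. The classification of Clifford algebras can then be carried out
with star isomorphisms, a* becoming the conjugate transpose over ℝ, ℂ, ℍ or a square of one of these
(`hasCliffordType_of_isFrame`). Two generators of opposite sign split off 2 × 2 matrices;
multiplying the other generators by a positive one exchanges the types (p+1,q) and (q+1,p);
multiplying four negative generators by their product turns (0,q+4) into (4,q). Only (0,0), (1,0),
(0,1), (0,2), (0,3) remain.

Let J be J₊ or J₋. Then J² = ε and J* = εJ with the same sign ε, and w = v₁⁺v₁⁻ is a self-adjoint
involution anticommuting with J. So J and w generate real 2 × 2 matrices, in which J is diag(1,-1)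
or [[0,-1],[1,0]]. Once the generators that anticommute with J are corrected by w, the remaining
ones form a frame of type (p-1,q-1) spanning the coefficient algebra B (`IsFrame.exists_split`).
Hence Aut(J) is the isometry group of a standard Hermitian or skew-Hermitian form over B, which is
(B).

The products of the generators with a fixed one form a frame of C_even, of type (p,q-1) or (q,p-1);
this gives the algebras in (A). Moving J₊ or J₋ past an even element applies T₋, so for even a the
condition ᵗa a = 1 means a* J a = J (`reverse_mul_self_iff`). If p or q is even, the corresponding J
lies in C_even and is, up to sign, the product of the negative generators of such a frame, so the
analysis of J₋ applies again.

If p and q are odd, w = J₊J₋ is central in C_even (`exists_central`). When p ≡ q mod 4, w² = 1 and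
ᵗw = -w: C_even is M × M, reversal exchanges the factors, and G is the unit group of M
(`lieIso_units_of_central`). Otherwise w² = -1 and ᵗw = w: reversal is linear over ℝ[w] ≅ ℂ.
Multiplication by w changes signs of generators at will, which produces a real form generated by a
frame of type (l+1,l+1) that reversal negates. There reversal is the transpose conjugated by the
product of the negative generators, so G preserves a symmetric or alternating complex bilinear form
(`lieIso_G_complex`). -/

noncomputable section

namespace IndefClifford

/-! ## Clifford frames in real star algebras -/

section Frames

variable {A : Type*} [Ring A] [StarRing A] [Algebra ℝ A] [StarModule ℝ A]
variable {ι κ : Type*}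

/-- Pairwise anticommuting elements with `zᵢ² = sᵢ = ±1` and `zᵢ* = sᵢ zᵢ`. -/
structure IsFrame (s : ι → ℝ) (z : ι → A) : Prop where
  sign_mul_self : ∀ i, s i * s i = 1
  mul_self : ∀ i, z i * z i = s i • 1
  star_eq : ∀ i, star (z i) = s i • z i
  anticomm : ∀ i j, i ≠ j → z j * z i = -(z i * z j)

/-- The family `z` generates `A` as a star algebra. -/
def StarGenerates (z : ι → A) : Prop :=
  ∀ S : StarSubalgebra ℝ A, (∀ i, z i ∈ S) → S = ⊤

theorem IsFrame.comp {s : ι → ℝ} {z : ι → A} (h : IsFrame s z) {f : κ → ι}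
    (hf : Function.Injective f) : IsFrame (s ∘ f) (z ∘ f) where
  sign_mul_self i := h.sign_mul_self _
  mul_self i := h.mul_self _
  star_eq i := h.star_eq _
  anticomm i j hij := h.anticomm _ _ (fun e => hij (hf e))

theorem IsFrame.congr {s t : ι → ℝ} {z : ι → A} (h : IsFrame s z) (e : ∀ i, s i = t i) :
    IsFrame t z := by
  rwa [← funext e]

theorem IsFrame.of_coe {B : StarSubalgebra ℝ A} {s : ι → ℝ} {z : ι → B}
    (h : IsFrame s (fun i => (z i : A))) : IsFrame s z where
  sign_mul_self := h.sign_mul_self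
  mul_self i := Subtype.ext (h.mul_self i)
  star_eq i := Subtype.ext (h.star_eq i)
  anticomm i j hij := Subtype.ext (h.anticomm i j hij)

/-- The relations give (zᵢ g)² = δγsᵢ and (zᵢ g)* = δγsᵢ zᵢ g, and g commutes with the untouched
generators, so anticommutation survives. All changes of frame below are instances. -/
theorem IsFrame.twist {s : ι → ℝ} {z : ι → A} (h : IsFrame s z) (T : ι → Prop)
    [DecidablePred T] {g : A} {γ δ : ℝ} (hγ : γ * γ = 1) (hδ : δ * δ = 1) (hg : g * g = γ • 1)
    (hgs : star g = γ • g) (hT : ∀ i, T i → g * z i = δ • (z i * g))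
    (hT' : ∀ i, ¬ T i → g * z i = z i * g) :
    IsFrame (fun i => if T i then δ * γ * s i else s i)
      (fun i => if T i then z i * g else z i) where
  sign_mul_self i := by
    have := h.sign_mul_self i
    by_cases hi : T i
    · simp only [hi, if_true]
      calc δ * γ * s i * (δ * γ * s i) = (δ * δ) * (γ * γ) * (s i * s i) := by ring
        _ = 1 := by rw [hγ, hδ, this]; norm_num
    · simpa [hi] using this
  mul_self i := by
    by_cases hi : T i
    · simp only [hi, if_true]
      calc z i * g * (z i * g) = z i * (g * z i) * g := by noncomm_ring
        _ = δ • ((z i * z i) * (g * g)) := by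
          rw [hT i hi, mul_smul_comm, smul_mul_assoc]; noncomm_ring
        _ = _ := by rw [h.mul_self, hg]; simp [smul_smul, mul_comm, mul_left_comm]
    · simpa [hi] using h.mul_self i
  star_eq i := by
    by_cases hi : T i
    · simp only [hi, if_true]
      rw [star_mul, hgs, h.star_eq, smul_mul_assoc, mul_smul_comm, hT i hi, smul_smul, smul_smul]
      congr 1; ring
    · simpa [hi] using h.star_eq i
  anticomm i j hij := by
    have a := h.anticomm i j hij
    by_cases hi : T i <;> by_cases hj : T j
    · simp only [hi, hj, if_true]
      calc z j * g * (z i * g) = z j * (g * z i) * g := by noncomm_ring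
        _ = δ • ((z j * z i) * (g * g)) := by
          rw [hT i hi, mul_smul_comm, smul_mul_assoc]; noncomm_ring
        _ = -(z i * (δ • (z j * g)) * g) := by
          rw [a, mul_smul_comm, smul_mul_assoc, ← smul_neg]; noncomm_ring
        _ = _ := by rw [← hT j hj]; noncomm_ring
    · simp only [hi, hj, if_true, if_false]
      rw [← mul_assoc, a, mul_assoc, hT' j hj]; noncomm_ring
    · simp only [hi, hj, if_true, if_false]
      rw [mul_assoc, hT' i hi, ← mul_assoc, a]; noncomm_ring
    · simpa [hi, hj] using a

/-- The star subalgebra generated by a family. -/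
abbrev frameSpan (z : ι → A) : StarSubalgebra ℝ A := StarAlgebra.adjoin ℝ (Set.range z)

/-- The family `z` inside the star subalgebra it generates. -/
def frameSpanGen (z : ι → A) (i : ι) : frameSpan z :=
  ⟨z i, StarAlgebra.subset_adjoin ℝ _ ⟨i, rfl⟩⟩

theorem starGenerates_frameSpanGen (z : ι → A) : StarGenerates (frameSpanGen z) := by
  intro S hS
  rw [eq_top_iff]
  rintro ⟨x, hx⟩ -
  have : frameSpan z ≤ S.map (frameSpan z).subtype := by
    refine StarAlgebra.adjoin_le ?_
    rintro _ ⟨i, rfl⟩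
    exact ⟨_, hS i, rfl⟩
  obtain ⟨y, hy, e⟩ := this hx
  rwa [show (⟨x, hx⟩ : frameSpan z) = y from Subtype.ext e.symm]

/-! ### Splitting off `2 × 2` matrices -/

/-- Complementary self-adjoint idempotents `e`, `f` exchanged by a self-adjoint involution `s`. -/
structure IsHalving (e f s : A) : Prop where
  add_eq : e + f = 1
  ee : e * e = e
  ff : f * f = f
  ef : e * f = 0
  fe : f * e = 0
  ss : s * s = 1
  se : s * e = f * s
  sf : s * f = e * s
  star_e : star e = e
  star_f : star f = f
  star_s : star s = s

/-- The spectral projections of the involution h are exchanged by any involution s anticommuting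
with h. -/
theorem IsHalving.of_anticomm {h s : A} (hh : h * h = 1) (hs : s * s = 1) (hsh : s * h = -(h * s))
    (h_star : star h = h) (s_star : star s = s) :
    IsHalving ((2⁻¹ : ℝ) • (1 + h)) ((2⁻¹ : ℝ) • (1 - h)) s where
  add_eq := by
    rw [← smul_add, show (1 + h + (1 - h) : A) = (2 : ℝ) • 1 by rw [two_smul]; abel, smul_smul]
    norm_num
  ee := by
    rw [smul_mul_smul_comm, show (1 + h) * (1 + h) = (2 : ℝ) • (1 + h) by
      simp only [two_smul, add_mul, mul_add, hh, one_mul, mul_one]; abel, smul_smul]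
    norm_num
  ff := by
    rw [smul_mul_smul_comm, show (1 - h) * (1 - h) = (2 : ℝ) • (1 - h) by
      simp only [two_smul, sub_mul, mul_sub, hh, one_mul, mul_one]; abel, smul_smul]
    norm_num
  ef := by
    rw [smul_mul_smul_comm, show (1 + h) * (1 - h) = 0 by simp [add_mul, mul_sub, hh]; abel,
      smul_zero]
  fe := by
    rw [smul_mul_smul_comm, show (1 - h) * (1 + h) = 0 by simp [sub_mul, mul_add, hh],
      smul_zero]
  ss := hs
  se := by rw [mul_smul_comm, smul_mul_assoc, mul_add, sub_mul, hsh]; simp [sub_eq_add_neg]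
  sf := by rw [mul_smul_comm, smul_mul_assoc, mul_sub, add_mul, hsh]; simp
  star_e := by simp [h_star]
  star_f := by simp [h_star]
  star_s := s_star

/-- The matrix units of a halving. -/
def matUnit (e f s : A) : Fin 2 → Fin 2 → A := ![![e, e * s], ![f * s, f]]

theorem IsHalving.matUnit_mul {e f s : A} (H : IsHalving e f s) (i j k l : Fin 2) :
    matUnit e f s i j * matUnit e f s k l = if j = k then matUnit e f s i l else 0 := by
  have f1 : ∀ x, e * (e * x) = e * x := fun x => by rw [← mul_assoc, H.ee]
  have f2 : ∀ x, f * (f * x) = f * x := fun x => by rw [← mul_assoc, H.ff]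
  have f3 : ∀ x, e * (f * x) = 0 := fun x => by rw [← mul_assoc, H.ef, zero_mul]
  have f4 : ∀ x, f * (e * x) = 0 := fun x => by rw [← mul_assoc, H.fe, zero_mul]
  have f5 : ∀ x, s * (e * x) = f * (s * x) := fun x => by rw [← mul_assoc, H.se, mul_assoc]
  have f6 : ∀ x, s * (f * x) = e * (s * x) := fun x => by rw [← mul_assoc, H.sf, mul_assoc]
  fin_cases i <;> fin_cases j <;> fin_cases k <;> fin_cases l <;>
    simp [matUnit, mul_assoc, H.ee, H.ff, H.ef, H.fe, H.ss, H.se, H.sf, f1, f2, f3, f4, f5, f6]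

theorem IsHalving.star_matUnit {e f s : A} (H : IsHalving e f s) (i j : Fin 2) :
    star (matUnit e f s i j) = matUnit e f s j i := by
  fin_cases i <;> fin_cases j <;> simp [matUnit, H.se, H.sf, H.star_e, H.star_f, H.star_s]

theorem matUnit_commute {e f s b : A} (he : Commute e b) (hf : Commute f b) (hs : Commute s b)
    (i j : Fin 2) : matUnit e f s i j * b = b * matUnit e f s i j := by
  fin_cases i <;> fin_cases j
  · exact he
  · exact he.mul_left hs
  · exact hf.mul_left hs
  · exact hf

/-- If `B` commutes with a halving of `A`, the `2 × 2` matrices over `B` map to `A`. -/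
def IsHalving.matHom {e f s : A} (H : IsHalving e f s) {B : StarSubalgebra ℝ A}
    (hB : ∀ b ∈ B, Commute e b ∧ Commute f b ∧ Commute s b) :
    Matrix (Fin 2) (Fin 2) B →⋆ₐ[ℝ] A where
  toFun X := ∑ i, ∑ j, (X i j : A) * matUnit e f s i j
  map_one' := by simp [Fin.sum_univ_two, Matrix.one_apply, matUnit, H.add_eq]
  map_zero' := by simp
  map_add' X Y := by simp [add_mul, Finset.sum_add_distrib]
  map_mul' X Y := by
    have key : ∀ i j k l, (X i j : A) * matUnit e f s i j * (Y k l * matUnit e f s k l)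
        = if j = k then X i j * Y k l * matUnit e f s i l else 0 := by
      intro i j k l
      obtain ⟨c1, c2, c3⟩ := hB _ (Y k l).2
      rw [mul_assoc, ← mul_assoc (matUnit e f s i j), matUnit_commute c1 c2 c3, mul_assoc,
        H.matUnit_mul]
      split_ifs <;> simp [mul_assoc]
    simp only [Finset.mul_sum, Finset.sum_mul, key, Matrix.mul_apply]
    simp only [Fin.sum_univ_two]
    simp [add_mul]
    abel
  commutes' r := by
    simp [Fin.sum_univ_two, Matrix.algebraMap_matrix_apply, matUnit, ← mul_add, H.add_eq]
  map_star' X := by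
    have key : ∀ i j, star ((X i j : A) * matUnit e f s i j)
        = star (X i j : A) * matUnit e f s j i := by
      intro i j
      obtain ⟨c1, c2, c3⟩ := hB _ (star (X i j)).2
      rw [star_mul, H.star_matUnit]
      exact matUnit_commute c1 c2 c3 _ _
    simp only [star_sum, key]
    rw [Finset.sum_comm]
    simp [Matrix.star_apply]

/-- Two anticommuting self-adjoint involutions span a copy of the real 2 × 2 matrices. Matrices over
any B commuting with them map injectively to A, and `gen` makes the map onto. -/
theorem exists_matrix_equiv {h s : A} (hh : h * h = 1) (hs : s * s = 1) (hsh : s * h = -(h * s))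
    (h_star : star h = h) (s_star : star s = s) {B : StarSubalgebra ℝ A}
    (hB : ∀ b ∈ B, Commute h b ∧ Commute s b)
    (gen : ∀ S : StarSubalgebra ℝ A, h ∈ S → s ∈ S → B ≤ S → S = ⊤) :
    ∃ e : A ≃⋆ₐ[ℝ] Matrix (Fin 2) (Fin 2) B, e h = !![1, 0; 0, -1] ∧ e s = !![0, 1; 1, 0] := by
  have H := IsHalving.of_anticomm hh hs hsh h_star s_star
  have h_eq : h = (2⁻¹ : ℝ) • (1 + h) - (2⁻¹ : ℝ) • (1 - h) := by
    rw [← smul_sub, show (1 + h - (1 - h) : A) = (2 : ℝ) • h by rw [two_smul]; abel, smul_smul]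
    norm_num
  have hc : ∀ b ∈ B, Commute ((2⁻¹ : ℝ) • (1 + h)) b ∧ Commute ((2⁻¹ : ℝ) • (1 - h)) b ∧
      Commute s b := fun b hb => ⟨((Commute.one_left b).add_left (hB b hb).1).smul_left _,
        ((Commute.one_left b).sub_left (hB b hb).1).smul_left _, (hB b hb).2⟩
  generalize (2⁻¹ : ℝ) • (1 + h) = u at H h_eq hc
  generalize (2⁻¹ : ℝ) • (1 - h) = v at H h_eq hc
  set f := H.matHom hc with hf
  have f_apply : ∀ X, f X = ∑ i, ∑ j, (X i j : A) * matUnit u v s i j := fun X => rfl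
  have f_h : f !![1, 0; 0, -1] = h := by
    simp [f_apply, Fin.sum_univ_two, matUnit, h_eq, sub_eq_add_neg]
  have f_s : f !![0, 1; 1, 0] = s := by
    simp [f_apply, Fin.sum_univ_two, matUnit, ← add_mul, H.add_eq]
  have inj : Function.Injective f := by
    rw [injective_iff_map_eq_zero]
    intro X hX
    ext k l
    -- Matrix units extract an entry from the image: X k l = ∑ₘ E_{mk} f(X) E_{lm}.
    have : ∑ m, matUnit u v s m k * f X * matUnit u v s l m = X k l := by
      have : ∀ m i j, matUnit u v s m k * ((X i j : A) * matUnit u v s i j) * matUnit u v s l m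
          = if k = i then (if j = l then (X i j : A) * matUnit u v s m m else 0) else 0 := by
        intro m i j
        obtain ⟨c1, c2, c3⟩ := hc _ (X i j).2
        rw [← mul_assoc, matUnit_commute c1 c2 c3, mul_assoc, mul_assoc, H.matUnit_mul]
        split_ifs <;> simp_all [H.matUnit_mul]
      simp only [f_apply, Finset.mul_sum, Finset.sum_mul, this]
      simp [Fin.sum_univ_two, matUnit, ← mul_add, H.add_eq]
    rw [← this, hX]; simp
  have surj : Function.Surjective f := by
    have : f.range = ⊤ := by
      refine gen _ ⟨_, f_h⟩ ⟨_, f_s⟩ ?_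
      intro b hb
      refine ⟨Matrix.diagonal fun _ => ⟨b, hb⟩, ?_⟩
      change f _ = _
      simp [f_apply, Fin.sum_univ_two, matUnit, ← mul_add, H.add_eq]
    intro a
    have : a ∈ f.range := this ▸ StarSubalgebra.mem_top
    exact this
  refine ⟨(StarAlgEquiv.ofBijective f ⟨inj, surj⟩).symm, ?_, ?_⟩
  · rw [← f_h]; exact StarAlgEquiv.symm_apply_apply (StarAlgEquiv.ofBijective f ⟨inj, surj⟩) _
  · rw [← f_s]; exact StarAlgEquiv.symm_apply_apply (StarAlgEquiv.ofBijective f ⟨inj, surj⟩) _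

end Frames

/-! ### Ordered products of anticommuting elements -/

section Products

variable {A : Type*} [Ring A] [Algebra ℝ A]

theorem mul_prod_ofFn {n : ℕ} {y : Fin n → A} {v : A} {c : Fin n → ℝ}
    (h : ∀ j, v * y j = c j • (y j * v)) :
    v * (List.ofFn y).prod = (∏ j, c j) • ((List.ofFn y).prod * v) := by
  induction n with
  | zero => simp
  | succ n ih =>
    have := ih (y := fun j => y j.succ) (c := fun j => c j.succ) (fun j => h j.succ)
    rw [List.ofFn_succ, List.prod_cons, ← mul_assoc, h, smul_mul_assoc, mul_assoc, this,
      Fin.prod_univ_succ, mul_smul_comm, smul_smul, mul_assoc]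

theorem mul_prod_ofFn_anticomm {n : ℕ} {y : Fin n → A} {v : A}
    (h : ∀ j, v * y j = -(y j * v)) :
    v * (List.ofFn y).prod = (-1 : ℝ) ^ n • ((List.ofFn y).prod * v) := by
  rw [mul_prod_ofFn (c := fun _ => -1) (by simpa using h)]
  simp

/-- The factor y k commutes with itself and anticommutes with the n others. -/
theorem mul_prod_ofFn_self {n : ℕ} {y : Fin (n + 1) → A}
    (h : ∀ i j, i ≠ j → y j * y i = -(y i * y j)) (k : Fin (n + 1)) :
    y k * (List.ofFn y).prod = (-1 : ℝ) ^ n • ((List.ofFn y).prod * y k) := by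
  rw [mul_prod_ofFn (c := fun j => if j = k then 1 else -1)]
  · congr 1
    rw [Finset.prod_ite, Finset.prod_const_one, one_mul, Finset.prod_const,
      Finset.filter_ne' , Finset.card_erase_of_mem (Finset.mem_univ k)]
    simp
  · intro j
    by_cases hj : j = k
    · simp [hj]
    · simpa [hj] using h j k hj

/-- Moving all copies of g to the right costs only signs; which sign results is irrelevant later. -/
theorem prod_ofFn_mul {n : ℕ} {y : Fin n → A} {g : A} (h : ∀ j, g * y j = -(y j * g)) :
    ∃ δ : ℝ, (δ = 1 ∨ δ = -1) ∧
      (List.ofFn fun j => y j * g).prod = δ • ((List.ofFn y).prod * g ^ n) := by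
  induction n with
  | zero => exact ⟨1, by simp⟩
  | succ n ih =>
    obtain ⟨δ, hδ, e⟩ := ih (y := fun j => y j.succ) (fun j => h j.succ)
    have c := mul_prod_ofFn_anticomm (y := fun j => y j.succ) (v := g) (fun j => h j.succ)
    refine ⟨δ * (-1) ^ n, ?_, ?_⟩
    · rcases hδ with rfl | rfl <;> rcases neg_one_pow_eq_or ℝ n with h | h <;> simp [h]
    · rw [List.ofFn_succ, List.prod_cons, e, List.ofFn_succ, List.prod_cons, mul_smul_comm,
        mul_assoc, ← mul_assoc g, c, smul_mul_assoc, mul_smul_comm, smul_smul, pow_succ']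
      simp only [mul_assoc]

/-- The sign of the square of a product of `n` anticommuting elements with square `c`. -/
def prodSign (c : ℝ) : ℕ → ℝ
  | 0 => 1
  | n + 1 => prodSign c n * c * (-1) ^ n

/-- In closed form the sign is cⁿ(-1)^{n(n-1)/2}, whence the period four. -/
theorem prodSign_add_four {c : ℝ} (hc : c * c = 1) (n : ℕ) :
    prodSign c (n + 4) = prodSign c n := by
  have h2 : ((-1 : ℝ) ^ n) * (-1) ^ n = 1 := by rw [← mul_pow]; norm_num
  simp only [prodSign, pow_succ]
  calc _ = prodSign c n * ((c * c) * (c * c)) * (((-1) ^ n * (-1) ^ n) * ((-1) ^ n * (-1) ^ n)) := by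
        ring
    _ = _ := by rw [hc, h2]; ring

theorem prodSign_mod_four {c : ℝ} (hc : c * c = 1) (n : ℕ) :
    prodSign c n = prodSign c (n % 4) := by
  induction n using Nat.strong_induction_on with
  | _ n ih =>
    rcases lt_or_ge n 4 with h | h
    · rw [Nat.mod_eq_of_lt h]
    · obtain ⟨k, rfl⟩ := Nat.exists_eq_add_of_le' h
      rw [prodSign_add_four hc, ih k (by omega), Nat.add_mod_right]

theorem prodSign_one_eq_one {n : ℕ} (h : n % 4 = 0 ∨ n % 4 = 1) : prodSign 1 n = 1 := by
  rw [prodSign_mod_four (by norm_num)]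
  rcases h with h | h <;> rw [h] <;> norm_num [prodSign]

theorem prodSign_one_eq_neg_one {n : ℕ} (h : n % 4 = 2 ∨ n % 4 = 3) : prodSign 1 n = -1 := by
  rw [prodSign_mod_four (by norm_num)]
  rcases h with h | h <;> rw [h] <;> norm_num [prodSign]

theorem prodSign_neg_one_eq_one {n : ℕ} (h : (n + 1) % 4 = 0 ∨ (n + 1) % 4 = 1) :
    prodSign (-1) n = 1 := by
  rw [prodSign_mod_four (by norm_num)]
  have h : n % 4 = 3 ∨ n % 4 = 0 := by omega
  rcases h with h | h <;> rw [h] <;> norm_num [prodSign]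

theorem prodSign_neg_one_eq_neg_one {n : ℕ} (h : (n + 1) % 4 = 2 ∨ (n + 1) % 4 = 3) :
    prodSign (-1) n = -1 := by
  rw [prodSign_mod_four (by norm_num)]
  have h : n % 4 = 1 ∨ n % 4 = 2 := by omega
  rcases h with h | h <;> rw [h] <;> norm_num [prodSign]

theorem prodSign_eq_or {c : ℝ} (hc : c * c = 1) (n : ℕ) : prodSign c n = 1 ∨ prodSign c n = -1 := by
  rcases mul_self_eq_one_iff.1 hc with rfl | rfl
  · rcases (by omega : (n % 4 = 0 ∨ n % 4 = 1) ∨ (n % 4 = 2 ∨ n % 4 = 3)) with h | h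
    · exact .inl (prodSign_one_eq_one h)
    · exact .inr (prodSign_one_eq_neg_one h)
  · rcases (by omega : ((n + 1) % 4 = 0 ∨ (n + 1) % 4 = 1) ∨ ((n + 1) % 4 = 2 ∨ (n + 1) % 4 = 3))
      with h | h
    · exact .inl (prodSign_neg_one_eq_one h)
    · exact .inr (prodSign_neg_one_eq_neg_one h)

theorem IsFrame.prod_mul_self [StarRing A] [StarModule ℝ A] {n : ℕ} {c : ℝ} {y : Fin n → A}
    (h : IsFrame (fun _ => c) y) :
    (List.ofFn y).prod * (List.ofFn y).prod = prodSign c n • 1 := by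
  induction n with
  | zero => simp [prodSign]
  | succ n ih =>
    have h' := ih (h.comp (f := Fin.succ) (Fin.succ_injective n))
    have := mul_prod_ofFn_anticomm (y := fun j => y j.succ) (v := y 0)
      (fun j => h.anticomm _ _ (Fin.succ_ne_zero j))
    have h2 : ((-1 : ℝ) ^ n) * (-1) ^ n = 1 := by rw [← mul_pow]; norm_num
    have this' : (List.ofFn fun j : Fin n => y j.succ).prod * y 0
        = (-1 : ℝ) ^ n • (y 0 * (List.ofFn fun j : Fin n => y j.succ).prod) := by
      rw [this, smul_smul, h2, one_smul]
    rw [List.ofFn_succ, List.prod_cons, mul_assoc, ← mul_assoc _ (y 0), this', smul_mul_assoc,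
      mul_smul_comm, mul_assoc, show (List.ofFn fun j : Fin n => y j.succ).prod *
      (List.ofFn fun j : Fin n => y j.succ).prod = _ from h', mul_smul_comm, mul_one,
      mul_smul_comm, h.mul_self, smul_smul, smul_smul]
    congr 1
    simp only [prodSign]; ring

/-- Each factor contributes c and reversing the order contributes (-1)^{n(n-1)/2}; this is the same
sign as for the square. -/
theorem IsFrame.star_prod [StarRing A] [StarModule ℝ A] {n : ℕ} {c : ℝ} {y : Fin n → A}
    (h : IsFrame (fun _ => c) y) :
    star (List.ofFn y).prod = prodSign c n • (List.ofFn y).prod := by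
  induction n with
  | zero => simp [prodSign]
  | succ n ih =>
    have h' := ih (h.comp (f := Fin.succ) (Fin.succ_injective n))
    have := mul_prod_ofFn_anticomm (y := fun j => y j.succ) (v := y 0)
      (fun j => h.anticomm _ _ (Fin.succ_ne_zero j))
    have h2 : ((-1 : ℝ) ^ n) * (-1) ^ n = 1 := by rw [← mul_pow]; norm_num
    have this' : (List.ofFn fun j : Fin n => y j.succ).prod * y 0
        = (-1 : ℝ) ^ n • (y 0 * (List.ofFn fun j : Fin n => y j.succ).prod) := by
      rw [this, smul_smul, h2, one_smul]
    rw [List.ofFn_succ, List.prod_cons, star_mul, h.star_eq,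
      show star (List.ofFn fun j : Fin n => y j.succ).prod = _ from h', smul_mul_smul_comm]
    change _ • ((List.ofFn fun j : Fin n => y j.succ).prod * y 0) = _
    rw [this', smul_smul]
    congr 1

end Products

/-! ### Splitting off 2 × 2 matrices along a given element J -/

section Splitting

variable {A : Type*} [Ring A] [StarRing A] [Algebra ℝ A] [StarModule ℝ A]
variable {ι κ : Type*}

theorem commute_of_mem_frameSpan {z : ι → A} {g : A} {c : ℝ} (hg : star g = c • g)
    (h : ∀ i, Commute g (z i)) {b : A} (hb : b ∈ frameSpan z) : Commute g b := by
  have : frameSpan z ≤ StarSubalgebra.centralizer ℝ {g} := by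
    refine StarAlgebra.adjoin_le ?_
    rintro _ ⟨i, rfl⟩
    rw [SetLike.mem_coe, StarSubalgebra.mem_centralizer_iff]
    rintro _ rfl
    exact ⟨h i, by rw [hg]; exact (h i).smul_left c⟩
  exact ((StarSubalgebra.mem_centralizer_iff ℝ).1 (this hb) g rfl).1

/-- The element w = z_a z_b is a self-adjoint involution that commutes with the remaining
generators. Those anticommuting with J are replaced by their product with w; they then commute with
both J and w, and keep their signs because the twist has γ = δ = 1. `hJa` ensures that z_a, hence
z_b, is recovered from J, w and the rest. -/
theorem IsFrame.exists_split {s : ι → ℝ} {z : ι → A} (hz : IsFrame s z) (gen : StarGenerates z)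
    {a b : ι} (hab : a ≠ b) (ha : s a = 1) (hb : s b = -1) {f : κ → ι}
    (hf : Function.Injective f) (hfa : ∀ k, f k ≠ a) (hfb : ∀ k, f k ≠ b)
    (hcov : ∀ i, i = a ∨ i = b ∨ ∃ k, f k = i) {J : A} {ε : ℝ} (hε : ε = 1 ∨ ε = -1)
    (hJJ : J * J = ε • 1) (hJs : star J = ε • J) (hJw : J * (z a * z b) = -(z a * z b * J))
    (T : κ → Prop) [DecidablePred T] (hT : ∀ k, T k → J * z (f k) = -(z (f k) * J))
    (hT' : ∀ k, ¬ T k → J * z (f k) = z (f k) * J)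
    (hJa : ∀ S : StarSubalgebra ℝ A, J ∈ S → z a * z b ∈ S → (∀ k, z (f k) ∈ S) → z a ∈ S) :
    ∃ (B : StarSubalgebra ℝ A) (y : κ → B), IsFrame (s ∘ f) y ∧ StarGenerates y ∧
      ∃ e : A ≃⋆ₐ[ℝ] Matrix (Fin 2) (Fin 2) B,
        (ε = 1 → e J = !![1, 0; 0, -1]) ∧ (ε = -1 → e J = !![0, -1; 1, 0]) := by
  have hw_comm : ∀ k, (z a * z b) * z (f k) = z (f k) * (z a * z b) := fun k => by
    rw [mul_assoc, hz.anticomm _ _ (hfb k), mul_neg, ← mul_assoc, hz.anticomm _ _ (hfa k),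
      neg_mul, neg_neg, mul_assoc]
  have hww : (z a * z b) * (z a * z b) = 1 := by
    rw [mul_assoc, ← mul_assoc (z b), hz.anticomm a b hab, neg_mul, mul_neg, mul_assoc, hz.mul_self,
      mul_smul_comm, mul_one, mul_smul_comm, hz.mul_self, ha, hb]
    simp
  have hws : star (z a * z b) = z a * z b := by
    rw [star_mul, hz.star_eq, hz.star_eq, ha, hb, smul_mul_smul_comm, hz.anticomm a b hab]
    simp
  have haw : z a * (z a * z b) = z b := by
    rw [← mul_assoc, hz.mul_self, ha]; simp
  generalize z a * z b = w at *
  have hfr := (hz.comp hf).twist T (g := w) (γ := 1) (δ := 1) (by norm_num) (by norm_num)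
    (by simpa using hww) (by simpa using hws) (fun k _ => by simpa using hw_comm k)
    (fun k _ => hw_comm k)
  have hfr := hfr.congr (t := s ∘ f) (fun k => by simp)
  set zt : κ → A := fun k => if T k then (z ∘ f) k * w else (z ∘ f) k with hzt
  have hBJ : ∀ x ∈ frameSpan zt, Commute J x := fun x hx => by
    refine commute_of_mem_frameSpan hJs (fun k => ?_) hx
    change J * zt k = zt k * J
    by_cases hk : T k
    · simp only [hzt, hk, if_true, Function.comp]
      rw [← mul_assoc, hT k hk, neg_mul, mul_assoc, hJw, mul_neg, neg_neg, mul_assoc]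
    · simpa [hzt, hk] using hT' k hk
  have hBw : ∀ x ∈ frameSpan zt, Commute w x := fun x hx => by
    refine commute_of_mem_frameSpan (c := 1) (by simpa using hws) (fun k => ?_) hx
    change w * zt k = zt k * w
    by_cases hk : T k
    · simp only [hzt, hk, if_true, Function.comp]
      rw [← mul_assoc, hw_comm]
    · simpa [hzt, hk] using hw_comm k
  have hgen : ∀ S : StarSubalgebra ℝ A, J ∈ S → w ∈ S → frameSpan zt ≤ S → S = ⊤ := by
    intro S hJ hw hS
    have hzf : ∀ k, z (f k) ∈ S := by
      intro k
      have hk' : zt k ∈ S := hS (StarAlgebra.subset_adjoin ℝ _ ⟨k, rfl⟩)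
      by_cases hk : T k
      · have : z (f k) = zt k * w := by simp [hzt, hk, mul_assoc, hww]
        rw [this]; exact mul_mem hk' hw
      · simpa [hzt, hk] using hk'
    have hza := hJa S hJ hw hzf
    refine gen S fun i => ?_
    rcases hcov i with rfl | rfl | ⟨k, rfl⟩
    · exact hza
    · rw [← haw]; exact mul_mem hza hw
    · exact hzf k
  refine ⟨frameSpan zt, frameSpanGen zt, IsFrame.of_coe hfr, starGenerates_frameSpanGen _, ?_⟩
  rcases hε with rfl | rfl
  · obtain ⟨e, h1, h2⟩ := exists_matrix_equiv (h := J) (s := w) (by simpa using hJJ) hww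
      (by rw [hJw, neg_neg]) (by simpa using hJs) hws (fun x hx => ⟨hBJ x hx, hBw x hx⟩) hgen
    exact ⟨e, fun _ => h1, fun h => by norm_num at h⟩
  -- For ε = -1 the anticommuting self-adjoint involutions are w and J w, and J = (J w) w becomes
  -- [[0,1],[1,0]] · diag(1,-1).
  · have hJJ' : J * J = -1 := by simpa using hJJ
    have e1 : (J * w) * w = J := by rw [mul_assoc, hww, mul_one]
    have e2 : w * (J * w) = -J := by
      rw [hJw, mul_neg, ← mul_assoc, hww, one_mul]
    obtain ⟨e, h1, h2⟩ := exists_matrix_equiv (h := w) (s := J * w) hww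
      (by rw [mul_assoc, e2, mul_neg, hJJ', neg_neg]) (by rw [e1, e2, neg_neg]) hws
      (by rw [star_mul, hws, hJs, hJw]; simp)
      (fun x hx => ⟨hBw x hx, (hBJ x hx).mul_left (hBw x hx)⟩)
      (fun S hw hs hS => hgen S (e1 ▸ mul_mem hs hw) hw hS)
    refine ⟨e, fun h => by norm_num at h, fun _ => ?_⟩
    rw [← e1, map_mul, h1, h2]
    simp

end Splitting

instance : StarModule ℝ ℍ[ℝ] := ⟨fun r a => by ext <;> simp⟩

/-! ### Star isomorphisms of matrix algebras -/

section MatrixStar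

variable {K L : Type*} [Ring K] [StarRing K] [Algebra ℝ K] [Ring L] [StarRing L] [Algebra ℝ L]

/-- A star isomorphism applied entrywise. -/
def mapMatrixStar {m : Type*} [Fintype m] [DecidableEq m] (e : K ≃⋆ₐ[ℝ] L) :
    Matrix m m K ≃⋆ₐ[ℝ] Matrix m m L :=
  StarAlgEquiv.ofAlgEquiv e.toAlgEquiv.mapMatrix fun X => by
    ext i j
    exact map_star e (X j i)

/-- Matrices over a product of star algebras. -/
def matrixProdStar {m : Type*} [Fintype m] [DecidableEq m] :
    Matrix m m (K × L) ≃⋆ₐ[ℝ] Matrix m m K × Matrix m m L where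
  toFun X := (X.map Prod.fst, X.map Prod.snd)
  invFun X := Matrix.of fun i j => (X.1 i j, X.2 i j)
  left_inv X := rfl
  right_inv X := rfl
  map_mul' X Y := by
    ext i j <;> simp [Matrix.mul_apply, Prod.fst_sum, Prod.snd_sum]
  map_add' X Y := rfl
  map_smul' r X := rfl
  map_star' X := rfl

/-- Reindexing is a star isomorphism. -/
def reindexStar {m n : Type*} [Fintype m] [DecidableEq m] [Fintype n] [DecidableEq n]
    (e : m ≃ n) : Matrix m m K ≃⋆ₐ[ℝ] Matrix n n K :=
  StarAlgEquiv.ofAlgEquiv (Matrix.reindexAlgEquiv ℝ K e) fun _ => rfl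

/-- `2 × 2` matrices of `n × n` matrices as block matrices. -/
def blockStar {n : Type*} [Fintype n] [DecidableEq n] :
    Matrix (Fin 2) (Fin 2) (Matrix n n K) ≃⋆ₐ[ℝ] Matrix (n ⊕ n) (n ⊕ n) K where
  toFun X := Matrix.fromBlocks (X 0 0) (X 0 1) (X 1 0) (X 1 1)
  invFun Y := !![Y.toBlocks₁₁, Y.toBlocks₁₂; Y.toBlocks₂₁, Y.toBlocks₂₂]
  left_inv X := by ext i j; fin_cases i <;> fin_cases j <;> rfl
  right_inv Y := Matrix.fromBlocks_toBlocks Y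
  map_mul' X Y := by
    rw [Matrix.fromBlocks_multiply]
    simp [Matrix.mul_apply, Fin.sum_univ_two]
  map_add' X Y := by rw [Matrix.fromBlocks_add]; rfl
  map_smul' r X := by
    ext i j
    rcases i with i | i <;> rcases j with j | j <;> rfl
  map_star' X := by
    change _ = (Matrix.fromBlocks _ _ _ _).conjTranspose
    rw [Matrix.fromBlocks_conjTranspose]; rfl

theorem blockStar_apply {n : Type*} [Fintype n] [DecidableEq n]
    (X : Matrix (Fin 2) (Fin 2) (Matrix n n K)) :
    blockStar X = Matrix.fromBlocks (X 0 0) (X 0 1) (X 1 0) (X 1 1) := rfl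

/-- A star algebra as `1 × 1` matrices over itself. -/
def oneByOneStar {K : Type} [Ring K] [StarRing K] [Algebra ℝ K] : K ≃⋆ₐ[ℝ] Mat 1 K where
  toFun x := Matrix.of fun _ _ => x
  invFun X := X 0 0
  left_inv x := rfl
  right_inv X := by ext i j; rw [Subsingleton.elim i 0, Subsingleton.elim j 0]; rfl
  map_mul' x y := by ext i j; simp [Matrix.mul_apply]
  map_add' x y := rfl
  map_smul' r x := rfl
  map_star' x := rfl

/-- Index equivalence for doubling. -/
def finDouble (m : ℕ) : Fin (2 ^ m) ⊕ Fin (2 ^ m) ≃ Fin (2 ^ (m + 1)) :=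
  finSumFinEquiv.trans (finCongr (by ring))

/-- The product of two star isomorphisms. -/
def prodStar {K' L' : Type*} [Ring K'] [StarRing K'] [Algebra ℝ K'] [Ring L'] [StarRing L']
    [Algebra ℝ L'] (e : K ≃⋆ₐ[ℝ] K') (f : L ≃⋆ₐ[ℝ] L') : (K × L) ≃⋆ₐ[ℝ] K' × L' where
  toFun x := (e x.1, f x.2)
  invFun y := (e.symm y.1, f.symm y.2)
  left_inv x := by simp
  right_inv x := by simp
  map_mul' x y := by simp
  map_add' x y := by simp
  map_smul' r x := by simp
  map_star' x := by ext <;> simp [map_star]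

end MatrixStar

/-! ### The star isomorphism types and their behaviour under doubling -/

section Types

/-- The star isomorphism types of Clifford algebras in terms of `d = p - q` and `N = p + q`. -/
def HasCliffordType (d : ℤ) (N : ℕ) (A : Type*) [Ring A] [StarRing A] [Algebra ℝ A] : Prop :=
  ((d % 8 = 0 ∨ d % 8 = 2) → ∃ m, N = 2 * m ∧ Nonempty (A ≃⋆ₐ[ℝ] Mat (2 ^ m) ℝ)) ∧
  (d % 8 = 1 → ∃ m, N = 2 * m + 1 ∧ Nonempty (A ≃⋆ₐ[ℝ] Mat (2 ^ m) ℝ × Mat (2 ^ m) ℝ)) ∧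
  ((d % 8 = 3 ∨ d % 8 = 7) → ∃ m, N = 2 * m + 1 ∧ Nonempty (A ≃⋆ₐ[ℝ] Mat (2 ^ m) ℂ)) ∧
  ((d % 8 = 4 ∨ d % 8 = 6) → ∃ m, N = 2 * m + 2 ∧ Nonempty (A ≃⋆ₐ[ℝ] Mat (2 ^ m) ℍ[ℝ])) ∧
  (d % 8 = 5 → ∃ m, N = 2 * m + 3 ∧ Nonempty (A ≃⋆ₐ[ℝ] Mat (2 ^ m) ℍ[ℝ] × Mat (2 ^ m) ℍ[ℝ]))

variable {A B : Type*} [Ring A] [StarRing A] [Algebra ℝ A] [Ring B] [StarRing B] [Algebra ℝ B]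
variable {K : Type} [Ring K] [StarRing K] [Algebra ℝ K]

/-- The list is invariant under d ↦ 2 - d, the effect on p - q of exchanging the types (p+1,q) and
(q+1,p). -/
theorem HasCliffordType.congr {d : ℤ} {N : ℕ} (h : HasCliffordType d N A) {d' : ℤ}
    (hd : d % 8 = d' % 8 ∨ d % 8 = (2 - d') % 8) : HasCliffordType d' N A :=
  ⟨fun h' => h.1 (by omega), fun h' => h.2.1 (by omega), fun h' => h.2.2.1 (by omega),
    fun h' => h.2.2.2.1 (by omega), fun h' => h.2.2.2.2 (by omega)⟩

/-- Block form of `2 × 2` matrices over a matrix algebra. -/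
def blockEquiv {n : ℕ} (e : A ≃⋆ₐ[ℝ] Matrix (Fin 2) (Fin 2) B) (f : B ≃⋆ₐ[ℝ] Mat n K) :
    A ≃⋆ₐ[ℝ] Matrix (Fin n ⊕ Fin n) (Fin n ⊕ Fin n) K :=
  (e.trans (mapMatrixStar f)).trans blockStar

/-- Block form of `2 × 2` matrices over the square of a matrix algebra. -/
def blockEquivProd {n : ℕ} (e : A ≃⋆ₐ[ℝ] Matrix (Fin 2) (Fin 2) B)
    (f : B ≃⋆ₐ[ℝ] Mat n K × Mat n K) :
    A ≃⋆ₐ[ℝ] Matrix (Fin n ⊕ Fin n) (Fin n ⊕ Fin n) K ×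
      Matrix (Fin n ⊕ Fin n) (Fin n ⊕ Fin n) K :=
  ((e.trans (mapMatrixStar f)).trans matrixProdStar).trans (prodStar blockStar blockStar)

/-- The standard skew form with block matrix `[[0, -1], [1, 0]]`. -/
def skewMatrix (n : ℕ) (F : Type*) [Ring F] : Matrix (Fin n ⊕ Fin n) (Fin n ⊕ Fin n) F :=
  Matrix.fromBlocks 0 (-1) 1 0

theorem blockEquiv_sign {n : ℕ} {e : A ≃⋆ₐ[ℝ] Matrix (Fin 2) (Fin 2) B} {J : A}
    (h : e J = !![1, 0; 0, -1]) (f : B ≃⋆ₐ[ℝ] Mat n K) : blockEquiv e f J = signMatrix n K := by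
  change blockStar ((e J).map f) = _
  rw [h, blockStar_apply]
  simp [signMatrix]

theorem blockEquiv_skew {n : ℕ} {e : A ≃⋆ₐ[ℝ] Matrix (Fin 2) (Fin 2) B} {J : A}
    (h : e J = !![0, -1; 1, 0]) (f : B ≃⋆ₐ[ℝ] Mat n K) : blockEquiv e f J = skewMatrix n K := by
  change blockStar ((e J).map f) = _
  rw [h, blockStar_apply]
  simp [skewMatrix]

theorem blockEquivProd_sign {n : ℕ} {e : A ≃⋆ₐ[ℝ] Matrix (Fin 2) (Fin 2) B} {J : A}
    (h : e J = !![1, 0; 0, -1]) (f : B ≃⋆ₐ[ℝ] Mat n K × Mat n K) :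
    blockEquivProd e f J = (signMatrix n K, signMatrix n K) := by
  change (blockStar (((e J).map f).map Prod.fst), blockStar (((e J).map f).map Prod.snd)) = _
  rw [h, blockStar_apply, blockStar_apply]
  simp [signMatrix]

theorem blockEquivProd_skew {n : ℕ} {e : A ≃⋆ₐ[ℝ] Matrix (Fin 2) (Fin 2) B} {J : A}
    (h : e J = !![0, -1; 1, 0]) (f : B ≃⋆ₐ[ℝ] Mat n K × Mat n K) :
    blockEquivProd e f J = (skewMatrix n K, skewMatrix n K) := by
  change (blockStar (((e J).map f).map Prod.fst), blockStar (((e J).map f).map Prod.snd)) = _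
  rw [h, blockStar_apply, blockStar_apply]
  simp [skewMatrix]

theorem HasCliffordType.double {d : ℤ} {N : ℕ} (h : HasCliffordType d N B)
    (e : A ≃⋆ₐ[ℝ] Matrix (Fin 2) (Fin 2) B) : HasCliffordType d (N + 2) A := by
  obtain ⟨h1, h2, h3, h4, h5⟩ := h
  refine ⟨fun hd => ?_, fun hd => ?_, fun hd => ?_, fun hd => ?_, fun hd => ?_⟩
  · obtain ⟨m, hm, ⟨f⟩⟩ := h1 hd
    exact ⟨m + 1, by omega, ⟨(blockEquiv e f).trans (reindexStar (finDouble m))⟩⟩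
  · obtain ⟨m, hm, ⟨f⟩⟩ := h2 hd
    exact ⟨m + 1, by omega, ⟨(blockEquivProd e f).trans
      (prodStar (reindexStar (finDouble m)) (reindexStar (finDouble m)))⟩⟩
  · obtain ⟨m, hm, ⟨f⟩⟩ := h3 hd
    exact ⟨m + 1, by omega, ⟨(blockEquiv e f).trans (reindexStar (finDouble m))⟩⟩
  · obtain ⟨m, hm, ⟨f⟩⟩ := h4 hd
    exact ⟨m + 1, by omega, ⟨(blockEquiv e f).trans (reindexStar (finDouble m))⟩⟩
  · obtain ⟨m, hm, ⟨f⟩⟩ := h5 hd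
    exact ⟨m + 1, by omega, ⟨(blockEquivProd e f).trans
      (prodStar (reindexStar (finDouble m)) (reindexStar (finDouble m)))⟩⟩

end Types

/-! ### Changes of frame -/

section Changes

/-- The signs of a frame of type `(p,q)`. -/
abbrev stdSign (p q : ℕ) : Fin p ⊕ Fin q → ℝ := Sum.elim (fun _ => 1) (fun _ => -1)

variable {A : Type*} [Ring A] [StarRing A] [Algebra ℝ A] [StarModule ℝ A]

/-- Index map of `exists_swap`. -/
def swapIndex (p q : ℕ) : Fin (q + 1) ⊕ Fin p → Fin (p + 1) ⊕ Fin q :=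
  Sum.elim (Fin.cases (Sum.inl 0) (fun j => Sum.inr j)) (fun i => Sum.inl i.succ)

theorem swapIndex_injective (p q : ℕ) : Function.Injective (swapIndex p q) := by
  rintro (i | i) (j | j) h
  · induction i using Fin.cases <;> induction j using Fin.cases <;> simp_all [swapIndex]
  · induction i using Fin.cases <;> simp_all [swapIndex, eq_comm]
  · induction j using Fin.cases <;> simp_all [swapIndex]
  · simp_all [swapIndex]

/-- A frame of type `(p+1,q)` yields one of type `(q+1,p)`. -/
theorem exists_swap {p q : ℕ} {z : Fin (p + 1) ⊕ Fin q → A} (hz : IsFrame (stdSign (p + 1) q) z)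
    (gen : StarGenerates z) :
    ∃ z' : Fin (q + 1) ⊕ Fin p → A, IsFrame (stdSign (q + 1) p) z' ∧ StarGenerates z' := by
  classical
  -- Multiplying every other generator by the positive generator g reverses its sign (δγ = -1),
  -- while g itself stays positive.
  set g := z (Sum.inl 0) with hg
  have hgg : g * g = 1 := by simpa using hz.mul_self (Sum.inl 0)
  have ht := hz.twist (fun i => i ≠ Sum.inl 0) (g := g) (γ := 1) (δ := -1) (by norm_num)
    (by norm_num) (by simpa using hgg) (by simpa using hz.star_eq (Sum.inl 0))
    (fun i hi => by simpa using hz.anticomm i (Sum.inl 0) hi) (fun i hi => by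
      rw [not_not.1 hi])
  refine ⟨_, (ht.comp (swapIndex_injective p q)).congr ?_, ?_⟩
  · rintro (i | i)
    · induction i using Fin.cases <;> simp [swapIndex]
    · simp [swapIndex]
  · intro S hS
    have hgS : g ∈ S := by simpa [swapIndex] using hS (Sum.inl 0)
    refine gen S ?_
    rintro (i | i)
    · induction i using Fin.cases with
      | zero => exact hgS
      | succ i =>
        have := mul_mem (hS (Sum.inr i)) hgS
        simpa [swapIndex, mul_assoc, hgg] using this
    · have := mul_mem (hS (Sum.inl i.succ)) hgS
      simpa [swapIndex, mul_assoc, hgg] using this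

/-- Index map of `exists_shift`. -/
def shiftIndex (q : ℕ) : Fin 4 ⊕ Fin q → Fin 0 ⊕ Fin (4 + q) :=
  Sum.elim (fun i => Sum.inr (Fin.castAdd q i)) (fun i => Sum.inr (Fin.natAdd 4 i))

theorem shiftIndex_injective (q : ℕ) : Function.Injective (shiftIndex q) := by
  rintro (i | i) (j | j) h <;> simp_all [shiftIndex, Fin.ext_iff] <;> omega

/-- A frame of type `(0,4+q)` yields one of type `(4,q)`. -/
theorem exists_shift {q : ℕ} {z : Fin 0 ⊕ Fin (4 + q) → A} (hz : IsFrame (stdSign 0 (4 + q)) z)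
    (gen : StarGenerates z) :
    ∃ z' : Fin 4 ⊕ Fin q → A, IsFrame (stdSign 4 q) z' ∧ StarGenerates z' := by
  classical
  -- The product g of these four generators is a self-adjoint involution that anticommutes with them
  -- and commutes with the others, so the twist by g makes exactly these four positive.
  set y : Fin 4 → A := fun k => z (Sum.inr (Fin.castAdd q k)) with hy
  have hyf : IsFrame (fun _ => (-1 : ℝ)) y :=
    hz.comp (f := fun k => Sum.inr (Fin.castAdd q k))
      (fun a b h => by simpa using h)
  set g := (List.ofFn y).prod with hg
  have hgg : g * g = 1 := by
    rw [hg, hyf.prod_mul_self, prodSign_neg_one_eq_one (by norm_num), one_smul]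
  have hgs : star g = g := by
    rw [hg, hyf.star_prod, prodSign_neg_one_eq_one (by norm_num), one_smul]
  have hgy : ∀ k, g * y k = -(y k * g) := by
    intro k
    have := mul_prod_ofFn_self hyf.anticomm k
    rw [← hg] at this
    rw [this]; norm_num
  have hgz : ∀ j : Fin q, g * z (Sum.inr (Fin.natAdd 4 j)) = z (Sum.inr (Fin.natAdd 4 j)) * g := by
    intro j
    have := mul_prod_ofFn_anticomm (y := y) (v := z (Sum.inr (Fin.natAdd 4 j)))
      (fun k => hz.anticomm _ _ (by simp [Fin.ext_iff]; omega))
    rw [← hg] at this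
    rw [this]; norm_num
  have ht := hz.twist (fun i => ∃ k, i = Sum.inr (Fin.castAdd q k)) (g := g) (γ := 1) (δ := -1)
    (by norm_num) (by norm_num) (by simpa using hgg) (by simpa using hgs)
    (by rintro _ ⟨k, rfl⟩; simpa using hgy k) (by
      rintro (i | i) hi
      · exact i.elim0
      · induction i using Fin.addCases with
        | left i => exact (hi ⟨i, rfl⟩).elim
        | right i => exact hgz i)
  have hne : ∀ (i : Fin q), ¬ ∃ k : Fin 4, Fin.natAdd 4 i = Fin.castAdd q k := by
    rintro i ⟨k, hk⟩
    have := Fin.ext_iff.1 hk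
    simp at this; omega
  refine ⟨_, (ht.comp (shiftIndex_injective q)).congr ?_, ?_⟩
  · rintro (i | i)
    · simp [shiftIndex]
    · simp [shiftIndex, hne]
  · intro S hS
    have h1 : ∀ k, y k * g ∈ S := fun k => by simpa [shiftIndex] using hS (Sum.inl k)
    -- Up to sign, g is the product of the four twisted generators, since that product is ± g · g⁴
    -- and g⁴ = 1.
    have hgS : g ∈ S := by
      obtain ⟨δ, hδ, e⟩ := prod_ofFn_mul hgy
      rw [← hg, show g * g ^ 4 = g by
        rw [show g ^ 4 = (g * g) * (g * g) by noncomm_ring, hgg]; simp] at e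
      have h2 : (List.ofFn fun j => y j * g).prod ∈ S :=
        list_prod_mem fun x hx => by
          obtain ⟨k, rfl⟩ := List.mem_ofFn.1 hx
          exact h1 k
      have : g = δ • (List.ofFn fun j => y j * g).prod := by
        rw [e, smul_smul]; rcases hδ with rfl | rfl <;> norm_num
      rw [this]; exact SMulMemClass.smul_mem δ h2
    refine gen S ?_
    rintro (i | i)
    · exact i.elim0
    · induction i using Fin.addCases with
      | left i => simpa [mul_assoc, hgg] using mul_mem (h1 i) hgS
      | right i => simpa [shiftIndex, hne] using hS (Sum.inr i)

/-- Splitting a hyperbolic plane off a frame. -/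
theorem exists_hyperbolic_split {p q : ℕ} {z : Fin (p + 1) ⊕ Fin (q + 1) → A}
    (hz : IsFrame (stdSign (p + 1) (q + 1)) z) (gen : StarGenerates z) :
    ∃ (B : StarSubalgebra ℝ A) (y : Fin p ⊕ Fin q → B), IsFrame (stdSign p q) y ∧
      StarGenerates y ∧ Nonempty (A ≃⋆ₐ[ℝ] Matrix (Fin 2) (Fin 2) B) := by
  -- With J a single positive generator, all remaining generators anticommute with J and are
  -- corrected by w.
  obtain ⟨B, y, h1, h2, e, -⟩ := hz.exists_split gen (a := Sum.inl 0) (b := Sum.inr 0) (by simp)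
    rfl rfl (f := Sum.map Fin.succ Fin.succ)
    ((Fin.succ_injective p).sumMap (Fin.succ_injective q))
    (by rintro (k | k) <;> simp) (by rintro (k | k) <;> simp)
    (by
      rintro (i | i) <;> induction i using Fin.cases <;> simp)
    (J := z (Sum.inl 0)) (ε := 1) (.inl rfl) (by simpa using hz.mul_self (Sum.inl 0))
    (by simpa using hz.star_eq (Sum.inl 0))
    (by
      rw [mul_assoc _ _ (z (Sum.inl 0)), hz.anticomm (Sum.inl 0) (Sum.inr 0) (by simp)]
      simp)
    (fun _ => True)
    (fun k _ => hz.anticomm _ _ (by rcases k with k | k <;> simp))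
    (fun k hk => (hk trivial).elim)
    (fun S hJ _ _ => hJ)
  exact ⟨B, y, h1.congr (by rintro (k | k) <;> rfl), h2, ⟨e⟩⟩

end Changes

/-! ### Small Clifford algebras -/

section Small

variable {A : Type*} [Ring A] [StarRing A] [Algebra ℝ A] [StarModule ℝ A] [Nontrivial A]

omit [Nontrivial A] in
theorem StarGenerates.surjective {ι : Type*} {z : ι → A} (gen : StarGenerates z) {K : Type*}
    [Ring K] [StarRing K] [Algebra ℝ K] [StarModule ℝ K] (f : K →⋆ₐ[ℝ] A) (h : ∀ i, ∃ k, f k = z i) :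
    Function.Surjective f := by
  have : f.range = ⊤ := gen _ h
  intro a
  have : a ∈ f.range := this ▸ StarSubalgebra.mem_top
  exact this

/-- The star homomorphism from `ℝ`. -/
def ofRealStar (A : Type*) [Ring A] [StarRing A] [Algebra ℝ A] [StarModule ℝ A] : ℝ →⋆ₐ[ℝ] A :=
  { Algebra.ofId ℝ A with
    map_star' := fun x => algebraMap_star_comm x }

/-- The star homomorphism from `ℂ` attached to a skew square root of `-1`. -/
def ofComplexStar {i : A} (hi : i * i = -1) (hs : star i = -i) : ℂ →⋆ₐ[ℝ] A :=
  { Complex.liftAux i hi with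
    map_star' := fun x => by
      change Complex.liftAux i hi (star x) = star (Complex.liftAux i hi x)
      simp [Complex.liftAux_apply, hs, ← algebraMap_star_comm] }

/-- The star homomorphism from `ℍ` attached to anticommuting skew square roots of `-1`. -/
def ofQuaternionStar {i j : A} (hi : i * i = -1) (hj : j * j = -1) (hij : j * i = -(i * j))
    (his : star i = -i) (hjs : star j = -j) : ℍ[ℝ] →⋆ₐ[ℝ] A :=
  let b : QuaternionAlgebra.Basis A (-1 : ℝ) 0 (-1) :=
    ⟨i, j, i * j, by simp [hi], by simp [hj], rfl, by simp [hij]⟩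
  { b.liftHom with
    map_star' := fun x => by
      change b.lift (star x) = star (b.lift x)
      have e : star x = ⟨x.re, -x.imI, -x.imJ, -x.imK⟩ := by ext <;> simp
      refine (congrArg b.lift e).trans ?_
      simp [QuaternionAlgebra.Basis.lift, b, his, hjs, hij, ← algebraMap_star_comm] }

/-- A star homomorphism and a commuting self-adjoint involution give one from the square. -/
def prodStarHom {K : Type*} [Ring K] [StarRing K] [Algebra ℝ K] (φ : K →⋆ₐ[ℝ] A) {e f : A}
    (ef : e + f = 1) (ee : e * e = e) (ff : f * f = f) (e_f : e * f = 0) (f_e : f * e = 0)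
    (es : star e = e) (fs : star f = f) (ce : ∀ k, e * φ k = φ k * e)
    (cf : ∀ k, f * φ k = φ k * f) : K × K →⋆ₐ[ℝ] A where
  toFun x := φ x.1 * e + φ x.2 * f
  map_one' := by simp [ef]
  map_zero' := by simp
  map_add' x y := by simp [add_mul]; abel
  map_mul' x y := by
    have h1 : ∀ a b, φ a * e * (φ b * e) = φ a * φ b * e := fun a b => by
      rw [mul_assoc, ← mul_assoc e, ce, mul_assoc, ee, mul_assoc]
    have h2 : ∀ a b, φ a * f * (φ b * f) = φ a * φ b * f := fun a b => by
      rw [mul_assoc, ← mul_assoc f, cf, mul_assoc, ff, mul_assoc]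
    have h3 : ∀ a b, φ a * e * (φ b * f) = 0 := fun a b => by
      rw [mul_assoc, ← mul_assoc e, ce, mul_assoc, e_f, mul_zero, mul_zero]
    have h4 : ∀ a b, φ a * f * (φ b * e) = 0 := fun a b => by
      rw [mul_assoc, ← mul_assoc f, cf, mul_assoc, f_e, mul_zero, mul_zero]
    simp [add_mul, mul_add, h1, h2, h3, h4]
  commutes' r := by
    have : ∀ r : ℝ, φ (algebraMap ℝ K r) = algebraMap ℝ A r := fun r => φ.toAlgHom.commutes r
    simp [this, ← mul_add, ef]
  map_star' x := by
    simp [es, fs, map_star]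
    rw [← map_star, ← map_star, ce, cf]

-- The idempotents (1 ± c)/2 commute with the image of φ, so (x, y) ↦ φ(x)(1 + c)/2 + φ(y)(1 - c)/2
-- is a homomorphism.
omit [Nontrivial A] in
theorem exists_prodStarHom {K : Type*} [Ring K] [StarRing K] [Algebra ℝ K] (φ : K →⋆ₐ[ℝ] A) {c : A}
    (hc : c * c = 1) (cs : star c = c) (hcφ : ∀ k, c * φ k = φ k * c) :
    ∃ ψ : K × K →⋆ₐ[ℝ] A, (∀ k, ψ (k, k) = φ k) ∧ ψ (1, -1) = c := by
  have n1 : (1 + c) * (1 + c) = (2 : ℝ) • (1 + c) := by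
    simp only [two_smul, add_mul, mul_add, hc, one_mul, mul_one]; abel
  have n2 : (1 - c) * (1 - c) = (2 : ℝ) • (1 - c) := by
    simp only [two_smul, sub_mul, mul_sub, hc, one_mul, mul_one]; abel
  have ef : ((2⁻¹ : ℝ) • (1 + c) + (2⁻¹ : ℝ) • (1 - c) : A) = 1 := by
    rw [← smul_add, show (1 + c + (1 - c) : A) = (2 : ℝ) • 1 by rw [two_smul]; abel, smul_smul]
    norm_num
  refine ⟨prodStarHom φ (e := (2⁻¹ : ℝ) • (1 + c)) (f := (2⁻¹ : ℝ) • (1 - c)) ef ?_ ?_ ?_ ?_ ?_ ?_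
    ?_ ?_, ?_, ?_⟩
  · rw [smul_mul_smul_comm, n1, smul_smul]; norm_num
  · rw [smul_mul_smul_comm, n2, smul_smul]; norm_num
  · rw [smul_mul_smul_comm, show (1 + c) * (1 - c) = 0 by simp [add_mul, mul_sub, hc]; abel,
      smul_zero]
  · rw [smul_mul_smul_comm, show (1 - c) * (1 + c) = 0 by simp [sub_mul, mul_add, hc], smul_zero]
  · simp [cs]
  · simp [cs]
  · intro k; rw [smul_mul_assoc, mul_smul_comm, add_mul, mul_add, hcφ]; simp
  · intro k; rw [smul_mul_assoc, mul_smul_comm, sub_mul, mul_sub, hcφ]; simp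
  · intro k
    change φ k * _ + φ k * _ = _
    rw [← mul_add, ef, mul_one]
  · change φ 1 * _ + φ (-1) * _ = _
    rw [map_neg, map_one, one_mul, neg_one_mul, ← sub_eq_add_neg, ← smul_sub,
      show (1 + c - (1 - c) : A) = (2 : ℝ) • c by rw [two_smul]; abel, smul_smul]
    norm_num

-- A square K × K is not simple, so injectivity has to come from a dimension count.
omit [Nontrivial A] [StarModule ℝ A] in
theorem bijective_of_finrank_le {K : Type*} [Ring K] [StarRing K] [Algebra ℝ K]
    [FiniteDimensional ℝ K] (f : K →⋆ₐ[ℝ] A) (hs : Function.Surjective f)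
    (h : Module.finrank ℝ K ≤ Module.finrank ℝ A) : Function.Bijective f := by
  refine ⟨?_, hs⟩
  have hs' : Function.Surjective f.toAlgHom.toLinearMap := hs
  have : FiniteDimensional ℝ A := Module.Finite.of_surjective _ hs'
  have hr : LinearMap.range f.toAlgHom.toLinearMap = ⊤ := LinearMap.range_eq_top.2 hs'
  have := f.toAlgHom.toLinearMap.finrank_range_add_finrank_ker
  rw [hr, finrank_top] at this
  have hk : LinearMap.ker f.toAlgHom.toLinearMap = ⊥ := Submodule.finrank_eq_zero.1 (by omega)
  exact LinearMap.ker_eq_bot.1 hk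

theorem equiv_real {z : Fin 0 ⊕ Fin 0 → A} (gen : StarGenerates z) : Nonempty (A ≃⋆ₐ[ℝ] ℝ) :=
  ⟨(StarAlgEquiv.ofBijective (ofRealStar A) ⟨(ofRealStar A).toAlgHom.toRingHom.injective,
    gen.surjective _ (by rintro (i | i) <;> exact i.elim0)⟩).symm⟩

theorem equiv_complex {z : Fin 0 ⊕ Fin 1 → A} (hz : IsFrame (stdSign 0 1) z)
    (gen : StarGenerates z) : Nonempty (A ≃⋆ₐ[ℝ] ℂ) := by
  set f := ofComplexStar (i := z (Sum.inr 0)) (by simpa using hz.mul_self (Sum.inr 0))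
    (by simpa using hz.star_eq (Sum.inr 0)) with hf
  refine ⟨(StarAlgEquiv.ofBijective f ⟨f.toAlgHom.toRingHom.injective, gen.surjective _ ?_⟩).symm⟩
  rintro (i | i)
  · exact i.elim0
  · refine ⟨Complex.I, ?_⟩
    rw [Subsingleton.elim i 0]
    exact Complex.liftAux_apply_I (z (Sum.inr 0)) (by simpa using hz.mul_self (Sum.inr 0))

theorem equiv_quaternion {z : Fin 0 ⊕ Fin 2 → A} (hz : IsFrame (stdSign 0 2) z)
    (gen : StarGenerates z) : Nonempty (A ≃⋆ₐ[ℝ] ℍ[ℝ]) := by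
  set f := ofQuaternionStar (i := z (Sum.inr 0)) (j := z (Sum.inr 1))
    (by simpa using hz.mul_self (Sum.inr 0)) (by simpa using hz.mul_self (Sum.inr 1))
    (hz.anticomm _ _ (by simp)) (by simpa using hz.star_eq (Sum.inr 0))
    (by simpa using hz.star_eq (Sum.inr 1)) with hf
  refine ⟨(StarAlgEquiv.ofBijective f ⟨f.toAlgHom.toRingHom.injective, gen.surjective _ ?_⟩).symm⟩
  rintro (i | i)
  · exact i.elim0
  · fin_cases i
    · exact ⟨⟨0, 1, 0, 0⟩, by
        change QuaternionAlgebra.Basis.lift _ _ = _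
        simp [QuaternionAlgebra.Basis.lift]⟩
    · exact ⟨⟨0, 0, 1, 0⟩, by
        change QuaternionAlgebra.Basis.lift _ _ = _
        simp [QuaternionAlgebra.Basis.lift]⟩

omit [Nontrivial A] in
theorem equiv_real_prod {z : Fin 1 ⊕ Fin 0 → A} (hz : IsFrame (stdSign 1 0) z)
    (gen : StarGenerates z) (hA : 2 ≤ Module.finrank ℝ A) : Nonempty (A ≃⋆ₐ[ℝ] ℝ × ℝ) := by
  obtain ⟨ψ, h1, h2⟩ := exists_prodStarHom (ofRealStar A) (c := z (Sum.inl 0))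
    (by simpa using hz.mul_self (Sum.inl 0)) (by simpa using hz.star_eq (Sum.inl 0))
    (fun k => (Algebra.commutes k _).symm)
  refine ⟨(StarAlgEquiv.ofBijective ψ (bijective_of_finrank_le ψ (gen.surjective _ ?_) ?_)).symm⟩
  · rintro (i | i)
    · rw [Subsingleton.elim i 0]; exact ⟨_, h2⟩
    · exact i.elim0
  · simpa using hA

omit [Nontrivial A] in
theorem equiv_quaternion_prod {z : Fin 0 ⊕ Fin 3 → A} (hz : IsFrame (stdSign 0 3) z)
    (gen : StarGenerates z) (hA : 8 ≤ Module.finrank ℝ A) :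
    Nonempty (A ≃⋆ₐ[ℝ] ℍ[ℝ] × ℍ[ℝ]) := by
  set y : Fin 3 → A := fun k => z (Sum.inr k) with hy
  have hyf : IsFrame (fun _ => (-1 : ℝ)) y := hz.comp (f := Sum.inr) Sum.inr_injective
  set g := (List.ofFn y).prod with hg
  have hgg : g * g = 1 := by
    rw [hg, hyf.prod_mul_self, prodSign_neg_one_eq_one (by norm_num), one_smul]
  have hgs : star g = g := by
    rw [hg, hyf.star_prod, prodSign_neg_one_eq_one (by norm_num), one_smul]
  have hgy : ∀ k, g * y k = y k * g := by
    intro k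
    have := mul_prod_ofFn_self hyf.anticomm k
    rw [← hg] at this
    rw [this]; norm_num
  have y2 : ∀ k, y k * y k = -1 := fun k => by simpa using hyf.mul_self k
  set φ := ofQuaternionStar (y2 0) (y2 1) (hyf.anticomm 0 1 (by simp))
    (by simpa using hyf.star_eq 0) (by simpa using hyf.star_eq 1) with hφ
  obtain ⟨k0, φ0⟩ : ∃ k, φ k = y 0 := ⟨⟨0, 1, 0, 0⟩, by
    change QuaternionAlgebra.Basis.lift _ _ = _
    simp [QuaternionAlgebra.Basis.lift]⟩
  obtain ⟨k1, φ1⟩ : ∃ k, φ k = y 1 := ⟨⟨0, 0, 1, 0⟩, by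
    change QuaternionAlgebra.Basis.lift _ _ = _
    simp [QuaternionAlgebra.Basis.lift]⟩
  have hc : ∀ k, g * φ k = φ k * g := by
    intro k
    change g * QuaternionAlgebra.Basis.lift _ _ = QuaternionAlgebra.Basis.lift _ _ * g
    simp only [QuaternionAlgebra.Basis.lift, mul_add, add_mul, mul_smul_comm, smul_mul_assoc, hgy]
    rw [← Algebra.commutes, ← mul_assoc, hgy, mul_assoc, hgy, mul_assoc]
  obtain ⟨ψ, h1, h2⟩ := exists_prodStarHom φ hgg hgs hc
  refine ⟨(StarAlgEquiv.ofBijective ψ (bijective_of_finrank_le ψ (gen.surjective _ ?_) ?_)).symm⟩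
  · rintro (i | i)
    · exact i.elim0
    · fin_cases i
      · exact ⟨_, (h1 _).trans φ0⟩
      · exact ⟨_, (h1 _).trans φ1⟩
      -- The third generator is y₂ = -y₀ y₁ g, because g = y₀ y₁ y₂.
      · refine ⟨-((k0, k0) * (k1, k1) * (1, -1)), ?_⟩
        rw [map_neg, map_mul, map_mul, h1, h1, φ0, φ1, h2, hg]
        simp only [List.ofFn_succ, List.ofFn_zero, List.prod_cons, List.prod_nil, mul_one]
        change -(y 0 * y 1 * (y 0 * (y 1 * y 2))) = y 2
        have a1 : ∀ w, y 1 * (y 0 * w) = -(y 0 * (y 1 * w)) := fun w => by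
          rw [← mul_assoc, hyf.anticomm 0 1 (by simp), neg_mul, mul_assoc]
        have a2 : ∀ k w, y k * (y k * w) = -w := fun k w => by rw [← mul_assoc, y2, neg_one_mul]
        simp [mul_assoc, a1, a2]
  · have : Module.finrank ℝ ℍ[ℝ] = 4 := Quaternion.finrank_eq_four
    simpa [this] using hA

end Small

/-! ### The classification -/

/-- The relations determine the algebra except when p - q ≡ 1 mod 4: then the universal algebra is a
product of two simple ones, and a frame might generate only one factor. The dimension bound excludes
this. -/
theorem hasCliffordType_of_isFrame (p q : ℕ) : ∀ {A : Type*} [Ring A] [StarRing A] [Algebra ℝ A]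
    [StarModule ℝ A] [Nontrivial A] {z : Fin p ⊕ Fin q → A}, IsFrame (stdSign p q) z →
    StarGenerates z → (((p : ℤ) - q) % 4 = 1 → 2 ^ (p + q) ≤ Module.finrank ℝ A) →
    HasCliffordType ((p : ℤ) - q) (p + q) A := by
  induction hN : p + q using Nat.strong_induction_on generalizing p q with
  | _ N ih =>
  subst hN
  intro A _ _ _ _ _ z hz gen hA
  -- It suffices to find some frame with generators of both signs and the same p + q whose
  -- difference is p - q or 2 - (p - q) mod 8; splitting it lowers p + q by two.
  have hyp : ∀ (p' q' : ℕ) (z : Fin (p' + 1) ⊕ Fin (q' + 1) → A),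
      IsFrame (stdSign (p' + 1) (q' + 1)) z → StarGenerates z → p + q = p' + q' + 2 →
      ((p' - q' : ℤ) % 8 = ((p : ℤ) - q) % 8 ∨ (p' - q' : ℤ) % 8 = (2 - ((p : ℤ) - q)) % 8) →
      HasCliffordType ((p : ℤ) - q) (p + q) A := by
    intro p' q' z hz gen h1 h2
    obtain ⟨B, y, hy, hyg, ⟨e⟩⟩ := exists_hyperbolic_split hz gen
    have h4 : Module.finrank ℝ A = 4 * Module.finrank ℝ B := by
      rw [e.toAlgEquiv.toLinearEquiv.finrank_eq, Module.finrank_matrix]; simp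
    have := (ih (p' + q') (by omega) p' q' rfl hy hyg (fun h => by
      have := hA (by omega)
      rw [h4, h1, pow_add] at this
      omega)).double e
    rw [h1]
    exact this.congr h2
  match p, q, z, hz, gen, hA, hyp with
  | p' + 1, q' + 1, z, hz, gen, hA, hyp => exact hyp p' q' z hz gen (by omega) (by push_cast; omega)
  | p' + 2, 0, z, hz, gen, hA, hyp =>
    obtain ⟨z', h1, h2⟩ := exists_swap hz gen
    exact hyp 0 p' z' h1 h2 (by omega) (by push_cast; omega)
  | 1, 0, z, hz, gen, hA, hyp =>
    obtain ⟨e⟩ := equiv_real_prod hz gen (by simpa using hA (by norm_num))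
    refine ⟨by norm_num, fun _ => ⟨0, rfl, ⟨e.trans (prodStar oneByOneStar oneByOneStar)⟩⟩,
      by norm_num, by norm_num, by norm_num⟩
  | 0, 0, z, hz, gen, hA, hyp =>
    obtain ⟨e⟩ := equiv_real gen
    refine ⟨fun _ => ⟨0, rfl, ⟨e.trans oneByOneStar⟩⟩, by norm_num, by norm_num, by norm_num,
      by norm_num⟩
  | 0, 1, z, hz, gen, hA, hyp =>
    obtain ⟨e⟩ := equiv_complex hz gen
    refine ⟨by norm_num, by norm_num, fun _ => ⟨0, rfl, ⟨e.trans oneByOneStar⟩⟩, by norm_num,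
      by norm_num⟩
  | 0, 2, z, hz, gen, hA, hyp =>
    obtain ⟨e⟩ := equiv_quaternion hz gen
    refine ⟨by norm_num, by norm_num, by norm_num, fun _ => ⟨0, rfl, ⟨e.trans oneByOneStar⟩⟩,
      by norm_num⟩
  | 0, 3, z, hz, gen, hA, hyp =>
    obtain ⟨e⟩ := equiv_quaternion_prod hz gen (by simpa using hA (by norm_num))
    refine ⟨by norm_num, by norm_num, by norm_num, by norm_num,
      fun _ => ⟨0, rfl, ⟨e.trans (prodStar oneByOneStar oneByOneStar)⟩⟩⟩
  | 0, q' + 4, z, hz, gen, hA, hyp =>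
    obtain ⟨z₁, h1, g1⟩ := exists_shift (q := q') (z := z ∘ Sum.map id (finCongr (by omega)))
      ((hz.comp (Function.injective_id.sumMap (finCongr _).injective)).congr
        (by rintro (i | i) <;> rfl))
      (fun S hS => gen S (by
        rintro (i | i)
        · exact i.elim0
        · exact hS (Sum.inr ((finCongr (by omega : q' + 4 = 4 + q')) i))))
    -- Type (4,q') may lack negative generators; its exchange (q'+1,3) has both signs.
    obtain ⟨z₂, h2, g2⟩ := exists_swap h1 g1
    exact hyp q' 2 z₂ h2 g2 (by omega) (by push_cast; omega)

/-! ### Frames split along `J₊` and `J₋` -/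

section SplitJ

variable {A : Type*} [Ring A] [StarRing A] [Algebra ℝ A] [StarModule ℝ A]

/-- The product J of the p+1 positive generators anticommutes with each of them iff p is odd and
with each negative one iff p is even, hence always with z₀⁺z₀⁻. The product of J with that of the
other positive generators is ± z₀⁺. -/
theorem exists_split_prod_plus {p q : ℕ} {z : Fin (p + 1) ⊕ Fin (q + 1) → A}
    (hz : IsFrame (stdSign (p + 1) (q + 1)) z) (gen : StarGenerates z) :
    ∃ (B : StarSubalgebra ℝ A) (y : Fin p ⊕ Fin q → B), IsFrame (stdSign p q) y ∧
      StarGenerates y ∧ ∃ e : A ≃⋆ₐ[ℝ] Matrix (Fin 2) (Fin 2) B,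
        (prodSign 1 (p + 1) = 1 →
          e (List.ofFn fun i => z (Sum.inl i)).prod = !![1, 0; 0, -1]) ∧
        (prodSign 1 (p + 1) = -1 →
          e (List.ofFn fun i => z (Sum.inl i)).prod = !![0, -1; 1, 0]) := by
  classical
  have hx : IsFrame (fun _ => (1 : ℝ)) (fun i => z (Sum.inl i)) := hz.comp Sum.inl_injective
  have hJJ := hx.prod_mul_self
  have hJs := hx.star_prod
  have c1 := mul_prod_ofFn_self hx.anticomm
  have c2 : ∀ j, _ := fun j => mul_prod_ofFn_anticomm (y := fun i => z (Sum.inl i))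
    (v := z (Sum.inr j)) (fun i => hz.anticomm (Sum.inl i) (Sum.inr j) (by simp))
  have hx' : IsFrame (fun _ => (1 : ℝ)) (fun i : Fin p => z (Sum.inl i.succ)) :=
    hx.comp (Fin.succ_injective p)
  have hPP := hx'.prod_mul_self
  have hJ0 : (List.ofFn fun i => z (Sum.inl i)).prod *
      (List.ofFn fun i : Fin p => z (Sum.inl i.succ)).prod = prodSign 1 p • z (Sum.inl 0) := by
    rw [List.ofFn_succ, List.prod_cons, mul_assoc, hPP, mul_smul_comm, mul_one]
  set J := (List.ofFn fun i => z (Sum.inl i)).prod with hJ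
  obtain ⟨B, y, h1, h2, e, he⟩ := hz.exists_split gen (a := Sum.inl 0) (b := Sum.inr 0) (by simp)
    rfl rfl (f := Sum.map Fin.succ Fin.succ)
    ((Fin.succ_injective p).sumMap (Fin.succ_injective q))
    (by rintro (k | k) <;> simp) (by rintro (k | k) <;> simp)
    (by rintro (i | i) <;> induction i using Fin.cases <;> simp)
    (J := J) (prodSign_eq_or (by norm_num) (p + 1)) hJJ hJs
    (by
      rw [mul_assoc _ _ J, c2, mul_smul_comm, ← mul_assoc _ J, c1, smul_mul_assoc, smul_smul,
        pow_succ, mul_assoc J]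
      rcases neg_one_pow_eq_or ℝ p with h | h <;> simp [h])
    (Sum.elim (fun _ => Odd p) (fun _ => Even p))
    (by
      rintro (k | k) hk
      · have := c1 k.succ
        rw [Odd.neg_one_pow hk] at this
        simp [this]
      · have := c2 k.succ
        rw [Odd.neg_one_pow (Even.add_one hk)] at this
        simp [this])
    (by
      rintro (k | k) hk
      · have := c1 k.succ
        rw [Even.neg_one_pow (Nat.not_odd_iff_even.1 hk)] at this
        simp [this]
      · have := c2 k.succ
        rw [Even.neg_one_pow (Odd.add_one (Nat.not_even_iff_odd.1 hk))] at this
        simp [this])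
    (by
      intro S hS _ hk
      have h3 : (List.ofFn fun i : Fin p => z (Sum.inl i.succ)).prod ∈ S :=
        list_prod_mem fun x hx => by
          obtain ⟨k, rfl⟩ := List.mem_ofFn.1 hx
          exact hk (Sum.inl k)
      have : z (Sum.inl 0) = prodSign 1 p • (J *
          (List.ofFn fun i : Fin p => z (Sum.inl i.succ)).prod) := by
        rw [hJ0, smul_smul]
        rcases prodSign_eq_or (c := 1) (by norm_num) p with h | h <;> simp [h]
      rw [this]
      exact SMulMemClass.smul_mem _ (mul_mem hS h3))
  exact ⟨B, y, h1.congr (by rintro (k | k) <;> rfl), h2, e, he⟩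

/-- The parities are exchanged relative to `exists_split_prod_plus`. Here J first yields z₀⁻, and
then z₀⁺ = -(z₀⁺z₀⁻)z₀⁻. -/
theorem exists_split_prod_minus {p q : ℕ} {z : Fin (p + 1) ⊕ Fin (q + 1) → A}
    (hz : IsFrame (stdSign (p + 1) (q + 1)) z) (gen : StarGenerates z) :
    ∃ (B : StarSubalgebra ℝ A) (y : Fin p ⊕ Fin q → B), IsFrame (stdSign p q) y ∧
      StarGenerates y ∧ ∃ e : A ≃⋆ₐ[ℝ] Matrix (Fin 2) (Fin 2) B,
        (prodSign (-1) (q + 1) = 1 →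
          e (List.ofFn fun i => z (Sum.inr i)).prod = !![1, 0; 0, -1]) ∧
        (prodSign (-1) (q + 1) = -1 →
          e (List.ofFn fun i => z (Sum.inr i)).prod = !![0, -1; 1, 0]) := by
  classical
  have hx : IsFrame (fun _ => (-1 : ℝ)) (fun i => z (Sum.inr i)) := hz.comp Sum.inr_injective
  have hJJ := hx.prod_mul_self
  have hJs := hx.star_prod
  have c1 := mul_prod_ofFn_self hx.anticomm
  have c2 : ∀ j, _ := fun j => mul_prod_ofFn_anticomm (y := fun i => z (Sum.inr i))
    (v := z (Sum.inl j)) (fun i => hz.anticomm (Sum.inr i) (Sum.inl j) (by simp))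
  have hx' : IsFrame (fun _ => (-1 : ℝ)) (fun i : Fin q => z (Sum.inr i.succ)) :=
    hx.comp (Fin.succ_injective q)
  have hPP := hx'.prod_mul_self
  have hJ0 : (List.ofFn fun i => z (Sum.inr i)).prod *
      (List.ofFn fun i : Fin q => z (Sum.inr i.succ)).prod = prodSign (-1) q • z (Sum.inr 0) := by
    rw [List.ofFn_succ, List.prod_cons, mul_assoc, hPP, mul_smul_comm, mul_one]
  set J := (List.ofFn fun i => z (Sum.inr i)).prod with hJ
  obtain ⟨B, y, h1, h2, e, he⟩ := hz.exists_split gen (a := Sum.inl 0) (b := Sum.inr 0) (by simp)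
    rfl rfl (f := Sum.map Fin.succ Fin.succ)
    ((Fin.succ_injective p).sumMap (Fin.succ_injective q))
    (by rintro (k | k) <;> simp) (by rintro (k | k) <;> simp)
    (by rintro (i | i) <;> induction i using Fin.cases <;> simp)
    (J := J) (prodSign_eq_or (by norm_num) (q + 1)) hJJ hJs
    (by
      rw [mul_assoc _ _ J, c1, mul_smul_comm, ← mul_assoc _ J, c2, smul_mul_assoc, smul_smul,
        pow_succ, mul_assoc J]
      rcases neg_one_pow_eq_or ℝ q with h | h <;> simp [h])
    (Sum.elim (fun _ => Even q) (fun _ => Odd q))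
    (by
      rintro (k | k) hk
      · have := c2 k.succ
        rw [Odd.neg_one_pow (Even.add_one hk)] at this
        simp [this]
      · have := c1 k.succ
        rw [Odd.neg_one_pow hk] at this
        simp [this])
    (by
      rintro (k | k) hk
      · have := c2 k.succ
        rw [Even.neg_one_pow (Odd.add_one (Nat.not_even_iff_odd.1 hk))] at this
        simp [this]
      · have := c1 k.succ
        rw [Even.neg_one_pow (Nat.not_odd_iff_even.1 hk)] at this
        simp [this])
    (by
      intro S hS hw hk
      have h3 : (List.ofFn fun i : Fin q => z (Sum.inr i.succ)).prod ∈ S :=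
        list_prod_mem fun x hx => by
          obtain ⟨k, rfl⟩ := List.mem_ofFn.1 hx
          exact hk (Sum.inr k)
      have h4 : z (Sum.inr 0) ∈ S := by
        have : z (Sum.inr 0) = prodSign (-1) q • (J *
            (List.ofFn fun i : Fin q => z (Sum.inr i.succ)).prod) := by
          rw [hJ0, smul_smul]
          rcases prodSign_eq_or (c := -1) (by norm_num) q with h | h <;> simp [h]
        rw [this]
        exact SMulMemClass.smul_mem _ (mul_mem hS h3)
      have : z (Sum.inl 0) = -(z (Sum.inl 0) * z (Sum.inr 0) * z (Sum.inr 0)) := by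
        rw [mul_assoc, hz.mul_self]; simp
      rw [this]
      exact neg_mem (mul_mem hw h4))
  exact ⟨B, y, h1.congr (by rintro (k | k) <;> rfl), h2, e, he⟩

end SplitJ

/-! ### Topological isomorphisms of isometry groups -/

section Isometry

/-- Elements of a star ring with `a* J a = J`. -/
def isomGroup {A : Type*} [Ring A] [StarRing A] (J : A) : Submonoid A where
  carrier := {a | star a * J * a = J}
  one_mem' := by simp
  mul_mem' := by
    intro a b (ha : _ = _) (hb : _ = _)
    change star (a * b) * J * (a * b) = J
    calc star (a * b) * J * (a * b) = star b * (star a * J * a) * b := by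
          rw [star_mul]; noncomm_ring
      _ = J := by rw [ha, hb]

theorem mem_isomGroup {A : Type*} [Ring A] [StarRing A] {J a : A} :
    a ∈ isomGroup J ↔ star a * J * a = J := Iff.rfl

theorem LieIso.trans {A B C : Type*} [Mul A] [Mul B] [Mul C] [TopologicalSpace A]
    [TopologicalSpace B] [TopologicalSpace C] (h : LieIso A B) (h' : LieIso B C) : LieIso A C :=
  h.elim fun e => h'.elim fun f => ⟨e.trans f⟩

theorem LieIso.symm {A B : Type*} [Mul A] [Mul B] [TopologicalSpace A] [TopologicalSpace B]
    (h : LieIso A B) : LieIso B A := h.elim fun e => ⟨e.symm⟩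

theorem lieIso_of_eq {A : Type*} [Monoid A] [TopologicalSpace A] {H K : Submonoid A} (h : H = K) :
    LieIso H K := by subst h; exact ⟨ContinuousMulEquiv.refl _⟩

variable {A Y : Type*} [Ring A] [Algebra ℝ A] [TopologicalSpace A] [IsModuleTopology ℝ A]
  [Ring Y] [Algebra ℝ Y] [TopologicalSpace Y] [IsTopologicalAddGroup Y] [ContinuousSMul ℝ Y]
  [T2Space Y] [FiniteDimensional ℝ Y]

/-- Linear maps between these finite-dimensional algebras are continuous, so an algebraic
isomorphism matching the two submonoids is automatically topological. -/
theorem lieIso_of_algEquiv (e : A ≃ₐ[ℝ] Y) {H : Submonoid A} {K : Submonoid Y}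
    (h : ∀ a, a ∈ H ↔ e a ∈ K) : LieIso H K := by
  have := IsModuleTopology.topologicalAddGroup ℝ A
  have := IsModuleTopology.toContinuousSMul ℝ A
  have c1 : Continuous e := IsModuleTopology.continuous_of_linearMap e.toLinearMap
  have c2 : Continuous e.symm := e.symm.toLinearMap.continuous_of_finiteDimensional
  exact ⟨{
    toFun := fun a => ⟨e a, (h a).1 a.2⟩
    invFun := fun b => ⟨e.symm b, (h _).2 (by simp)⟩
    left_inv := fun a => by simp
    right_inv := fun b => by simp
    map_mul' := fun a b => by ext; simp
    continuous_toFun := by fun_prop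
    continuous_invFun := by fun_prop }⟩

variable [StarRing A] [StarRing Y]

theorem lieIso_isomGroup (e : A ≃⋆ₐ[ℝ] Y) (J : A) : LieIso (isomGroup J) (isomGroup (e J)) :=
  lieIso_of_algEquiv e.toAlgEquiv fun a => by
    rw [mem_isomGroup, mem_isomGroup, StarAlgEquiv.coe_toAlgEquiv, ← map_star, ← map_mul,
      ← map_mul, (EquivLike.injective e).eq_iff]

omit [Algebra ℝ Y] [IsTopologicalAddGroup Y] [ContinuousSMul ℝ Y] [T2Space Y]
  [FiniteDimensional ℝ Y] in
theorem lieIso_isomGroup_prod (J J' : Y) :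
    LieIso (isomGroup (J, J')) (isomGroup J × isomGroup J') :=
  ⟨{ toFun := fun a => (⟨a.1.1, congrArg Prod.fst a.2⟩, ⟨a.1.2, congrArg Prod.snd a.2⟩)
     invFun := fun b => ⟨(b.1.1, b.2.1), Prod.ext b.1.2 b.2.2⟩
     left_inv := fun a => rfl
     right_inv := fun b => rfl
     map_mul' := fun a b => rfl
     continuous_toFun := by fun_prop
     continuous_invFun := by fun_prop }⟩

end Isometry

/-! ### Equivalences between standard forms -/

section Forms

variable {F : Type} [Ring F] [StarRing F] [Algebra ℝ F] [TopologicalSpace F]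
  [IsTopologicalAddGroup F] [ContinuousSMul ℝ F] [T2Space F] [FiniteDimensional ℝ F]

instance {m : Type*} [Fintype m] : IsModuleTopology ℝ (Matrix m m F) :=
  isModuleTopologyOfFiniteDimensional

/-- `2 × 2` matrices of scalars as block matrices. -/
def inflate (n : ℕ) (X : Matrix (Fin 2) (Fin 2) F) : Matrix (Fin n ⊕ Fin n) (Fin n ⊕ Fin n) F :=
  blockStar (X.map (Matrix.scalar (Fin n)))

omit [TopologicalSpace F] [IsTopologicalAddGroup F] [ContinuousSMul ℝ F] [T2Space F]
  [FiniteDimensional ℝ F] in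
theorem inflate_mul (n : ℕ) (X Y : Matrix (Fin 2) (Fin 2) F) :
    inflate n X * inflate n Y = inflate n (X * Y) := by
  rw [inflate, inflate, inflate, ← map_mul, Matrix.map_mul]

omit [TopologicalSpace F] [IsTopologicalAddGroup F] [ContinuousSMul ℝ F] [T2Space F]
  [FiniteDimensional ℝ F] in
theorem inflate_star (n : ℕ) (X : Matrix (Fin 2) (Fin 2) F) :
    (inflate n X).conjTranspose = inflate n X.conjTranspose := by
  rw [← Matrix.star_eq_conjTranspose, inflate, ← map_star, inflate]
  congr 1
  refine Matrix.ext fun i j => ?_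
  change (Matrix.diagonal fun _ : Fin n => X j i).conjTranspose =
    Matrix.diagonal fun _ : Fin n => star (X j i)
  rw [Matrix.diagonal_conjTranspose]
  rfl

omit [TopologicalSpace F] [IsTopologicalAddGroup F] [ContinuousSMul ℝ F] [T2Space F]
  [FiniteDimensional ℝ F] in
theorem inflate_one (n : ℕ) : inflate n (1 : Matrix (Fin 2) (Fin 2) F) = 1 := by
  rw [inflate, Matrix.map_one _ (map_zero _) (map_one _), map_one]

omit [TopologicalSpace F] [IsTopologicalAddGroup F] [ContinuousSMul ℝ F] [T2Space F]
  [FiniteDimensional ℝ F] in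
theorem inflate_eq (n : ℕ) (a b c d : F) : inflate n !![a, b; c, d] =
    Matrix.fromBlocks (Matrix.diagonal fun _ => a) (Matrix.diagonal fun _ => b)
      (Matrix.diagonal fun _ => c) (Matrix.diagonal fun _ => d) := rfl

/-- A change of basis: X ↦ P⁻¹XP carries isometries of B to isometries of P*BP. -/
theorem lieIso_formGroup_conj {m : Type} [Fintype m] [DecidableEq m] {B B' P Q : Matrix m m F}
    (hPQ : P * Q = 1) (hQP : Q * P = 1) (hB : P.conjTranspose * B * P = B') :
    LieIso (formGroup B) (formGroup B') := by
  have hPQ' : ∀ X, P * (Q * X) = X := fun X => by rw [← mul_assoc, hPQ, one_mul]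
  have hQP' : ∀ X, Q * (P * X) = X := fun X => by rw [← mul_assoc, hQP, one_mul]
  let e : Matrix m m F ≃ₐ[ℝ] Matrix m m F :=
    AlgEquiv.ofLinearEquiv
      { toFun := fun X => Q * X * P
        invFun := fun X => P * X * Q
        left_inv := fun X => by simp only [mul_assoc, hPQ', hPQ, mul_one]
        right_inv := fun X => by simp only [mul_assoc, hQP', hQP, mul_one]
        map_add' := fun X Y => by simp [mul_add, add_mul]
        map_smul' := fun r X => by simp }
      (by simp [hQP]) (fun X Y => by simp only [LinearEquiv.coe_mk, LinearMap.coe_mk,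
        AddHom.coe_mk, mul_assoc, hPQ'])
  refine lieIso_of_algEquiv e fun X => ?_
  have he : e X = Q * X * P := rfl
  change X.conjTranspose * B * X = B ↔ (e X).conjTranspose * B' * (e X) = B'
  have hQs : Q.conjTranspose * P.conjTranspose = 1 := by
    rw [← Matrix.conjTranspose_mul, hPQ, Matrix.conjTranspose_one]
  have h1 : (e X).conjTranspose * B' * (e X)
      = P.conjTranspose * (X.conjTranspose * B * X) * P := by
    rw [he, ← hB, Matrix.conjTranspose_mul, Matrix.conjTranspose_mul]
    calc _ = P.conjTranspose * X.conjTranspose * (Q.conjTranspose * P.conjTranspose) * B *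
          (P * Q) * X * P := by simp only [mul_assoc]
      _ = _ := by rw [hQs, hPQ]; simp only [mul_assoc, mul_one, one_mul]
  rw [h1, ← hB]
  constructor
  · intro h; rw [h]
  · intro h
    have := congrArg (fun Z => Q.conjTranspose * Z * Q) h
    simp only [← mul_assoc, hQs, one_mul] at this
    simpa only [mul_assoc, hPQ, mul_one] using this

omit [TopologicalSpace F] [IsTopologicalAddGroup F] [ContinuousSMul ℝ F] [T2Space F]
  [FiniteDimensional ℝ F] [Algebra ℝ F] in
theorem formGroup_smul {R : Type*} [Field R] [Module R F] [IsScalarTower R F F]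
    [SMulCommClass R F F] {m : Type} [Fintype m] [DecidableEq m] {c : R} (hc : c ≠ 0)
    (B : Matrix m m F) : formGroup (c • B) = formGroup B := by
  ext X
  change X.conjTranspose * (c • B) * X = c • B ↔ X.conjTranspose * B * X = B
  rw [Matrix.mul_smul, Matrix.smul_mul]
  constructor
  · intro h
    have := congrArg (fun Z => c⁻¹ • Z) h
    simpa [smul_smul, hc] using this
  · intro h; rw [h]

theorem lieIso_spR (n : ℕ) : LieIso (formGroup (skewMatrix n ℝ)) (SpR n) := by
  refine lieIso_of_eq ?_
  ext X
  rw [SymplecticGroup.mem_iff']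
  change X.conjTranspose * _ * X = _ ↔ _
  rw [Matrix.conjTranspose_eq_transpose_of_trivial]
  rfl

/-- Multiplication by i exchanges skew-Hermitian and Hermitian forms, so over ℂ both signs of J²
give U(n,n). The columns (1,i) and (1,-i) of P are orthogonal for the skew form, with values -2i and
2i. -/
theorem lieIso_unn (n : ℕ) : LieIso (formGroup (skewMatrix n ℂ)) (Unn n) := by
  have h := lieIso_formGroup_conj (B := skewMatrix n ℂ)
    (P := inflate n !![1, 1; Complex.I, -Complex.I])
    (Q := inflate n !![1/2, -Complex.I/2; 1/2, Complex.I/2])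
    (B' := (-2 * Complex.I) • signMatrix n ℂ) ?_ ?_ ?_
  · rwa [formGroup_smul (by simp)] at h
  · rw [inflate_mul, ← inflate_one]
    congr 1
    ext i j
    fin_cases i <;> fin_cases j <;> simp [Matrix.mul_apply, Fin.sum_univ_two] <;> ring_nf <;>
      norm_num
  · rw [inflate_mul, ← inflate_one]
    congr 1
    ext i j
    fin_cases i <;> fin_cases j <;> simp [Matrix.mul_apply, Fin.sum_univ_two] <;> ring_nf <;>
      norm_num
  · have h1 : skewMatrix n ℂ = inflate n !![0, -1; 1, 0] := by
      rw [inflate_eq]; simp [skewMatrix, ← Matrix.diagonal_neg]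
    have h2 : (-2 * Complex.I) • signMatrix n ℂ
        = inflate n !![-2 * Complex.I, 0; 0, 2 * Complex.I] := by
      rw [inflate_eq, signMatrix, Matrix.fromBlocks_smul]
      congr 1 <;> ext i j <;> simp [Matrix.one_apply, Matrix.diagonal_apply]
      split_ifs <;> simp
    rw [h1, h2, inflate_star, inflate_mul, inflate_mul]
    congr 1
    ext i j
    fin_cases i <;> fin_cases j <;> simp [Matrix.mul_apply, Fin.sum_univ_two] <;> ring_nf

/-- The quaternion unit `𝐢`. -/
def quatI : ℍ[ℝ] := ⟨0, 1, 0, 0⟩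

/-- The quaternion unit `𝐣`. -/
def quatJ : ℍ[ℝ] := ⟨0, 0, 1, 0⟩

theorem quat_relations : quatI * quatI = -1 ∧ quatJ * quatJ = -1 ∧
    quatJ * quatI = -(quatI * quatJ) ∧ star quatI = -quatI ∧ star quatJ = -quatJ := by
  have i0 : quatI.re = 0 := rfl
  have i1 : quatI.imI = 1 := rfl
  have i2 : quatI.imJ = 0 := rfl
  have i3 : quatI.imK = 0 := rfl
  have j0 : quatJ.re = 0 := rfl
  have j1 : quatJ.imI = 0 := rfl
  have j2 : quatJ.imJ = 1 := rfl
  have j3 : quatJ.imK = 0 := rfl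
  refine ⟨?_, ?_, ?_, ?_, ?_⟩ <;> ext <;> simp [i0, i1, i2, i3, j0, j1, j2, j3]

/-- The columns (1,-j) and (i,-ij) of P are orthogonal for the skew form and both have value 2j, so
the form is equivalent to 2j times the identity. -/
theorem lieIso_oStar (n : ℕ) : LieIso (formGroup (skewMatrix n ℍ[ℝ])) (OStar (2 * n)) := by
  change LieIso _ (formGroup (Matrix.diagonal fun _ : Fin (2 * n) => quatJ))
  obtain ⟨hi, hj, hij, his, hjs⟩ := quat_relations
  generalize quatI = i at *
  generalize quatJ = j at *
  have hi' : ∀ x, i * (i * x) = -x := fun x => by rw [← mul_assoc, hi, neg_one_mul]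
  have hj' : ∀ x, j * (j * x) = -x := fun x => by rw [← mul_assoc, hj, neg_one_mul]
  have hij' : ∀ x, j * (i * x) = -(i * (j * x)) := fun x => by
    rw [← mul_assoc, hij, neg_mul, mul_assoc]
  have half : (2⁻¹ : ℝ) • (1 : ℍ[ℝ]) + (2⁻¹ : ℝ) • (1 : ℍ[ℝ]) = 1 := by
    rw [← add_smul]; norm_num
  have h := lieIso_formGroup_conj (B := skewMatrix n ℍ[ℝ])
    (P := inflate n !![1, i; -j, -(i * j)])
    (Q := inflate n ((2⁻¹ : ℝ) • !![1, j; -i, i * j]))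
    (B' := (2 : ℝ) • Matrix.diagonal fun _ => j) ?_ ?_ ?_
  · rw [formGroup_smul two_ne_zero] at h
    refine h.trans ?_
    let e : Fin n ⊕ Fin n ≃ Fin (2 * n) := finSumFinEquiv.trans (finCongr (two_mul n).symm)
    have := lieIso_isomGroup (reindexStar (K := ℍ[ℝ]) e) (Matrix.diagonal fun _ => j)
    rwa [show reindexStar (K := ℍ[ℝ]) e (Matrix.diagonal fun _ => j)
      = Matrix.diagonal fun _ => j from ?_] at this
    refine Matrix.ext fun a b => ?_
    change (Matrix.diagonal fun _ => j) (e.symm a) (e.symm b) = _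
    rw [Matrix.diagonal_apply, Matrix.diagonal_apply]
    simp
  · rw [inflate_mul, ← inflate_one]
    congr 1
    refine Matrix.ext fun a b => ?_
    fin_cases a <;> fin_cases b <;>
      simp [Matrix.mul_apply, Fin.sum_univ_two, mul_assoc, hi, hj, hij, hi', hj', hij', half]
  · rw [inflate_mul, ← inflate_one]
    congr 1
    refine Matrix.ext fun a b => ?_
    fin_cases a <;> fin_cases b <;>
      simp [Matrix.mul_apply, Fin.sum_univ_two, mul_assoc, hi, hj, hij, hi', hj', hij', half]
  · have h1 : skewMatrix n ℍ[ℝ] = inflate n !![0, -1; 1, 0] := by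
      rw [inflate_eq]; simp [skewMatrix, ← Matrix.diagonal_neg]
    have h2 : ((2 : ℝ) • Matrix.diagonal fun _ => j) = inflate n !![(2 : ℝ) • j, 0; 0, (2 : ℝ) • j] := by
      rw [inflate_eq]
      refine Matrix.ext fun a b => ?_
      rcases a with a | a <;> rcases b with b | b <;> simp [Matrix.diagonal_apply]
    rw [h1, h2, inflate_star, inflate_mul, inflate_mul]
    congr 1
    refine Matrix.ext fun a b => ?_
    fin_cases a <;> fin_cases b <;>
      simp [Matrix.mul_apply, Fin.sum_univ_two, mul_assoc, his, hjs, hi, hj, hij, hi', hj', hij',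
        two_smul]

end Forms

/-! ### The table of isometry groups -/

section Table

/-- The isomorphism types of the groups `a* J a = J` with `J² = ε`, in terms of the type `(d, N)` of
the algebra over which `J` splits off `2 × 2` matrices. -/
def HasFormType (d : ℤ) (N : ℕ) (ε : ℝ) (H : Type*) [Mul H] [TopologicalSpace H] : Prop :=
  ((d % 8 = 0 ∨ d % 8 = 2) → ∃ m, N = 2 * m ∧
    (ε = 1 → LieIso H (Onn (2 ^ m))) ∧ (ε = -1 → LieIso H (SpR (2 ^ m)))) ∧
  (d % 8 = 1 → ∃ m, N = 2 * m + 1 ∧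
    (ε = 1 → LieIso H (Onn (2 ^ m) × Onn (2 ^ m))) ∧
    (ε = -1 → LieIso H (SpR (2 ^ m) × SpR (2 ^ m)))) ∧
  ((d % 8 = 3 ∨ d % 8 = 7) → ∃ m, N = 2 * m + 1 ∧ LieIso H (Unn (2 ^ m))) ∧
  ((d % 8 = 4 ∨ d % 8 = 6) → ∃ m, N = 2 * m + 2 ∧
    (ε = 1 → LieIso H (Spnn (2 ^ m))) ∧ (ε = -1 → LieIso H (OStar (2 * 2 ^ m)))) ∧
  (d % 8 = 5 → ∃ m, N = 2 * m + 3 ∧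
    (ε = 1 → LieIso H (Spnn (2 ^ m) × Spnn (2 ^ m))) ∧
    (ε = -1 → LieIso H (OStar (2 * 2 ^ m) × OStar (2 * 2 ^ m))))

theorem LieIso.prod {A B C D : Type*} [Mul A] [Mul B] [Mul C] [Mul D] [TopologicalSpace A]
    [TopologicalSpace B] [TopologicalSpace C] [TopologicalSpace D] (h : LieIso A B)
    (h' : LieIso C D) : LieIso (A × C) (B × D) :=
  h.elim fun e => h'.elim fun f => ⟨{ e.toEquiv.prodCongr f.toEquiv with
    map_mul' := fun x y => Prod.ext (e.map_mul' _ _) (f.map_mul' _ _)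
    continuous_toFun := (e.continuous_toFun.comp continuous_fst).prodMk
      (f.continuous_toFun.comp continuous_snd)
    continuous_invFun := (e.continuous_invFun.comp continuous_fst).prodMk
      (f.continuous_invFun.comp continuous_snd) }⟩

theorem HasFormType.of_lieIso {d : ℤ} {N : ℕ} {ε : ℝ} {H H' : Type*} [Mul H] [TopologicalSpace H]
    [Mul H'] [TopologicalSpace H'] (e : LieIso H H') (h : HasFormType d N ε H') :
    HasFormType d N ε H := by
  obtain ⟨h1, h2, h3, h4, h5⟩ := h
  exact ⟨fun hd => (h1 hd).imp fun m hm => ⟨hm.1, fun hε => e.trans (hm.2.1 hε),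
      fun hε => e.trans (hm.2.2 hε)⟩,
    fun hd => (h2 hd).imp fun m hm => ⟨hm.1, fun hε => e.trans (hm.2.1 hε),
      fun hε => e.trans (hm.2.2 hε)⟩,
    fun hd => (h3 hd).imp fun m hm => ⟨hm.1, e.trans hm.2⟩,
    fun hd => (h4 hd).imp fun m hm => ⟨hm.1, fun hε => e.trans (hm.2.1 hε),
      fun hε => e.trans (hm.2.2 hε)⟩,
    fun hd => (h5 hd).imp fun m hm => ⟨hm.1, fun hε => e.trans (hm.2.1 hε),
      fun hε => e.trans (hm.2.2 hε)⟩⟩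

variable {A : Type*} [Ring A] [StarRing A] [Algebra ℝ A] [TopologicalSpace A]
  [IsModuleTopology ℝ A]
variable {F : Type} [Ring F] [StarRing F] [Algebra ℝ F] [TopologicalSpace F]
  [IsTopologicalAddGroup F] [ContinuousSMul ℝ F] [T2Space F] [FiniteDimensional ℝ F]

theorem lieIso_formGroup {m : Type} [Fintype m] [DecidableEq m] {J : A} {J' : Matrix m m F}
    (e : A ≃⋆ₐ[ℝ] Matrix m m F) (h : e J = J') : LieIso (isomGroup J) (formGroup J') := by
  subst h
  exact lieIso_isomGroup e J

theorem lieIso_formGroup_prod {m : Type} [Fintype m] [DecidableEq m] {J : A} {J' : Matrix m m F}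
    (e : A ≃⋆ₐ[ℝ] Matrix m m F × Matrix m m F) (h : e J = (J', J')) :
    LieIso (isomGroup J) (formGroup J' × formGroup J') := by
  have := lieIso_isomGroup e J
  rw [h] at this
  exact this.trans (lieIso_isomGroup_prod J' J')

/-- In block form over the scalars of B, J becomes the sign matrix or the skew matrix, so each row
of the classification of B yields a classical group. -/
theorem hasFormType_of_split {B : Type*} [Ring B] [StarRing B] [Algebra ℝ B] {d : ℤ} {N : ℕ}
    (hB : HasCliffordType d N B) (e : A ≃⋆ₐ[ℝ] Matrix (Fin 2) (Fin 2) B) {J : A} {ε : ℝ}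
    (hε : ε = 1 ∨ ε = -1) (h₁ : ε = 1 → e J = !![1, 0; 0, -1])
    (h₂ : ε = -1 → e J = !![0, -1; 1, 0]) : HasFormType d N ε (isomGroup J) := by
  obtain ⟨hR, hRR, hC, hH, hHH⟩ := hB
  refine ⟨fun hd => ?_, fun hd => ?_, fun hd => ?_, fun hd => ?_, fun hd => ?_⟩
  · obtain ⟨m, hm, ⟨f⟩⟩ := hR hd
    exact ⟨m, hm, fun h => lieIso_formGroup _ (blockEquiv_sign (h₁ h) f),
      fun h => (lieIso_formGroup _ (blockEquiv_skew (h₂ h) f)).trans (lieIso_spR _)⟩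
  · obtain ⟨m, hm, ⟨f⟩⟩ := hRR hd
    exact ⟨m, hm, fun h => lieIso_formGroup_prod _ (blockEquivProd_sign (h₁ h) f),
      fun h => (lieIso_formGroup_prod _ (blockEquivProd_skew (h₂ h) f)).trans
        ((lieIso_spR _).prod (lieIso_spR _))⟩
  · obtain ⟨m, hm, ⟨f⟩⟩ := hC hd
    refine ⟨m, hm, ?_⟩
    rcases hε with h | h
    · exact lieIso_formGroup _ (blockEquiv_sign (h₁ h) f)
    · exact (lieIso_formGroup _ (blockEquiv_skew (h₂ h) f)).trans (lieIso_unn _)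
  · obtain ⟨m, hm, ⟨f⟩⟩ := hH hd
    exact ⟨m, hm, fun h => lieIso_formGroup _ (blockEquiv_sign (h₁ h) f),
      fun h => (lieIso_formGroup _ (blockEquiv_skew (h₂ h) f)).trans (lieIso_oStar _)⟩
  · obtain ⟨m, hm, ⟨f⟩⟩ := hHH hd
    exact ⟨m, hm, fun h => lieIso_formGroup_prod _ (blockEquivProd_sign (h₁ h) f),
      fun h => (lieIso_formGroup_prod _ (blockEquivProd_skew (h₂ h) f)).trans
        ((lieIso_oStar _).prod (lieIso_oStar _))⟩

variable [StarModule ℝ A] [Nontrivial A]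

omit [TopologicalSpace A] [IsModuleTopology ℝ A] in
theorem hasCliffordType_of_split {p q : ℕ} {B : StarSubalgebra ℝ A} {y : Fin p ⊕ Fin q → B}
    (hy : IsFrame (stdSign p q) y) (gen : StarGenerates y)
    (e : A ≃⋆ₐ[ℝ] Matrix (Fin 2) (Fin 2) B)
    (hA : ((p : ℤ) - q) % 4 = 1 → 2 ^ (p + q + 2) ≤ Module.finrank ℝ A) :
    HasCliffordType ((p : ℤ) - q) (p + q) B := by
  have h4 : Module.finrank ℝ A = 4 * Module.finrank ℝ B := by
    rw [e.toAlgEquiv.toLinearEquiv.finrank_eq, Module.finrank_matrix]; simp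
  exact hasCliffordType_of_isFrame p q hy gen fun h => by
    have := hA h
    rw [h4, pow_add] at this
    omega

/-- The group `a* J₊ a = J₊` of a frame. -/
theorem hasFormType_plus {p q : ℕ} {z : Fin (p + 1) ⊕ Fin (q + 1) → A}
    (hz : IsFrame (stdSign (p + 1) (q + 1)) z) (gen : StarGenerates z)
    (hA : ((p : ℤ) - q) % 4 = 1 → 2 ^ (p + q + 2) ≤ Module.finrank ℝ A) :
    HasFormType ((p : ℤ) - q) (p + q) (prodSign 1 (p + 1))
      (isomGroup (List.ofFn fun i => z (Sum.inl i)).prod) := by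
  obtain ⟨B, y, hy, hyg, e, h₁, h₂⟩ := exists_split_prod_plus hz gen
  exact hasFormType_of_split (hasCliffordType_of_split hy hyg e hA) e
    (prodSign_eq_or (by norm_num) _) h₁ h₂

/-- The group `a* J₋ a = J₋` of a frame. -/
theorem hasFormType_minus {p q : ℕ} {z : Fin (p + 1) ⊕ Fin (q + 1) → A}
    (hz : IsFrame (stdSign (p + 1) (q + 1)) z) (gen : StarGenerates z)
    (hA : ((p : ℤ) - q) % 4 = 1 → 2 ^ (p + q + 2) ≤ Module.finrank ℝ A) :
    HasFormType ((p : ℤ) - q) (p + q) (prodSign (-1) (q + 1))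
      (isomGroup (List.ofFn fun i => z (Sum.inr i)).prod) := by
  obtain ⟨B, y, hy, hyg, e, h₁, h₂⟩ := exists_split_prod_minus hz gen
  exact hasFormType_of_split (hasCliffordType_of_split hy hyg e hA) e
    (prodSign_eq_or (by norm_num) _) h₁ h₂

end Table

/-! ### The star algebra `C(p,q)` -/

section Concrete

/-- `C(p,q)` with the star operation `a ↦ a*`. -/
def StarCl (p q : ℕ) : Type := Cl p q

instance (p q : ℕ) : Ring (StarCl p q) := inferInstanceAs (Ring (Cl p q))
instance (p q : ℕ) : Algebra ℝ (StarCl p q) := inferInstanceAs (Algebra ℝ (Cl p q))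
instance (p q : ℕ) : TopologicalSpace (StarCl p q) := inferInstanceAs (TopologicalSpace (Cl p q))
instance (p q : ℕ) : IsModuleTopology ℝ (StarCl p q) :=
  inferInstanceAs (IsModuleTopology ℝ (Cl p q))
instance (p q : ℕ) : Nontrivial (StarCl p q) := inferInstanceAs (Nontrivial (Cl p q))

theorem TMinus_ι {p q : ℕ} (x : Fin p ⊕ Fin q → ℝ) :
    TMinus p q (ι (stdForm p q) x) = ι (stdForm p q) (flipMinus p q x) :=
  CliffordAlgebra.map_apply_ι _ _

theorem TMinus_TMinus {p q : ℕ} (a : Cl p q) : TMinus p q (TMinus p q a) = a := by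
  have : (TMinus p q).comp (TMinus p q) = AlgHom.id ℝ _ := by
    refine CliffordAlgebra.hom_ext (LinearMap.ext fun x => ?_)
    change TMinus p q (TMinus p q (ι (stdForm p q) x)) = ι (stdForm p q) x
    rw [TMinus_ι, TMinus_ι]
    congr 1
    ext k
    rcases k with k | k <;> simp [flipMinus_apply]
  exact DFunLike.congr_fun this a

theorem reverse_TMinus {p q : ℕ} (a : Cl p q) : reverse (TMinus p q a) = TMinus p q (reverse a) := by
  induction a using CliffordAlgebra.induction with
  | algebraMap r => simp
  | ι x => simp [TMinus_ι]
  | mul a b ha hb => simp [ha, hb]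
  | add a b ha hb => simp [ha, hb]

theorem starConj_starConj {p q : ℕ} (a : Cl p q) : starConj (starConj a) = a := by
  rw [starConj, starConj, reverse_TMinus, TMinus_TMinus, reverse_reverse]

theorem starConj_add {p q : ℕ} (a b : Cl p q) : starConj (a + b) = starConj a + starConj b := by
  simp [starConj]

theorem starConj_smul {p q : ℕ} (r : ℝ) (a : Cl p q) : starConj (r • a) = r • starConj a := by
  simp [starConj]

/-- Reversal and T₋ are commuting involutions, so `starConj` is involutive. The type synonym keeps
this star apart from the usual Clifford conjugation. -/
instance (p q : ℕ) : StarRing (StarCl p q) where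
  star a := starConj (p := p) (q := q) a
  star_involutive a := starConj_starConj _
  star_mul a b := starConj_mul _ _
  star_add a b := starConj_add _ _

instance (p q : ℕ) : StarModule ℝ (StarCl p q) :=
  ⟨fun r a => starConj_smul (p := p) (q := q) r a⟩

/-- The standard generators. -/
def stdGen (p q : ℕ) (i : Fin p ⊕ Fin q) : StarCl p q := ι (stdForm p q) (Pi.single i 1)

theorem ι_eq_sum {p q : ℕ} (x : Fin p ⊕ Fin q → ℝ) :
    (ι (stdForm p q) x : StarCl p q) = ∑ i, x i • stdGen p q i := by
  conv_lhs => rw [pi_eq_sum_univ' x]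
  change ι (stdForm p q) _ = ∑ i, x i • ι (stdForm p q) (Pi.single i 1)
  rw [map_sum]
  refine Finset.sum_congr rfl fun i _ => ?_
  rw [← map_smul]

theorem stdForm_single {p q : ℕ} (i : Fin p ⊕ Fin q) :
    stdForm p q (Pi.single i 1) = stdSign p q i := by
  simp [QuadraticMap.weightedSumSquares_apply, Pi.single_apply]

theorem isFrame_stdGen (p q : ℕ) : IsFrame (stdSign p q) (stdGen p q) where
  sign_mul_self i := by rcases i with i | i <;> simp
  mul_self i := by
    change ι (stdForm p q) _ * ι (stdForm p q) _ = _
    rw [ι_sq_scalar, stdForm_single, Algebra.algebraMap_eq_smul_one]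
    rfl
  star_eq i := by
    change starConj (p := p) (q := q) (ι (stdForm p q) _) = stdSign p q i • ι (stdForm p q) _
    rw [starConj, reverse_ι, TMinus_ι, ← map_smul]
    congr 1
    ext k
    rcases i with i | i <;> rcases k with k | k <;>
      simp [flipMinus_apply, Pi.single_apply, apply_ite (Neg.neg : ℝ → ℝ)]
  anticomm i j hij := by
    refine eq_neg_of_add_eq_zero_left ?_
    change ι (stdForm p q) _ * ι (stdForm p q) _ + ι (stdForm p q) _ * ι (stdForm p q) _ = 0
    rw [ι_mul_ι_add_swap, QuadraticMap.polar]
    simp only [QuadraticMap.weightedSumSquares_apply, ← Finset.sum_sub_distrib]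
    rw [Finset.sum_eq_zero, map_zero]
    intro k _
    by_cases hi : k = i
    · subst hi; simp [Pi.single_apply, hij]
    · by_cases hj : k = j
      · subst hj; simp [Pi.single_apply, hi]
      · simp [Pi.single_apply, hi, hj]

theorem starGenerates_stdGen (p q : ℕ) : StarGenerates (stdGen p q) := by
  intro S hS
  rw [eq_top_iff]
  intro a _
  induction a using CliffordAlgebra.induction with
  | algebraMap r => exact S.algebraMap_mem r
  | ι x =>
    rw [ι_eq_sum]
    exact sum_mem fun i _ => SMulMemClass.smul_mem _ (hS i)
  | mul a b ha hb => exact mul_mem (ha trivial) (hb trivial)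
  | add a b ha hb => exact add_mem (ha trivial) (hb trivial)

theorem finrank_starCl (p q : ℕ) : Module.finrank ℝ (StarCl p q) = 2 ^ (p + q) := by
  change Module.finrank ℝ (Cl p q) = _
  let b := (Pi.basisFun ℝ (Fin p ⊕ Fin q)).reindex finSumFinEquiv
  rw [(CliffordAlgebra.equivExterior (stdForm p q)).finrank_eq,
    Module.finrank_eq_card_basis b.ExteriorAlgebra]
  simp

instance (p q : ℕ) : FiniteDimensional ℝ (StarCl p q) :=
  Module.finite_of_finrank_pos (by rw [finrank_starCl]; positivity)

instance (p q : ℕ) : T2Space (StarCl p q) := by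
  have := IsModuleTopology.topologicalAddGroup ℝ (StarCl p q)
  let e := (Module.finBasis ℝ (StarCl p q)).equivFun
  exact T2Space.of_injective_continuous e.injective
    (IsModuleTopology.continuous_of_linearMap e.toLinearMap)

/-- The table is indexed by d - 1 = p - q - 1, which centres the symmetry d ↦ 2 - d at zero; N = p +
q - 2 counts the generators left after the split. -/
theorem autTable_of_hasFormType {p q : ℕ} {H : Submonoid (Cl p q)} {ε : ℝ} {d : ℤ} {N : ℕ}
    (h : HasFormType d N ε H) (hd : d = p - q) (hN : p + q = N + 2) {herm skew : Prop}
    (h1 : herm → ε = 1) (h2 : skew → ε = -1) : AutTable p q H herm skew := by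
  obtain ⟨hR, hRR, hC, hH, hHH⟩ := h
  refine ⟨fun h => ?_, fun h => ?_, fun h => ?_, fun h => ?_, fun h => ?_⟩ <;>
    simp only [PM8, Int.ModEq] at h
  · obtain ⟨m, hm, a, b⟩ := hRR (by omega)
    exact ⟨m, _, by omega, rfl, fun h => a (h1 h), fun h => b (h2 h)⟩
  · obtain ⟨m, hm, a, b⟩ := hR (by omega)
    exact ⟨m, _, by omega, rfl, fun h => a (h1 h), fun h => b (h2 h)⟩
  · obtain ⟨m, hm, a⟩ := hC (by omega)
    exact ⟨m, _, by omega, rfl, a⟩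
  · obtain ⟨m, hm, a, b⟩ := hH (by omega)
    exact ⟨m, _, by omega, rfl, fun h => a (h1 h), fun h => b (h2 h)⟩
  · obtain ⟨m, hm, a, b⟩ := hHH (by omega)
    exact ⟨m, _, by omega, rfl, fun h => a (h1 h), fun h => b (h2 h)⟩

theorem autTable_plus {p q : ℕ} (hp : 1 ≤ p) (hq : 1 ≤ q) :
    AutTable p q (AutJ (JPlus p q)) (p % 4 = 0 ∨ p % 4 = 1) (p % 4 = 2 ∨ p % 4 = 3) := by
  obtain ⟨p, rfl⟩ := Nat.exists_eq_add_of_le' hp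
  obtain ⟨q, rfl⟩ := Nat.exists_eq_add_of_le' hq
  have := hasFormType_plus (isFrame_stdGen (p + 1) (q + 1)) (starGenerates_stdGen _ _)
    (fun _ => by rw [finrank_starCl, show p + 1 + (q + 1) = p + q + 2 by ring])
  exact autTable_of_hasFormType (H := AutJ (JPlus (p + 1) (q + 1))) this (by push_cast; ring)
    (by ring) prodSign_one_eq_one prodSign_one_eq_neg_one

theorem autTable_minus {p q : ℕ} (hp : 1 ≤ p) (hq : 1 ≤ q) :
    AutTable p q (AutJ (JMinus p q)) ((q + 1) % 4 = 0 ∨ (q + 1) % 4 = 1)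
      ((q + 1) % 4 = 2 ∨ (q + 1) % 4 = 3) := by
  obtain ⟨p, rfl⟩ := Nat.exists_eq_add_of_le' hp
  obtain ⟨q, rfl⟩ := Nat.exists_eq_add_of_le' hq
  have := hasFormType_minus (isFrame_stdGen (p + 1) (q + 1)) (starGenerates_stdGen _ _)
    (fun _ => by rw [finrank_starCl, show p + 1 + (q + 1) = p + q + 2 by ring])
  exact autTable_of_hasFormType (H := AutJ (JMinus (p + 1) (q + 1))) this (by push_cast; ring)
    (by ring) prodSign_neg_one_eq_one prodSign_neg_one_eq_neg_one

end Concrete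

/-! ### The even subalgebra -/

section Even

variable {p q : ℕ}

/-- The standard generators, as elements of `C(p,q)`. -/
abbrev clGen (p q : ℕ) (i : Fin p ⊕ Fin q) : Cl p q := ι (stdForm p q) (Pi.single i 1)

theorem ι_eq_sum_clGen (x : Fin p ⊕ Fin q → ℝ) : ι (stdForm p q) x = ∑ i, x i • clGen p q i :=
  ι_eq_sum x

theorem TMinus_ι_eq (x : Fin p ⊕ Fin q → ℝ) :
    TMinus p q (ι (stdForm p q) x) = ∑ i, (x i * stdSign p q i) • clGen p q i := by
  rw [TMinus_ι, ι_eq_sum_clGen]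
  refine Finset.sum_congr rfl fun i _ => ?_
  rcases i with i | i <;> simp [flipMinus_apply]

/-- An element that twists the generators by `T₋` up to a common sign twists the even part by
`T₋`. -/
theorem mul_even_eq {g : Cl p q} {c : ℝ} (hc : c * c = 1)
    (hg : ∀ i, g * clGen p q i = (c * stdSign p q i) • (clGen p q i * g))
    {a : Cl p q} (ha : a ∈ ClEven p q) : g * a = TMinus p q a * g := by
  have hx : ∀ x, g * ι (stdForm p q) x = c • (TMinus p q (ι (stdForm p q) x) * g) := by
    intro x
    rw [TMinus_ι_eq, ι_eq_sum_clGen, Finset.mul_sum, Finset.sum_mul, Finset.smul_sum]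
    refine Finset.sum_congr rfl fun i _ => ?_
    rw [mul_smul_comm, hg, smul_mul_assoc, smul_smul, smul_smul]
    congr 1; ring
  induction a, ha using CliffordAlgebra.even_induction with
  | algebraMap r => rw [AlgHom.commutes]; exact (Algebra.commutes r g).symm
  | add x y hx hy h1 h2 => rw [mul_add, map_add, add_mul, h1, h2]
  -- Each of the two vectors contributes a factor c, and c² = 1.
  | ι_mul_ι_mul m₁ m₂ x hx' h =>
    rw [map_mul, map_mul, ← mul_assoc, ← mul_assoc, hx, smul_mul_assoc, mul_assoc _ g, hx,
      mul_smul_comm, smul_smul, hc, one_smul, mul_assoc, mul_assoc _ g, h]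
    simp only [mul_assoc]

theorem reverse_mem_even {a : Cl p q} (ha : a ∈ ClEven p q) : reverse a ∈ ClEven p q :=
  (reverse_mem_evenOdd_iff _).2 ha

theorem TMinus_mem_even {a : Cl p q} (ha : a ∈ ClEven p q) : TMinus p q a ∈ ClEven p q := by
  induction a, ha using CliffordAlgebra.even_induction with
  | algebraMap r => rw [AlgHom.commutes]; exact algebraMap_mem _ r
  | add x y hx hy h1 h2 => rw [map_add]; exact add_mem h1 h2
  | ι_mul_ι_mul m₁ m₂ x hx' h =>
    rw [map_mul, map_mul, TMinus_ι, TMinus_ι]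
    exact mul_mem (ι_mul_ι_mem_evenOdd_zero _ _ _) h

/-- For even a, g ᵗa = T₋(ᵗa) g = a* g, so a* g a = g ᵗa a; and g is invertible because g² = ±1. -/
theorem reverse_mul_self_iff {g : Cl p q} {c ε : ℝ} (hc : c * c = 1)
    (hg : ∀ i, g * clGen p q i = (c * stdSign p q i) • (clGen p q i * g))
    (hgg : g * g = ε • 1) (hε : ε * ε = 1) {a : Cl p q} (ha : a ∈ ClEven p q) :
    reverse a * a = 1 ↔ starConj a * g * a = g := by
  rw [starConj, ← mul_even_eq hc hg (reverse_mem_even ha), mul_assoc]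
  constructor
  · intro h; rw [h, mul_one]
  · intro h
    have := congrArg (fun x => ε • (g * x)) h
    simpa only [← mul_assoc, hgg, smul_mul_assoc, one_mul, smul_smul, hε, one_smul] using this

theorem G_eq_inf {g : Cl p q} {c ε : ℝ} (hc : c * c = 1)
    (hg : ∀ i, g * clGen p q i = (c * stdSign p q i) • (clGen p q i * g))
    (hgg : g * g = ε • 1) (hε : ε * ε = 1) : G p q = (ClEven p q).toSubmonoid ⊓ AutJ g := by
  ext a
  exact and_congr_right fun ha => reverse_mul_self_iff hc hg hgg hε ha

theorem neg_one_pow_mul_self (n : ℕ) : ((-1 : ℝ) ^ n) * (-1) ^ n = 1 := by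
  rw [← mul_pow]; norm_num

theorem prodSign_mul_self {c : ℝ} (hc : c * c = 1) (n : ℕ) : prodSign c n * prodSign c n = 1 := by
  rcases prodSign_eq_or hc n with h | h <;> rw [h] <;> norm_num

theorem JPlus_mul_JPlus (p q : ℕ) : JPlus p q * JPlus p q = prodSign 1 p • 1 :=
  ((isFrame_stdGen p q).comp (f := Sum.inl) Sum.inl_injective).prod_mul_self

theorem JMinus_mul_JMinus (p q : ℕ) : JMinus p q * JMinus p q = prodSign (-1) q • 1 :=
  ((isFrame_stdGen p q).comp (f := Sum.inr) Sum.inr_injective).prod_mul_self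

theorem JPlus_mul_clGen (p q : ℕ) (i : Fin (p + 1) ⊕ Fin q) :
    JPlus (p + 1) q * clGen (p + 1) q i
      = ((-1 : ℝ) ^ p * stdSign (p + 1) q i) • (clGen (p + 1) q i * JPlus (p + 1) q) := by
  have hz := isFrame_stdGen (p + 1) q
  rcases i with i | i
  · have : clGen (p + 1) q (Sum.inl i) * JPlus (p + 1) q
        = (-1 : ℝ) ^ p • (JPlus (p + 1) q * clGen (p + 1) q (Sum.inl i)) :=
      mul_prod_ofFn_self (hz.comp Sum.inl_injective).anticomm i
    rw [this, smul_smul]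
    simp [neg_one_pow_mul_self]
  · have : clGen (p + 1) q (Sum.inr i) * JPlus (p + 1) q
        = (-1 : ℝ) ^ (p + 1) • (JPlus (p + 1) q * clGen (p + 1) q (Sum.inr i)) :=
      mul_prod_ofFn_anticomm (y := fun j => stdGen (p + 1) q (Sum.inl j))
        (v := stdGen (p + 1) q (Sum.inr i)) fun j => hz.anticomm (Sum.inl j) (Sum.inr i) (by simp)
    rw [this, smul_smul]
    simp [pow_succ, neg_one_pow_mul_self]

theorem JMinus_mul_clGen (p q : ℕ) (i : Fin p ⊕ Fin (q + 1)) :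
    JMinus p (q + 1) * clGen p (q + 1) i
      = ((-1 : ℝ) ^ (q + 1) * stdSign p (q + 1) i) • (clGen p (q + 1) i * JMinus p (q + 1)) := by
  have hz := isFrame_stdGen p (q + 1)
  rcases i with i | i
  · have : clGen p (q + 1) (Sum.inl i) * JMinus p (q + 1)
        = (-1 : ℝ) ^ (q + 1) • (JMinus p (q + 1) * clGen p (q + 1) (Sum.inl i)) :=
      mul_prod_ofFn_anticomm (y := fun j => stdGen p (q + 1) (Sum.inr j))
        (v := stdGen p (q + 1) (Sum.inl i)) fun j => hz.anticomm (Sum.inr j) (Sum.inl i) (by simp)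
    rw [this, smul_smul]
    simp [neg_one_pow_mul_self]
  · have : clGen p (q + 1) (Sum.inr i) * JMinus p (q + 1)
        = (-1 : ℝ) ^ q • (JMinus p (q + 1) * clGen p (q + 1) (Sum.inr i)) :=
      mul_prod_ofFn_self (hz.comp Sum.inr_injective).anticomm i
    rw [this, smul_smul]
    simp [pow_succ, neg_one_pow_mul_self]

/-- The even subalgebra as a star subalgebra. -/
def evenStar (p q : ℕ) : StarSubalgebra ℝ (StarCl p q) where
  toSubalgebra := ClEven p q
  star_mem' := fun ha => TMinus_mem_even (reverse_mem_even ha)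

theorem stdGen_mul_mem (i j : Fin p ⊕ Fin q) : stdGen p q i * stdGen p q j ∈ evenStar p q :=
  ι_mul_ι_mem_evenOdd_zero _ _ _

/-- The generators of the even subalgebra obtained from a distinguished generator `z_c`. -/
def evenGen {κ : Type*} (f : κ → Fin p ⊕ Fin q) (c : Fin p ⊕ Fin q) (k : κ) : evenStar p q :=
  ⟨stdGen p q (f k) * stdGen p q c, stdGen_mul_mem _ _⟩

/-- Since (zᵢ z_c)² = -sᵢ s_c, a negative z_c preserves the signs of the other generators and a
positive one reverses them. -/
theorem isFrame_evenGen {κ : Type*} {f : κ → Fin p ⊕ Fin q} {c : Fin p ⊕ Fin q}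
    (hf : Function.Injective f) (hfc : ∀ k, f k ≠ c) :
    IsFrame (fun k => -(stdSign p q c * stdSign p q (f k))) (evenGen f c) := by
  classical
  have hz := isFrame_stdGen p q
  refine IsFrame.of_coe ?_
  have := (hz.twist (fun i => i ≠ c) (g := stdGen p q c) (γ := stdSign p q c) (δ := -1)
    (hz.sign_mul_self c) (by norm_num) (hz.mul_self c) (hz.star_eq c)
    (fun i hi => by rw [hz.anticomm i c hi]; simp)
    (fun i hi => by rw [not_not.1 hi])).comp hf
  convert this using 2 with k k
  · simp [hfc]
  · simp [hfc, evenGen]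

/-- The even subalgebra is generated by the products zᵢ zⱼ, and zᵢ zⱼ = -s_c (zᵢ z_c)(zⱼ z_c) for j
≠ c. -/
theorem starGenerates_evenGen {κ : Type*} {f : κ → Fin p ⊕ Fin q} {c : Fin p ⊕ Fin q}
    (hcov : ∀ i, i = c ∨ ∃ k, f k = i) : StarGenerates (evenGen f c) := by
  intro S hS
  have hz := isFrame_stdGen p q
  set S' : StarSubalgebra ℝ (StarCl p q) := S.map (evenStar p q).subtype with hS'
  have key : ∀ k, stdGen p q (f k) * stdGen p q c ∈ S' := fun k => ⟨_, hS k, rfl⟩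
  have key2 : ∀ i, stdGen p q i * stdGen p q c ∈ S' := by
    intro i
    rcases hcov i with rfl | ⟨k, rfl⟩
    · rw [hz.mul_self]; exact SMulMemClass.smul_mem _ (one_mem _)
    · exact key k
  have key3 : ∀ i j, stdGen p q i * stdGen p q j ∈ S' := by
    intro i j
    by_cases hj : j = c
    · subst hj; exact key2 i
    · have h1 : (stdGen p q i * stdGen p q c) * (stdGen p q j * stdGen p q c)
          = (-(stdSign p q c)) • (stdGen p q i * stdGen p q j) := by
        rw [mul_assoc, ← mul_assoc (stdGen p q c), hz.anticomm j c hj, neg_mul, mul_assoc,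
          hz.mul_self]
        simp
      have h2 : stdGen p q i * stdGen p q j = (-(stdSign p q c)) •
          ((stdGen p q i * stdGen p q c) * (stdGen p q j * stdGen p q c)) := by
        rw [h1, smul_smul, neg_mul_neg, hz.sign_mul_self, one_smul]
      rw [h2]
      exact SMulMemClass.smul_mem _ (mul_mem (key2 i) (key2 j))
  have key5 : ∀ x y : Fin p ⊕ Fin q → ℝ,
      (∑ i, x i • stdGen p q i) * (∑ i, y i • stdGen p q i) ∈ S' := by
    intro x y
    rw [Finset.sum_mul_sum]
    refine sum_mem fun i _ => sum_mem fun j _ => ?_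
    rw [smul_mul_smul_comm]
    exact SMulMemClass.smul_mem _ (key3 i j)
  have key4 : ∀ a : Cl p q, a ∈ ClEven p q → (a : StarCl p q) ∈ S' := by
    intro a ha
    induction a, ha using CliffordAlgebra.even_induction with
    | algebraMap r => exact S'.algebraMap_mem r
    | add x y hx hy h1 h2 => exact add_mem h1 h2
    | ι_mul_ι_mul m₁ m₂ x hx' h =>
      rw [ι_eq_sum_clGen m₁, ι_eq_sum_clGen m₂]
      exact mul_mem (key5 m₁ m₂) h
  rw [eq_top_iff]
  rintro ⟨a, ha⟩ -
  obtain ⟨b, hb, e⟩ := key4 a ha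
  rwa [show (⟨a, ha⟩ : evenStar p q) = b from Subtype.ext e.symm]

/-- Left multiplication by v₁⁺, whose square is 1, embeds the odd part in the even part, so the
latter has at least half the dimension. -/
theorem le_finrank_evenStar (p q : ℕ) (hp : 1 ≤ p) :
    2 ^ (p + q) ≤ 2 * Module.finrank ℝ (evenStar p q) := by
  have : FiniteDimensional ℝ (CliffordAlgebra (stdForm p q)) :=
    inferInstanceAs (FiniteDimensional ℝ (StarCl p q))
  have h := Submodule.finrank_add_eq_of_isCompl (evenOdd_isCompl (stdForm p q))
  rw [show Module.finrank ℝ (CliffordAlgebra (stdForm p q)) = 2 ^ (p + q) from finrank_starCl p q] at h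
  let v : Fin p ⊕ Fin q → ℝ := Pi.single (Sum.inl ⟨0, hp⟩) 1
  have hv : ι (stdForm p q) v * ι (stdForm p q) v = 1 := by
    rw [ι_sq_scalar, stdForm_single]; simp
  let L : evenOdd (stdForm p q) 1 →ₗ[ℝ] evenOdd (stdForm p q) 0 :=
    ((LinearMap.mulLeft ℝ (ι (stdForm p q) v)).comp (Submodule.subtype _)).codRestrict _ fun x => by
      have := SetLike.mul_mem_graded (ι_mem_evenOdd_one (stdForm p q) v) x.2
      exact this
  have hL : Function.Injective L := by
    intro x y hxy
    have := congrArg (fun w => ι (stdForm p q) v * w) (congrArg Subtype.val hxy)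
    have h2 : ∀ x, ι (stdForm p q) v * (L x : Cl p q) = x := fun x => by
      change ι (stdForm p q) v * (ι (stdForm p q) v * (x : Cl p q)) = x
      rw [← mul_assoc, hv, one_mul]
    simp only [h2] at this
    exact Subtype.ext this
  have h1 := LinearMap.finrank_le_finrank_of_injective hL
  have h2 : Module.finrank ℝ (evenStar p q) = Module.finrank ℝ (evenOdd (stdForm p q) 0) := rfl
  omega

instance (p q : ℕ) : IsTopologicalAddGroup (StarCl p q) :=
  IsModuleTopology.topologicalAddGroup ℝ (StarCl p q)
instance (p q : ℕ) : ContinuousSMul ℝ (StarCl p q) :=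
  IsModuleTopology.toContinuousSMul ℝ (StarCl p q)

instance (p q : ℕ) : TopologicalSpace (evenStar p q) := instTopologicalSpaceSubtype

instance (p q : ℕ) : FiniteDimensional ℝ (evenStar p q) :=
  inferInstanceAs (FiniteDimensional ℝ (Subalgebra.toSubmodule (evenStar p q).toSubalgebra))

instance (p q : ℕ) : IsModuleTopology ℝ (evenStar p q) := by
  have : IsTopologicalAddGroup (evenStar p q) :=
    inferInstanceAs (IsTopologicalAddGroup (Subalgebra.toSubmodule (evenStar p q).toSubalgebra))
  have : ContinuousSMul ℝ (evenStar p q) :=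
    inferInstanceAs (ContinuousSMul ℝ (Subalgebra.toSubmodule (evenStar p q).toSubalgebra))
  exact isModuleTopologyOfFiniteDimensional

instance (p q : ℕ) : Nontrivial (evenStar p q) :=
  ⟨0, 1, fun h => zero_ne_one (congrArg Subtype.val h)⟩

/-- A submonoid of the even part of `C(p,q)` may be regarded inside `evenStar p q`. -/
theorem lieIso_evenStar {H : Submonoid (Cl p q)} (hH : ∀ a ∈ H, a ∈ ClEven p q)
    {K : Submonoid (evenStar p q)} (h : ∀ a, a ∈ K ↔ (a : StarCl p q) ∈ (H : Set (Cl p q))) :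
    LieIso H K :=
  ⟨{ toFun := fun a => ⟨⟨a.1, hH a a.2⟩, (h _).2 a.2⟩
     invFun := fun b => ⟨b.1.1, (h _).1 b.2⟩
     left_inv := fun a => rfl
     right_inv := fun b => rfl
     map_mul' := fun a b => rfl
     continuous_toFun := continuous_induced_rng.2 (continuous_induced_rng.2 continuous_subtype_val)
     continuous_invFun := 
      continuous_induced_rng.2 (show Continuous fun b : K => (b.1.1 : StarCl p q) from
        continuous_subtype_val.comp continuous_subtype_val) }⟩

theorem lieIso_G_isomGroup {g : Cl p q} (hge : g ∈ ClEven p q) {c ε : ℝ} (hc : c * c = 1)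
    (hg : ∀ i, g * clGen p q i = (c * stdSign p q i) • (clGen p q i * g))
    (hgg : g * g = ε • 1) (hε : ε * ε = 1) :
    LieIso (G p q) (isomGroup (⟨g, hge⟩ : evenStar p q)) := by
  refine lieIso_evenStar (H := G p q) (fun a ha => ha.1) fun a => ?_
  have := reverse_mul_self_iff hc hg hgg hε a.2
  constructor
  · intro h
    exact ⟨a.2, this.2 (congrArg Subtype.val h)⟩
  · intro h
    exact Subtype.ext (this.1 h.2)

theorem isomGroup_smul {A : Type*} [Ring A] [StarRing A] [Algebra ℝ A] {δ : ℝ}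
    (hδ : δ = 1 ∨ δ = -1) (J : A) : isomGroup (δ • J) = isomGroup J := by
  rcases hδ with rfl | rfl
  · rw [one_smul]
  · ext a
    rw [mem_isomGroup, mem_isomGroup]
    simp

end Even

/-! ### `C_even(p,q)`, and `G(p,q)` when `p` or `q` is even -/

section Even

/-- Collecting the n copies of y₀ leaves y₀ⁿ = ± y₀ for odd n. Thus a product of an even number of
generators is, up to sign, the product of even generators yⱼ y₀. -/
theorem exists_prod_mul_head {A : Type*} [Ring A] [StarRing A] [Algebra ℝ A] {n : ℕ}
    {s : Fin (n + 1) → ℝ} {y : Fin (n + 1) → A} (hy : IsFrame s y) (hn : Odd n) :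
    ∃ δ : ℝ, (δ = 1 ∨ δ = -1) ∧
      (List.ofFn fun j : Fin n => y j.succ * y 0).prod = δ • (List.ofFn y).prod := by
  have h0 : ∀ j : Fin n, y 0 * y j.succ = -(y j.succ * y 0) := fun j =>
    hy.anticomm _ _ (Fin.succ_ne_zero j)
  obtain ⟨δ, hδ, e⟩ := prod_ofFn_mul h0
  obtain ⟨k, rfl⟩ := hn
  have h2 := mul_prod_ofFn_anticomm h0
  rw [Odd.neg_one_pow ⟨k, rfl⟩] at h2
  have h3 : y 0 ^ (2 * k + 1) = s 0 ^ k • y 0 := by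
    rw [pow_succ, pow_mul, pow_two, hy.mul_self, smul_pow, one_pow, smul_mul_assoc, one_mul]
  have h4 : (List.ofFn y).prod = y 0 * (List.ofFn fun j => y j.succ).prod := by
    rw [List.ofFn_succ, List.prod_cons]
  refine ⟨δ * s 0 ^ k * -1, ?_, ?_⟩
  · rcases hδ with rfl | rfl <;> rcases mul_self_eq_one_iff.1 (hy.sign_mul_self 0) with h | h <;>
      rw [h] <;> rcases neg_one_pow_eq_or ℝ k with h' | h' <;> simp [h']
  · rw [e, h3, h4, h2, mul_smul_comm, smul_smul, smul_smul]
    congr 1; ring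

variable {p q : ℕ}

theorem isFrame_evenGen_inr (p q : ℕ) :
    IsFrame (stdSign p q) (evenGen (p := p) (q := q + 1) (Sum.map id Fin.succ) (Sum.inr 0)) :=
  (isFrame_evenGen (Function.injective_id.sumMap (Fin.succ_injective q))
    (by rintro (k | k) <;> simp)).congr (by rintro (k | k) <;> simp)

theorem starGenerates_evenGen_inr (p q : ℕ) :
    StarGenerates (evenGen (p := p) (q := q + 1) (Sum.map id Fin.succ) (Sum.inr 0)) :=
  starGenerates_evenGen (by
    rintro (i | i)
    · exact .inr ⟨Sum.inl i, rfl⟩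
    · induction i using Fin.cases with
      | zero => exact .inl rfl
      | succ i => exact .inr ⟨Sum.inr i, rfl⟩)

theorem isFrame_evenGen_inl (p q : ℕ) :
    IsFrame (stdSign q p)
      (evenGen (p := p + 1) (q := q) (Sum.elim Sum.inr (Sum.inl ∘ Fin.succ)) (Sum.inl 0)) :=
  (isFrame_evenGen
    (Sum.inr_injective.sumElim (Sum.inl_injective.comp (Fin.succ_injective p)) (by simp))
    (by rintro (k | k) <;> simp)).congr (by rintro (k | k) <;> simp)

theorem starGenerates_evenGen_inl (p q : ℕ) :
    StarGenerates
      (evenGen (p := p + 1) (q := q) (Sum.elim Sum.inr (Sum.inl ∘ Fin.succ)) (Sum.inl 0)) :=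
  starGenerates_evenGen (by
    rintro (i | i)
    · induction i using Fin.cases with
      | zero => exact .inl rfl
      | succ i => exact .inr ⟨Sum.inr i, rfl⟩
    · exact .inr ⟨Sum.inl i, rfl⟩)

theorem hasCliffordType_evenStar (hp : 1 ≤ p) :
    HasCliffordType ((p : ℤ) - q) (p + q) (evenStar p (q + 1)) :=
  hasCliffordType_of_isFrame p q (isFrame_evenGen_inr p q) (starGenerates_evenGen_inr p q)
    fun _ => by
      have := le_finrank_evenStar p (q + 1) hp
      rw [← add_assoc, pow_succ] at this
      omega

theorem coe_list_prod_ofFn {n : ℕ} (y : Fin n → evenStar p q) :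
    (((List.ofFn y).prod : evenStar p q) : StarCl p q) = (List.ofFn fun i => (y i : StarCl p q)).prod := by
  rw [← StarSubalgebra.subtype_apply, map_list_prod, List.map_ofFn]
  rfl

theorem lieIso_G_isomGroup_of_eq_smul {g : Cl p q} {W : evenStar p q} {δ : ℝ}
    (hδ : δ = 1 ∨ δ = -1) (hW : Eq (α := Cl p q) W.1 (δ • g)) {c ε : ℝ}
    (hc : c * c = 1) (hg : ∀ i, g * clGen p q i = (c * stdSign p q i) • (clGen p q i * g))
    (hgg : g * g = ε • 1) (hε : ε * ε = 1) : LieIso (G p q) (isomGroup W) := by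
  have h : ∀ w : Cl p q, w = δ • g → δ • w = g := by
    rintro _ rfl
    rcases hδ with rfl | rfl <;> simp
  have h : Eq (α := Cl p q) (δ • W).1 g := h W.1 hW
  subst h
  have := lieIso_G_isomGroup (δ • W).2 hc hg hgg hε
  exact isomGroup_smul hδ W ▸ this

/-- Relative to the distinguished generator z₀⁻ the even subalgebra has a frame of type (p,q+1), and
J₋ is, up to sign, the product of its negative generators. So G(p,q+2) is the group of
`hasFormType_minus` for that frame. -/
theorem hasFormType_G_of_even_right (hp : 1 ≤ p) (hq : Even (q + 2)) :
    HasFormType ((p : ℤ) - (q + 1)) (p + q - 1) (prodSign (-1) (q + 1)) (G p (q + 2)) := by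
  obtain ⟨p, rfl⟩ := Nat.exists_eq_add_of_le' hp
  have hq' : Odd (q + 1) := by grind
  have h := hasFormType_minus (isFrame_evenGen_inr (p + 1) (q + 1))
    (starGenerates_evenGen_inr (p + 1) (q + 1)) fun _ => by
      have := le_finrank_evenStar (p + 1) (q + 1 + 1) hp
      rw [show p + 1 + (q + 1 + 1) = p + q + 2 + 1 by ring, pow_succ] at this
      omega
  obtain ⟨δ, hδ, e⟩ :=
    exists_prod_mul_head ((isFrame_stdGen (p + 1) (q + 2)).comp Sum.inr_injective) hq'
  refine HasFormType.of_lieIso (lieIso_G_isomGroup_of_eq_smul hδ ?_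
    (neg_one_pow_mul_self (q + 2)) (JMinus_mul_clGen (p + 1) (q + 1)) (JMinus_mul_JMinus _ _)
    (prodSign_mul_self (by norm_num) _)) (by
      convert h using 1
      · push_cast; ring
      · omega)
  rw [coe_list_prod_ofFn]
  exact e

/-- A positive distinguished generator reverses signs: the frame has type (q,p+1), and J₊ is now, up
to sign, the product of its negative generators. -/
theorem hasFormType_G_of_even_left (hq : 1 ≤ q) (hp : Even (p + 2)) :
    HasFormType ((q : ℤ) - (p + 1)) (q + p - 1) (prodSign (-1) (p + 1)) (G (p + 2) q) := by
  obtain ⟨q, rfl⟩ := Nat.exists_eq_add_of_le' hq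
  have hp' : Odd (p + 1) := by grind
  have h := hasFormType_minus (isFrame_evenGen_inl (p + 1) (q + 1))
    (starGenerates_evenGen_inl (p + 1) (q + 1)) fun _ => by
      have := le_finrank_evenStar (p + 1 + 1) (q + 1) (by omega)
      rw [show p + 1 + 1 + (q + 1) = q + p + 2 + 1 by ring, pow_succ] at this
      omega
  obtain ⟨δ, hδ, e⟩ :=
    exists_prod_mul_head ((isFrame_stdGen (p + 2) (q + 1)).comp Sum.inl_injective) hp'
  refine HasFormType.of_lieIso (lieIso_G_isomGroup_of_eq_smul hδ ?_
    (neg_one_pow_mul_self (p + 1)) (JPlus_mul_clGen (p + 1) (q + 1)) (JPlus_mul_JPlus _ _)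
    (prodSign_mul_self (by norm_num) _)) (by
      convert h using 1
      · push_cast; ring
      · omega)
  rw [coe_list_prod_ofFn]
  exact e

theorem algIso_clEven {B : Type*} [Ring B] [Algebra ℝ B] [Star B]
    (h : Nonempty (evenStar p q ≃⋆ₐ[ℝ] B)) : AlgIso (ClEven p q) B := by
  obtain ⟨e⟩ := h
  exact ⟨AlgEquiv.ofLinearEquiv (A₁ := ClEven p q)
    { e.toRingEquiv.toAddEquiv with map_smul' := fun r x => map_smul e r x } (map_one e)
    (fun x y => map_mul e x y)⟩

end Even

/-! ### Isometries of an anti-involution that swaps two blocks -/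

section Swap

/-- The centre of a simple ring is a field. -/
theorem eq_or_eq_neg_of_center_sq {M : Type*} [Ring M] [IsSimpleRing M] {w : M}
    (hc : ∀ x, w * x = x * w) (hw : w * w = 1) : w = 1 ∨ w = -1 := by
  letI := (IsSimpleRing.isField_center M).toField
  have hm : w ∈ Subring.center M := Subring.mem_center_iff.2 fun x => (hc x).symm
  have : (⟨w, hm⟩ : Subring.center M) * ⟨w, hm⟩ = 1 := Subtype.ext hw
  rcases mul_self_eq_one_iff.1 this with h | h
  · exact .inl (congrArg Subtype.val h)
  · exact .inr (congrArg Subtype.val h)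

variable {A M : Type*} [Ring A] [Algebra ℝ A] [TopologicalSpace A] [IsModuleTopology ℝ A]
  [Ring M] [Algebra ℝ M] [TopologicalSpace M] [IsModuleTopology ℝ M] [FiniteDimensional ℝ M]

/-- Since τ exchanges the two factors, an isometry is determined by its first component. That
component can be any unit u, and the second is then forced to be τ(u⁻¹). -/
theorem lieIso_units_of_swap (φ : A ≃ₐ[ℝ] M × M) (τ : A →ₗ[ℝ] A)
    (hτ : ∀ a b, τ (a * b) = τ b * τ a) (hττ : ∀ a, τ (τ a) = a)
    (hP : τ (φ.symm (1, 0)) = φ.symm (0, 1)) {H : Submonoid A}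
    (hH : ∀ a, a ∈ H ↔ τ a * a = 1) : LieIso H Mˣ := by
  have : IsTopologicalAddGroup M := IsModuleTopology.topologicalAddGroup ℝ M
  have : ContinuousSMul ℝ M := IsModuleTopology.toContinuousSMul ℝ M
  have : IsTopologicalAddGroup A := IsModuleTopology.topologicalAddGroup ℝ A
  have : ContinuousSMul ℝ A := IsModuleTopology.toContinuousSMul ℝ A
  have : IsArtinianRing M := IsArtinianRing.of_finite ℝ M
  have cφ : Continuous φ := IsModuleTopology.continuous_of_linearMap φ.toLinearMap
  have cψ : Continuous φ.symm := IsModuleTopology.continuous_of_linearMap φ.symm.toLinearMap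
  have cτ : Continuous τ := IsModuleTopology.continuous_of_linearMap τ
  have hfst : ∀ a, a ∈ H → (φ (τ a)).1 * (φ a).1 = 1 := fun a ha => by
    rw [← Prod.fst_mul, ← map_mul, (hH a).1 ha, map_one, Prod.fst_one]
  -- One-sided inverses in the Artinian ring M are two-sided.
  let f : H → Mˣ := fun a =>
    ⟨(φ a).1, (φ (τ a)).1, mul_eq_one_comm.1 (hfst a a.2), hfst a a.2⟩
  let g : Mˣ → A := fun u => φ.symm (u.1, 0) + τ (φ.symm (↑u⁻¹, 0))
  have k1 : ∀ x : M, φ.symm (x, 0) = φ.symm (1, 0) * φ.symm (x, 0) := fun x => by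
    rw [← map_mul, Prod.mk_mul_mk, one_mul, mul_zero]
  have k2 : ∀ x : M, φ.symm (x, 0) = φ.symm (x, 0) * φ.symm (1, 0) := fun x => by
    rw [← map_mul, Prod.mk_mul_mk, mul_one, mul_zero]
  have k3 : ∀ x : M, τ (φ.symm (x, 0)) = φ.symm (0, 1) * τ (φ.symm (x, 0)) := fun x => by
    conv_lhs => rw [k2, hτ, hP]
  have k4 : ∀ x : M, τ (φ.symm (x, 0)) = τ (φ.symm (x, 0)) * φ.symm (0, 1) := fun x => by
    conv_lhs => rw [k1, hτ, hP]
  have z1 : φ.symm ((0, 1) : M × M) * φ.symm (1, 0) = 0 := by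
    rw [← map_mul, Prod.mk_mul_mk, mul_zero, zero_mul]; exact map_zero _
  have z2 : φ.symm ((1, 0) : M × M) * φ.symm (0, 1) = 0 := by
    rw [← map_mul, Prod.mk_mul_mk, mul_zero, zero_mul]; exact map_zero _
  have m1 : ∀ x y : M, τ (φ.symm (x, 0)) * φ.symm (y, 0) = 0 := fun x y => by
    rw [k4, k1 y, mul_assoc, ← mul_assoc (φ.symm (0, 1)), z1, zero_mul, mul_zero]
  have m2 : ∀ x y : M, φ.symm (x, 0) * τ (φ.symm (y, 0)) = 0 := fun x y => by
    rw [k2, k3 y, mul_assoc, ← mul_assoc (φ.symm (1, 0)), z2, zero_mul, mul_zero]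
  have m3 : ∀ u : Mˣ, φ.symm ((↑u⁻¹ : M), (0 : M)) * φ.symm ((u : M), (0 : M)) = φ.symm (1, 0) :=
    fun u => by rw [← map_mul, Prod.mk_mul_mk, u.inv_mul, zero_mul]
  have gH : ∀ u, g u ∈ H := fun u => by
    rw [hH]
    simp only [g, map_add, hττ, add_mul, mul_add, m1, m2, m3, add_zero, zero_add]
    rw [← hτ, m3, hP, ← map_add, Prod.mk_add_mk, zero_add, add_zero]
    exact map_one _
  have d1 : ∀ a, φ.symm ((φ a).1, 0) = a * φ.symm (1, 0) := fun a => by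
    apply φ.injective
    rw [map_mul, AlgEquiv.apply_symm_apply, AlgEquiv.apply_symm_apply]
    ext <;> simp
  refine ⟨{
    toFun := f
    invFun := fun u => ⟨g u, gH u⟩
    left_inv := ?_
    right_inv := ?_
    map_mul' := ?_
    continuous_toFun := ?_
    continuous_invFun := ?_ }⟩
  · intro a
    apply Subtype.ext
    change φ.symm ((φ a).1, 0) + τ (φ.symm ((φ (τ a)).1, 0)) = a
    have d2 : φ.symm ((0, 1) : M × M) * a = a * φ.symm (0, 1) := by
      apply φ.injective
      rw [map_mul, map_mul, AlgEquiv.apply_symm_apply]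
      ext <;> simp
    rw [d1, d1, hτ, hττ, hP, d2, ← mul_add, ← map_add, Prod.mk_add_mk, zero_add, add_zero,
      show ((1, 1) : M × M) = 1 from rfl, map_one, mul_one]
  · intro u
    apply Units.ext
    change (φ (φ.symm (u.1, 0) + τ (φ.symm (↑u⁻¹, 0)))).1 = u
    rw [k3]
    simp
  · intro a b
    apply Units.ext
    change (φ ((a * b : H) : A)).1 = (φ a).1 * (φ b).1
    simp
  · refine Units.continuous_iff.2 ⟨?_, ?_⟩
    · exact continuous_fst.comp (cφ.comp continuous_subtype_val)
    · exact continuous_fst.comp (cφ.comp (cτ.comp continuous_subtype_val))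
  · refine Continuous.subtype_mk ?_ _
    refine (cψ.comp (Units.continuous_val.prodMk continuous_const)).add
      (cτ.comp (cψ.comp (Units.continuous_coe_inv.prodMk continuous_const)))

/-- If a central square root of one is reversed by an anti-involution, the isometries of the
anti-involution form a general linear group. -/
theorem lieIso_units_of_central [IsSimpleRing M] [Nontrivial A] (φ : A ≃ₐ[ℝ] M × M) (τ : A →ₗ[ℝ] A)
    (hτ : ∀ a b, τ (a * b) = τ b * τ a) (hττ : ∀ a, τ (τ a) = a) (hτ1 : τ 1 = 1) {w : A}
    (hw : w * w = 1) (hc : ∀ a, w * a = a * w) (hτw : τ w = -w) {H : Submonoid A}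
    (hH : ∀ a, a ∈ H ↔ τ a * a = 1) : LieIso H Mˣ := by
  -- If w corresponds to (1,-1), the two central idempotents are (1 ± w)/2, and τ w = -w exchanges
  -- them.
  have key : ∀ φ : A ≃ₐ[ℝ] M × M, φ w = (1, -1) → LieIso H Mˣ := by
    intro φ h
    refine lieIso_units_of_swap φ τ hτ hττ ?_ hH
    have e1 : φ.symm (1, 0) = (2⁻¹ : ℝ) • (1 + w) := by
      apply φ.injective
      rw [AlgEquiv.apply_symm_apply, map_smul, map_add, h, map_one]
      ext
      · simp only [Prod.smul_fst, Prod.fst_add, Prod.fst_one]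
        rw [← two_smul ℝ (1 : M), smul_smul]; norm_num
      · simp
    have e2 : φ.symm (0, 1) = (2⁻¹ : ℝ) • (1 - w) := by
      apply φ.injective
      rw [AlgEquiv.apply_symm_apply, map_smul, map_sub, h, map_one]
      ext
      · simp
      · simp only [Prod.smul_snd, Prod.snd_sub, Prod.snd_one, sub_neg_eq_add]
        rw [← two_smul ℝ (1 : M), smul_smul]; norm_num
    rw [e1, e2, map_smul, map_add, hτ1, hτw, sub_eq_add_neg]
  have hw' : φ w * φ w = 1 := by rw [← map_mul, hw, map_one]
  have hc' : ∀ x, φ w * x = x * φ w := fun x => by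
    obtain ⟨a, rfl⟩ := φ.surjective x
    rw [← map_mul, hc, map_mul]
  have hne : w ≠ 1 ∧ w ≠ -1 := by
    have h2 : (1 : A) ≠ -1 := fun h => by
      have : (2 : ℝ) • (1 : A) = 0 := by rw [two_smul]; nth_rewrite 1 [h]; simp
      rcases smul_eq_zero.1 this with h | h
      · norm_num at h
      · exact one_ne_zero h
    constructor
    · rintro rfl; exact h2 (hτ1.symm.trans hτw)
    · rintro rfl; rw [map_neg, hτ1, neg_neg] at hτw; exact h2 hτw.symm
  -- Both components of φ w are ±1. Equal signs would give w = ±1, contrary to τ w = -w; the order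
  -- of opposite signs is adjusted by exchanging the factors.
  have f1 := eq_or_eq_neg_of_center_sq (w := (φ w).1)
    (fun x => congrArg Prod.fst (hc' (x, 0))) (congrArg Prod.fst hw')
  have f2 := eq_or_eq_neg_of_center_sq (w := (φ w).2)
    (fun x => congrArg Prod.snd (hc' (0, x))) (congrArg Prod.snd hw')
  rcases f1 with f1 | f1 <;> rcases f2 with f2 | f2
  · exact absurd (φ.injective (by rw [map_one]; exact Prod.ext f1 f2)) hne.1
  · exact key φ (Prod.ext f1 f2)
  · exact key (φ.trans (AlgEquiv.ofRingEquiv (f := RingEquiv.prodComm) fun _ => rfl)) (Prod.ext f2 f1)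
  · exact absurd (φ.injective (by rw [map_neg, map_one]; exact Prod.ext f1 f2)) hne.2

end Swap

/-! ### Complexification of a real form -/

section Complexify

variable {A : Type*} [Ring A] [Algebra ℝ A] {m : Type} [Fintype m] [DecidableEq m]

/-- The extension to complex matrices of an algebra homomorphism on real matrices, by a square root
of `-1` that commutes with its image. -/
def complexify (ψ : Matrix m m ℝ →ₐ[ℝ] A) (w : A) (hw : w * w = -1)
    (hc : ∀ X, w * ψ X = ψ X * w) : Matrix m m ℂ →ₐ[ℝ] A :=
  AlgHom.ofLinearMap
    { toFun := fun X => ψ (X.map Complex.re) + w * ψ (X.map Complex.im)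
      map_add' := fun X Y => by
        have h1 : (X + Y).map Complex.re = X.map Complex.re + Y.map Complex.re := by ext; simp
        have h2 : (X + Y).map Complex.im = X.map Complex.im + Y.map Complex.im := by ext; simp
        rw [h1, h2, map_add, map_add, mul_add]; abel
      map_smul' := fun r X => by
        have h1 : (r • X).map Complex.re = r • X.map Complex.re := by ext; simp
        have h2 : (r • X).map Complex.im = r • X.map Complex.im := by ext; simp
        rw [h1, h2, map_smul, map_smul, mul_smul_comm, smul_add]; rfl }
    (by
      have h1 : (1 : Matrix m m ℂ).map Complex.re = 1 := by
        rw [Matrix.map_one _ (by simp) (by simp)]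
      have h2 : (1 : Matrix m m ℂ).map Complex.im = 0 := by
        ext i j; by_cases h : i = j <;> simp [Matrix.one_apply, h]
      change ψ _ + w * ψ _ = 1
      rw [h1, h2, map_one, map_zero, mul_zero, add_zero])
    (fun X Y => by
      have h1 : (X * Y).map Complex.re =
          X.map Complex.re * Y.map Complex.re - X.map Complex.im * Y.map Complex.im := by
        ext; simp [Matrix.mul_apply, Finset.sum_sub_distrib]
      have h2 : (X * Y).map Complex.im =
          X.map Complex.re * Y.map Complex.im + X.map Complex.im * Y.map Complex.re := by
        ext; simp [Matrix.mul_apply, Finset.sum_add_distrib]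
      change ψ _ + w * ψ _ = (ψ _ + w * ψ _) * (ψ _ + w * ψ _)
      rw [h1, h2, map_sub, map_add, map_mul, map_mul, map_mul, map_mul]
      generalize X.map Complex.im = X₂, Y.map Complex.im = Y₂
      have e1 : ∀ a, ψ a * (w * ψ Y₂) = w * (ψ a * ψ Y₂) := fun a => by
        rw [← mul_assoc, ← hc, mul_assoc]
      have e2 : w * ψ X₂ * (w * ψ Y₂) = -(ψ X₂ * ψ Y₂) := by
        rw [mul_assoc, e1, ← mul_assoc, hw, neg_one_mul]
      simp only [add_mul, mul_add, e1, e2]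
      noncomm_ring)

theorem complexify_apply {ψ : Matrix m m ℝ →ₐ[ℝ] A} {w : A} {hw : w * w = -1}
    {hc : ∀ X, w * ψ X = ψ X * w} (X : Matrix m m ℂ) :
    complexify ψ w hw hc X = ψ (X.map Complex.re) + w * ψ (X.map Complex.im) := rfl

variable [TopologicalSpace A] [IsModuleTopology ℝ A] [Nontrivial A] [FiniteDimensional ℝ A]
  [Nonempty m]

/-- With w in the role of i, A is the complexification of the real matrices, and τ w = w makes τ
complex linear. So `hψ` extends to complex matrices: τ is the transpose conjugated by S, and τ(a) a
= 1 becomes XᵀSX = S. -/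
theorem lieIso_of_complexify {ψ : Matrix m m ℝ →ₐ[ℝ] A} {w : A} (hw : w * w = -1)
    (hc : ∀ X, w * ψ X = ψ X * w)
    (hA : Module.finrank ℝ A = Module.finrank ℝ (Matrix m m ℂ)) {τ : A →ₗ[ℝ] A}
    (hτ : ∀ a b, τ (a * b) = τ b * τ a) (hτw : τ w = w) {S : Matrix m m ℝ} {ε : ℝ}
    (hS : S * S = ε • 1) (hε : ε * ε = 1) (hψ : ∀ X, ψ S * τ (ψ X) = ψ X.transpose * ψ S)
    {H : Submonoid A} (hH : ∀ a, a ∈ H ↔ τ a * a = 1) {K : Submonoid (Matrix m m ℂ)}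
    (hK : ∀ X, X ∈ K ↔ X.transpose * S.map Complex.ofReal * X = S.map Complex.ofReal) :
    LieIso H K := by
  let Ψ := complexify ψ w hw hc
  have hΨS : Ψ (S.map Complex.ofReal) = ψ S := by
    have h1 : (S.map Complex.ofReal).map Complex.re = S := by ext; simp
    have h2 : (S.map Complex.ofReal).map Complex.im = 0 := by ext; simp
    rw [complexify_apply, h1, h2, map_zero, mul_zero, add_zero]
  -- Complex matrices form a simple ring; bijectivity then follows from equal dimensions.
  have hinj : Function.Injective Ψ := RingHom.injective Ψ.toRingHom
  have hbij : Function.Bijective Ψ := ⟨hinj,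
    (LinearMap.injective_iff_surjective_of_finrank_eq_finrank (f := Ψ.toLinearMap) hA.symm).1 hinj⟩
  have hT : ∀ X, ψ S * τ (Ψ X) = Ψ X.transpose * ψ S := fun X => by
    rw [complexify_apply, complexify_apply, map_add, hτ, hτw, mul_add, ← mul_assoc, hψ, hψ, add_mul,
      mul_assoc (ψ _) (ψ S) w, ← hc, ← mul_assoc, ← hc]
    rfl
  let e : Matrix m m ℂ ≃ₐ[ℝ] A := AlgEquiv.ofBijective Ψ hbij
  have hJ : ψ S * ψ S = ε • 1 := by rw [← map_mul, hS, map_smul, map_one]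
  refine lieIso_of_algEquiv e.symm fun a => ?_
  obtain ⟨X, rfl⟩ := e.surjective a
  rw [AlgEquiv.symm_apply_apply, hH, hK]
  change τ (Ψ X) * Ψ X = 1 ↔ _
  rw [← hinj.eq_iff (a := _ * _), map_mul, map_mul, hΨS, ← hT, mul_assoc]
  constructor
  · intro h; rw [h, mul_one]
  · intro h
    have := congrArg (fun x => ε • (ψ S * x)) h
    simpa only [← mul_assoc, hJ, smul_mul_assoc, one_mul, smul_smul, hε, one_smul] using this

end Complexify

/-! ### Complex orthogonal and symplectic groups -/

section Complex

theorem mem_SpC_iff {n : ℕ} (X : Matrix (Fin n ⊕ Fin n) (Fin n ⊕ Fin n) ℂ) :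
    X ∈ SpC n ↔ X.transpose * (skewMatrix n ℝ).map Complex.ofReal * X =
      (skewMatrix n ℝ).map Complex.ofReal := by
  have : (skewMatrix n ℝ).map Complex.ofReal = Matrix.J (Fin n) ℂ := by
    rw [skewMatrix, Matrix.J, Matrix.fromBlocks_map]
    congr 1 <;> ext i j <;> by_cases h : i = j <;> simp [Matrix.one_apply, h]
  rw [this]
  exact SymplecticGroup.mem_iff'

/-- Complex matrices that preserve a symmetric bilinear form with matrix `diag(1,…,1,-1,…,-1)`. -/
def signIsometries (n : ℕ) : Submonoid (Matrix (Fin n ⊕ Fin n) (Fin n ⊕ Fin n) ℂ) where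
  carrier := {X | X.transpose * (signMatrix n ℝ).map Complex.ofReal * X =
      (signMatrix n ℝ).map Complex.ofReal}
  one_mem' := by simp
  mul_mem' := by
    intro X Y (hX : _ = _) (hY : _ = _)
    change (X * Y).transpose * _ * (X * Y) = _
    calc _ = Y.transpose * (X.transpose * (signMatrix n ℝ).map Complex.ofReal * X) * Y := by
          rw [Matrix.transpose_mul]; simp only [Matrix.mul_assoc]
      _ = _ := by rw [hX, hY]

/-- Complex symmetric forms have no signature: diag(1,-1) = P² with P = diag(1,i). -/
theorem lieIso_signIsometries (n : ℕ) : LieIso (signIsometries n) (OC (2 * n)) := by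
  let P : Matrix (Fin n ⊕ Fin n) (Fin n ⊕ Fin n) ℂ := Matrix.diagonal (Sum.elim (fun _ => 1) fun _ => Complex.I)
  let Q : Matrix (Fin n ⊕ Fin n) (Fin n ⊕ Fin n) ℂ := Matrix.diagonal (Sum.elim (fun _ => 1) fun _ => -Complex.I)
  have hS : (signMatrix n ℝ).map Complex.ofReal = P * P := by
    ext i j
    rcases i with i | i <;> rcases j with j | j <;>
      by_cases h : i = j <;> simp [P, signMatrix, Matrix.one_apply, Matrix.diagonal_apply, h]
  have hPQ : P * Q = 1 := by
    rw [Matrix.diagonal_mul_diagonal, ← Matrix.diagonal_one]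
    congr 1; ext i; rcases i with i | i <;> simp
  have hQP : Q * P = 1 := by
    rw [Matrix.diagonal_mul_diagonal, ← Matrix.diagonal_one]
    congr 1; ext i; rcases i with i | i <;> simp
  have hPQ' : ∀ X, P * (Q * X) = X := fun X => by rw [← mul_assoc, hPQ, one_mul]
  have hQP' : ∀ X, Q * (P * X) = X := fun X => by rw [← mul_assoc, hQP, one_mul]
  have hPt : P.transpose = P := Matrix.diagonal_transpose _
  have hQt : Q.transpose = Q := Matrix.diagonal_transpose _
  let e : Matrix (Fin n ⊕ Fin n) (Fin n ⊕ Fin n) ℂ ≃ₐ[ℝ] Matrix (Fin n ⊕ Fin n) (Fin n ⊕ Fin n) ℂ :=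
    AlgEquiv.ofLinearEquiv
      { toFun := fun X => P * X * Q
        invFun := fun X => Q * X * P
        left_inv := fun X => by simp only [mul_assoc, hQP', hQP, mul_one]
        right_inv := fun X => by simp only [mul_assoc, hPQ', hPQ, mul_one]
        map_add' := fun X Y => by simp [mul_add, add_mul]
        map_smul' := fun r X => by simp }
      (by simp [hPQ]) (fun X Y => by simp only [LinearEquiv.coe_mk, LinearMap.coe_mk,
        AddHom.coe_mk, mul_assoc, hQP'])
  let σ : Fin n ⊕ Fin n ≃ Fin (2 * n) := finSumFinEquiv.trans (finCongr (two_mul n).symm)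
  refine lieIso_of_algEquiv (e.trans (Matrix.reindexAlgEquiv ℝ ℂ σ)) fun X => ?_
  have h1 : (Matrix.reindexAlgEquiv ℝ ℂ σ (e X)).transpose * Matrix.reindexAlgEquiv ℝ ℂ σ (e X)
      = Matrix.reindexAlgEquiv ℝ ℂ σ ((e X).transpose * e X) := by
    rw [map_mul]; rfl
  rw [AlgEquiv.trans_apply, OC, Matrix.mem_orthogonalGroup_iff', h1,
    map_eq_one_iff _ (Matrix.reindexAlgEquiv ℝ ℂ σ).injective]
  have he : (e X).transpose * e X = Q * (X.transpose * (P * P) * X) * Q := by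
    change (P * X * Q).transpose * (P * X * Q) = _
    rw [Matrix.transpose_mul, Matrix.transpose_mul, hPt, hQt]
    simp only [mul_assoc]
  rw [he]
  change X.transpose * (signMatrix n ℝ).map Complex.ofReal * X = (signMatrix n ℝ).map Complex.ofReal ↔ _
  rw [hS]
  constructor
  · intro h; rw [h, mul_assoc, mul_assoc, hPQ, mul_one, hQP]
  · intro h
    have := congrArg (fun x => P * x * P) h
    simpa only [mul_assoc, hPQ', hQP, mul_one] using this

end Complex

/-! ### `G(p,q)` when `p` and `q` are odd -/

section OddOdd

variable {p q : ℕ}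

/-- The anti-involution `a ↦ ᵗa` of the even subalgebra. -/
def evenReverse (p q : ℕ) : evenStar p q →ₗ[ℝ] evenStar p q where
  toFun a := ⟨reverse (Q := stdForm p q) a.1, reverse_mem_even a.2⟩
  map_add' a b := Subtype.ext (map_add (reverse (Q := stdForm p q)) a.1 b.1)
  map_smul' r a := Subtype.ext (map_smul (reverse (Q := stdForm p q)) r a.1)

theorem evenReverse_mul (a b : evenStar p q) :
    evenReverse p q (a * b) = evenReverse p q b * evenReverse p q a :=
  Subtype.ext (reverse.map_mul (Q := stdForm p q) a.1 b.1)

theorem evenReverse_one : evenReverse p q 1 = 1 := Subtype.ext reverse.map_one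

theorem evenReverse_evenReverse (a : evenStar p q) : evenReverse p q (evenReverse p q a) = a :=
  Subtype.ext (reverse_reverse (Q := stdForm p q) a.1)

theorem evenReverse_evenGen {κ : Type*} {f : κ → Fin p ⊕ Fin q} {c : Fin p ⊕ Fin q} {k : κ}
    (h : f k ≠ c) : evenReverse p q (evenGen f c k) = -evenGen f c k := by
  refine Subtype.ext (Eq.trans ?_ ((isFrame_stdGen p q).anticomm (f k) c h))
  change reverse (clGen p q (f k) * clGen p q c) = clGen p q c * clGen p q (f k)
  rw [reverse.map_mul, reverse_ι, reverse_ι]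

/-- `{a : ᵗa a = 1}` inside the even subalgebra. -/
def reverseGroup (p q : ℕ) : Submonoid (evenStar p q) where
  carrier := {a | evenReverse p q a * a = 1}
  one_mem' := by simp [evenReverse_one]
  mul_mem' := by
    intro a b (ha : _ = _) (hb : _ = _)
    change evenReverse p q (a * b) * (a * b) = 1
    rw [evenReverse_mul, mul_assoc, ← mul_assoc _ a b, ha, one_mul, hb]

theorem lieIso_G_reverseGroup (p q : ℕ) : LieIso (G p q) (reverseGroup p q) :=
  lieIso_evenStar (H := G p q) (fun _ ha => ha.1) fun a =>
    ⟨fun h => ⟨a.2, congrArg Subtype.val h⟩, fun h => Subtype.ext h.2⟩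

theorem JPlus_mul_clGen_of_odd (hp : Odd p) (i : Fin p ⊕ Fin q) :
    JPlus p q * clGen p q i = (1 * stdSign p q i) • (clGen p q i * JPlus p q) := by
  obtain ⟨p, rfl⟩ := hp
  have := JPlus_mul_clGen (2 * p) q i
  rwa [Even.neg_one_pow (even_two_mul p)] at this

theorem JMinus_mul_clGen_of_odd (hq : Odd q) (i : Fin p ⊕ Fin q) :
    JMinus p q * clGen p q i = (-1 * stdSign p q i) • (clGen p q i * JMinus p q) := by
  obtain ⟨q, rfl⟩ := hq
  have := JMinus_mul_clGen p (2 * q) i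
  rwa [Odd.neg_one_pow ⟨q, rfl⟩] at this

theorem list_prod_ofFn_mem_evenOdd {n : ℕ} {y : Fin n → Cl p q}
    (hy : ∀ i, y i ∈ evenOdd (stdForm p q) 1) :
    (List.ofFn y).prod ∈ evenOdd (stdForm p q) (n : ZMod 2) := by
  have := SetLike.list_prod_ofFn_mem_graded (A := evenOdd (stdForm p q)) (fun _ => 1) y hy
  rwa [List.sum_ofFn, Finset.sum_const, Finset.card_univ, Fintype.card_fin, nsmul_one] at this

theorem JPlus_mul_JMinus_mem_even (hp : Odd p) (hq : Odd q) :
    JPlus p q * JMinus p q ∈ ClEven p q := by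
  have h1 : JPlus p q ∈ evenOdd (stdForm p q) p :=
    list_prod_ofFn_mem_evenOdd fun i => ι_mem_evenOdd_one _ _
  have h2 : JMinus p q ∈ evenOdd (stdForm p q) q :=
    list_prod_ofFn_mem_evenOdd fun i => ι_mem_evenOdd_one _ _
  have h3 := SetLike.mul_mem_graded h1 h2
  rw [← Nat.cast_add, (ZMod.natCast_eq_zero_iff_even).2 (hp.add_odd hq)] at h3
  exact h3

theorem JMinus_mul_JPlus (hp : Odd p) (hq : Odd q) :
    JMinus p q * JPlus p q = -(JPlus p q * JMinus p q) := by
  have : JPlus p q * JMinus p q = (-1 : ℝ) ^ q • (JMinus p q * JPlus p q) :=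
    mul_prod_ofFn_anticomm (y := fun j => clGen p q (Sum.inr j)) (v := JPlus p q) fun j => by
      rw [JPlus_mul_clGen_of_odd hp]; simp
  rw [this, hq.neg_one_pow, neg_one_smul, neg_neg]

/-- The central element `J₊ J₋` of the even subalgebra, its square, and its images under the
anti-involutions. -/
theorem exists_central (hp : Odd p) (hq : Odd q) {η : ℝ}
    (hη : η = -(prodSign 1 p * prodSign (-1) q)) :
    ∃ w : evenStar p q, w * w = η • 1 ∧ star w = η • w ∧ evenReverse p q w = (-η) • w ∧
      ∀ a, w * a = a * w := by
  have hJ := JMinus_mul_JPlus hp hq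
  have hJJ : ∀ x, JMinus p q * (JPlus p q * x) = -(JPlus p q * (JMinus p q * x)) := fun x => by
    rw [← mul_assoc, hJ, neg_mul, mul_assoc]
  have hw := JPlus_mul_JMinus_mem_even hp hq
  have e1 : ∀ {a}, a ∈ ClEven p q → JPlus p q * a = TMinus p q a * JPlus p q :=
    mul_even_eq (by norm_num) (JPlus_mul_clGen_of_odd hp)
  have e2 : ∀ {a}, a ∈ ClEven p q → JMinus p q * a = TMinus p q a * JMinus p q :=
    mul_even_eq (by norm_num) (JMinus_mul_clGen_of_odd hq)
  have sP : starConj (JPlus p q) = prodSign 1 p • JPlus p q :=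
    ((isFrame_stdGen p q).comp Sum.inl_injective).star_prod
  have sM : starConj (JMinus p q) = prodSign (-1) q • JMinus p q :=
    ((isFrame_stdGen p q).comp Sum.inr_injective).star_prod
  have hstar : starConj (JPlus p q * JMinus p q) = η • (JPlus p q * JMinus p q) := by
    rw [starConj_mul, sP, sM, smul_mul_smul_comm, hJ, smul_neg, hη, neg_smul, mul_comm (prodSign 1 p)]
  -- J₊ anticommutes with w = J₊J₋, while moving J₊ past the even element w applies T₋; cancelling
  -- J₊ gives T₋ w = -w.
  have hT : TMinus p q (JPlus p q * JMinus p q) = -(JPlus p q * JMinus p q) := by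
    have h1 : TMinus p q (JPlus p q * JMinus p q) * JPlus p q
        = -(JPlus p q * JMinus p q) * JPlus p q := by
      rw [← e1 hw, neg_mul, mul_assoc _ (JMinus p q), hJ, mul_neg, neg_neg]
    have h2 := congrArg (fun x => prodSign 1 p • (x * JPlus p q)) h1
    simpa only [mul_assoc, JPlus_mul_JPlus, mul_smul_comm, smul_smul, mul_one, neg_mul,
      smul_neg, prodSign_mul_self (c := 1) (by norm_num), one_smul] using h2
  refine ⟨⟨JPlus p q * JMinus p q, hw⟩, Subtype.ext ?_, Subtype.ext hstar, Subtype.ext ?_, ?_⟩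
  · change JPlus p q * JMinus p q * (JPlus p q * JMinus p q) = η • 1
    rw [mul_assoc, hJJ, mul_neg, ← mul_assoc, JPlus_mul_JPlus, JMinus_mul_JMinus,
      smul_mul_smul_comm, mul_one, hη, neg_smul]
  · change reverse (JPlus p q * JMinus p q) = (-η) • (JPlus p q * JMinus p q)
    rw [← TMinus_TMinus (reverse _)]
    change TMinus p q (starConj _) = _
    rw [hstar, map_smul, hT, smul_neg, neg_smul]
  · have h3 : ∀ a ∈ ClEven p q, JPlus p q * JMinus p q * a = a * (JPlus p q * JMinus p q) := by
      intro a ha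
      rw [mul_assoc, e2 ha, ← mul_assoc, e1 (TMinus_mem_even ha), TMinus_TMinus, mul_assoc]
    exact fun a => Subtype.ext (h3 a.1 a.2)

/-- For odd p ≡ q mod 4 the signs of J₊² and J₋² are opposite, so the central element has square 1
and is negated by reversal. -/
theorem lieIso_G_units (hp : Odd p) (hq : Odd q) (h : ((p : ℤ) - q) % 4 = 0) {M : Type*} [Ring M]
    [Algebra ℝ M] [Star M] [TopologicalSpace M] [IsModuleTopology ℝ M] [FiniteDimensional ℝ M]
    [IsSimpleRing M] (φ : Nonempty (evenStar p q ≃⋆ₐ[ℝ] M × M)) : LieIso (G p q) Mˣ := by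
  obtain ⟨φ⟩ := φ
  obtain ⟨w, h1, -, h2, h3⟩ := exists_central hp hq (η := 1) (by
    have := Nat.odd_iff.1 hp
    have := Nat.odd_iff.1 hq
    rcases (by omega : p % 4 = 1 ∧ q % 4 = 1 ∨ p % 4 = 3 ∧ q % 4 = 3) with h | h
    · rw [prodSign_one_eq_one (.inr h.1), prodSign_neg_one_eq_neg_one (.inl (by omega))]; norm_num
    · rw [prodSign_one_eq_neg_one (.inr h.1), prodSign_neg_one_eq_one (.inl (by omega))]; norm_num)
  refine (lieIso_G_reverseGroup p q).trans (lieIso_units_of_central φ.toAlgEquiv (evenReverse p q)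
    evenReverse_mul evenReverse_evenReverse evenReverse_one (by rw [h1, one_smul]) h3
    (by rw [h2, neg_one_smul]) fun a => Iff.rfl)

theorem prodSign_mul_prodSign_of_sub (hp : Odd p) (hq : Odd q) (h : ((p : ℤ) - q) % 4 = 2) :
    -1 = -(prodSign 1 p * prodSign (-1) q) := by
  have := Nat.odd_iff.1 hp
  have := Nat.odd_iff.1 hq
  rcases (by omega : p % 4 = 1 ∧ q % 4 = 3 ∨ p % 4 = 3 ∧ q % 4 = 1) with h | h
  · rw [prodSign_one_eq_one (.inr h.1), prodSign_neg_one_eq_one (.inl (by omega))]; norm_num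
  · rw [prodSign_one_eq_neg_one (.inr h.1), prodSign_neg_one_eq_neg_one (.inl (by omega))]; norm_num

/-- An anti-automorphism agrees with the conjugate of the star operation on the span of a frame if it
does so on the frame. -/
theorem IsFrame.mul_anti_eq_star_mul {A : Type*} [Ring A] [StarRing A] [Algebra ℝ A] [StarModule ℝ A]
    {κ : Type*} {s : κ → ℝ} {u : κ → A} (hu : IsFrame s u) {τ : A →ₗ[ℝ] A}
    (hτ : ∀ a b, τ (a * b) = τ b * τ a) (hτ1 : τ 1 = 1) {J : A}
    (h : ∀ i, J * τ (u i) = s i • (u i * J)) :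
    ∀ b ∈ frameSpan u, J * τ b = star b * J ∧ J * τ (star b) = b * J := by
  -- The two equalities are proved together because the star case of the induction exchanges them.
  intro b hb
  induction hb using StarAlgebra.adjoin_induction with
  | mem x hx =>
    obtain ⟨i, rfl⟩ := hx
    rw [hu.star_eq, map_smul, mul_smul_comm, h, smul_mul_assoc, smul_smul, hu.sign_mul_self,
      one_smul]
    exact ⟨rfl, rfl⟩
  | algebraMap r =>
    rw [Algebra.algebraMap_eq_smul_one, StarModule.star_smul, star_one, star_trivial, map_smul, hτ1,
      mul_smul_comm, smul_mul_assoc, mul_one, one_mul]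
    exact ⟨rfl, rfl⟩
  | add x y hx hy h1 h2 =>
    rw [star_add, map_add, map_add, mul_add, mul_add, add_mul, add_mul, h1.1, h1.2, h2.1, h2.2]
    exact ⟨rfl, rfl⟩
  | mul x y hx hy h1 h2 =>
    rw [star_mul, hτ, hτ, ← mul_assoc, ← mul_assoc, h2.1, h1.2, mul_assoc, mul_assoc x J, h1.1, h2.2,
      mul_assoc, mul_assoc]
    exact ⟨rfl, rfl⟩
  | star x hx h1 => rw [star_star]; exact h1.symm

/-- A subalgebra of real matrices spanned by a frame whose elements are negated by an
anti-automorphism. -/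
theorem IsFrame.exists_realForm {A : Type*} [Ring A] [StarRing A] [Algebra ℝ A] [StarModule ℝ A]
    [Nontrivial A] {l : ℕ} {u : Fin (l + 1) ⊕ Fin (l + 1) → A}
    (hu : IsFrame (stdSign (l + 1) (l + 1)) u) (hle : Even l) {τ : A →ₗ[ℝ] A}
    (hτ : ∀ a b, τ (a * b) = τ b * τ a) (hτ1 : τ 1 = 1) (hur : ∀ i, τ (u i) = -u i) :
    ∃ (ψ : Matrix (Fin (2 ^ l) ⊕ Fin (2 ^ l)) (Fin (2 ^ l) ⊕ Fin (2 ^ l)) ℝ →ₐ[ℝ] A)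
      (S : Matrix (Fin (2 ^ l) ⊕ Fin (2 ^ l)) (Fin (2 ^ l) ⊕ Fin (2 ^ l)) ℝ),
      (∀ X, ψ S * τ (ψ X) = ψ X.transpose * ψ S) ∧
      (l % 4 = 2 → S = signMatrix (2 ^ l) ℝ) ∧ (l % 4 = 0 → S = skewMatrix (2 ^ l) ℝ) := by
  have hu' : IsFrame (stdSign (l + 1) (l + 1)) (frameSpanGen u) := IsFrame.of_coe hu
  obtain ⟨B, y, hy, hyg, e, h₁, h₂⟩ := exists_split_prod_minus hu' (starGenerates_frameSpanGen u)
  -- After the split a frame of type (l,l) remains, so B consists of real matrices of size 2^l.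
  obtain ⟨m, hm, ⟨g⟩⟩ := (hasCliffordType_of_split hy hyg e (by simp)).1 (.inl (by simp))
  obtain rfl : l = m := by omega
  let φ := blockEquiv e g
  have hJv : (((List.ofFn fun i => frameSpanGen u (Sum.inr i)).prod : frameSpan u) : A) =
      (List.ofFn fun i => u (Sum.inr i)).prod := by
    rw [← StarSubalgebra.subtype_apply, map_list_prod, List.map_ofFn]
    rfl
  -- The product J of the l+1 negative generators, an odd number, satisfies J uᵢ = -sᵢ uᵢ J. With τ
  -- uᵢ = -uᵢ this says that J τ(uᵢ) = uᵢ* J.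
  have hJu : ∀ i, (List.ofFn fun i => u (Sum.inr i)).prod * u i =
      -(stdSign (l + 1) (l + 1) i) • (u i * (List.ofFn fun i => u (Sum.inr i)).prod) := by
    rintro (i | i)
    · have := mul_prod_ofFn_anticomm (y := fun j => u (Sum.inr j)) (v := u (Sum.inl i))
        fun j => hu.anticomm (Sum.inr j) (Sum.inl i) (by simp)
      rw [hle.add_one.neg_one_pow] at this
      rw [this]; simp
    · have := mul_prod_ofFn_self (hu.comp Sum.inr_injective).anticomm i
      rw [hle.neg_one_pow, one_smul] at this
      simpa using this.symm
  have hrev := hu.mul_anti_eq_star_mul hτ hτ1 fun i => by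
    rw [hur, mul_neg, hJu, neg_smul, neg_neg]
  set J := (List.ofFn fun i => frameSpanGen u (Sum.inr i)).prod with hJ
  have hψ : ∀ X, (J : A) * τ (φ.symm X : frameSpan u) = (φ.symm X.transpose : frameSpan u) * (J : A) := by
    intro X
    rw [hJv, (hrev _ (φ.symm X).2).1,
      show X.transpose = star X by rw [Matrix.star_eq_conjTranspose]; rfl, map_star]
    rfl
  -- The product of l+1 negative generators has square 1 when l+1 ≡ 3 mod 4 and -1 when l+1 ≡ 1 mod
  -- 4.
  refine ⟨(frameSpan u).subtype.toAlgHom.comp φ.symm.toAlgEquiv.toAlgHom, φ J, fun X => ?_,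
    fun h => blockEquiv_sign (h₁ (prodSign_neg_one_eq_one (.inl (by omega)))) g,
    fun h => blockEquiv_skew (h₂ (prodSign_neg_one_eq_neg_one (.inl (by omega)))) g⟩
  have := hψ X
  nth_rewrite 1 2 [← φ.symm_apply_apply J] at this
  exact this

/-- A frame of the even subalgebra that is negated by the anti-involution `a ↦ ᵗa`. -/
theorem exists_frame_evenReverse {w : evenStar p (q + 1)} (hw : w * w = (-1 : ℝ) • 1)
    (hws : star w = (-1 : ℝ) • w) (hwr : evenReverse _ _ w = w) (hwc : ∀ a, w * a = a * w) {l : ℕ}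
    (hl : p + q = 2 * l + 3) : ∃ u : Fin (l + 1) ⊕ Fin (l + 1) → evenStar p (q + 1),
      IsFrame (stdSign (l + 1) (l + 1)) u ∧ ∀ i, evenReverse _ _ (u i) = -u i := by
  classical
  -- Any 2l+2 of the 2l+3 generators will do: multiplication by the central w with w² = -1 flips a
  -- sign wherever the wanted type requires it, and reversal, which fixes w, still negates the
  -- result.
  obtain ⟨f⟩ : Nonempty (Fin (l + 1) ⊕ Fin (l + 1) ↪ Fin p ⊕ Fin q) :=
    Function.Embedding.nonempty_of_card_le (by simp; omega)
  have hzr : ∀ i, evenReverse p (q + 1) (evenGen (Sum.map id Fin.succ) (Sum.inr 0) i) =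
      -evenGen (Sum.map id Fin.succ) (Sum.inr 0) i := fun i =>
    evenReverse_evenGen (by rcases i with i | i <;> simp)
  refine ⟨_, (((isFrame_evenGen_inr p q).comp f.injective).twist
    (fun i => stdSign p q (f i) ≠ stdSign (l + 1) (l + 1) i) (g := w) (γ := -1) (δ := 1)
    (by norm_num) (by norm_num) hw hws (fun i _ => by rw [hwc, one_smul])
    (fun i _ => hwc _)).congr fun i => ?_, fun i => ?_⟩
  · rcases i with i | i
    · rcases hfi : f (Sum.inl i) with j | j <;> simp [hfi]
    · rcases hfi : f (Sum.inr i) with j | j <;> simp [hfi]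
  · split_ifs
    · rw [evenReverse_mul, hwr, Function.comp_apply, hzr, hwc, neg_mul]
    · exact hzr _

theorem finrank_evenStar_of_sub (hp : 1 ≤ p) (h : ((p : ℤ) - q) % 4 = 3) {l : ℕ}
    (hl : p + q = 2 * l + 3) : Module.finrank ℝ (evenStar p (q + 1)) =
      Module.finrank ℝ (Matrix (Fin (2 ^ l) ⊕ Fin (2 ^ l)) (Fin (2 ^ l) ⊕ Fin (2 ^ l)) ℂ) := by
  obtain ⟨m, hm, ⟨e⟩⟩ := (hasCliffordType_evenStar (q := q) hp).2.2.1 (by omega)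
  obtain rfl : m = l + 1 := by omega
  rw [e.toAlgEquiv.toLinearEquiv.finrank_eq, Module.finrank_matrix, Module.finrank_matrix]
  simp [pow_succ, mul_two]

/-- The residue of l mod 4 decides whether the complex bilinear form on the real form's matrices is
symmetric or alternating. Odd l makes both claims vacuous. -/
theorem lieIso_G_complex (hp : Odd p) (hq : Odd q) (h : ((p : ℤ) - q) % 4 = 2) {l : ℕ}
    (hl : p + q = 2 * l + 4) :
    (l % 4 = 2 → LieIso (G p q) (OC (2 * 2 ^ l))) ∧ (l % 4 = 0 → LieIso (G p q) (SpC (2 ^ l))) := by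
  obtain ⟨q, rfl⟩ := Nat.exists_eq_add_of_le' hq.pos
  push_cast at h
  by_cases hle : Even l
  swap
  · rw [Nat.even_iff] at hle
    exact ⟨fun h => absurd h (by omega), fun h => absurd h (by omega)⟩
  obtain ⟨w, hw, hws, hwr, hwc⟩ := exists_central hp hq (η := -1)
    (prodSign_mul_prodSign_of_sub hp hq (by push_cast; exact h))
  rw [neg_neg, one_smul] at hwr
  obtain ⟨u, hu, hur⟩ := exists_frame_evenReverse hw hws hwr hwc (l := l) (by omega)
  rw [neg_one_smul] at hw
  obtain ⟨ψ, S, hψ, h1, h2⟩ := hu.exists_realForm hle evenReverse_mul evenReverse_one hur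
  have hf := finrank_evenStar_of_sub (q := q) hp.pos (by omega) (l := l) (by omega)
  constructor
  · intro h
    obtain rfl := h1 h
    exact (lieIso_G_reverseGroup p (q + 1)).trans ((lieIso_of_complexify (K := signIsometries _) hw (fun _ => hwc _) hf
      evenReverse_mul hwr (ε := 1) (by simp [signMatrix, Matrix.fromBlocks_multiply]) (by norm_num)
      hψ (fun a => Iff.rfl) (fun X => Iff.rfl)).trans (lieIso_signIsometries _))
  · intro h
    obtain rfl := h2 h
    exact (lieIso_G_reverseGroup p (q + 1)).trans (lieIso_of_complexify hw (fun _ => hwc _) hf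
      evenReverse_mul hwr (ε := -1)
      (by simp [skewMatrix, Matrix.fromBlocks_multiply, ← Matrix.fromBlocks_one,
        Matrix.fromBlocks_neg]) (by norm_num)
      hψ (fun a => Iff.rfl) mem_SpC_iff)

end OddOdd

/-! ### The tables -/

/-- Here c is an even one among p and q, and its residue mod 4 gives the sign ε. Since p + q = ±(p -
q) + 2c, that residue is equivalent to a condition on p + q mod 8 once p - q is known. -/
theorem exists_lieIso_G_of_hasFormType {p q c N : ℕ} {d : ℤ} {ε : ℝ}
    (hT : HasFormType d N ε (G p q)) (hd : d = p - q + 1 ∨ d = q - p + 1) (hN : p + q = N + 3)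
    (hc : c = p ∨ c = q) (hc2 : c % 2 = 0) (h1 : c % 4 = 0 → ε = 1) (h2 : c % 4 = 2 → ε = -1) :
    ((p : ℤ) - q ≡ 0 [ZMOD 8] → ∃ m, p + q = 2 * m + 4 ∧
      ((p : ℤ) + q ≡ 0 [ZMOD 8] → LieIso (G p q) (Onn (2 ^ m) × Onn (2 ^ m))) ∧
      ((p : ℤ) + q ≡ 4 [ZMOD 8] → LieIso (G p q) (SpR (2 ^ m) × SpR (2 ^ m)))) ∧
    (PM8 ((p : ℤ) - q) 1 → ∃ m, p + q = 2 * m + 3 ∧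
      (PM8 ((p : ℤ) + q) 1 → LieIso (G p q) (Onn (2 ^ m))) ∧
      (PM8 ((p : ℤ) + q) 3 → LieIso (G p q) (SpR (2 ^ m)))) ∧
    (PM8 ((p : ℤ) - q) 2 → ∃ m, p + q = 2 * m + 4 ∧ LieIso (G p q) (Unn (2 ^ m))) ∧
    (PM8 ((p : ℤ) - q) 3 → ∃ m, p + q = 2 * m + 5 ∧
      (PM8 ((p : ℤ) + q) 1 → LieIso (G p q) (OStar (2 * 2 ^ m))) ∧
      (PM8 ((p : ℤ) + q) 3 → LieIso (G p q) (Spnn (2 ^ m)))) ∧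
    ((p : ℤ) - q ≡ 4 [ZMOD 8] → ∃ m, p + q = 2 * m + 6 ∧
      ((p : ℤ) + q ≡ 0 [ZMOD 8] → LieIso (G p q) (OStar (2 * 2 ^ m) × OStar (2 * 2 ^ m))) ∧
      ((p : ℤ) + q ≡ 4 [ZMOD 8] → LieIso (G p q) (Spnn (2 ^ m) × Spnn (2 ^ m)))) := by
  simp only [PM8, Int.ModEq]
  refine ⟨fun h => ?_, fun h => ?_, fun h => ?_, fun h => ?_, fun h => ?_⟩
  · obtain ⟨m, hm, a, b⟩ := hT.2.1 (by omega)
    exact ⟨m, by omega, fun h => a (h1 (by omega)), fun h => b (h2 (by omega))⟩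
  · obtain ⟨m, hm, a, b⟩ := hT.1 (by omega)
    exact ⟨m, by omega, fun h => a (h1 (by omega)), fun h => b (h2 (by omega))⟩
  · obtain ⟨m, hm, a⟩ := hT.2.2.1 (by omega)
    exact ⟨m, by omega, a⟩
  · obtain ⟨m, hm, a, b⟩ := hT.2.2.2.1 (by omega)
    exact ⟨m, by omega, fun h => b (h2 (by omega)), fun h => a (h1 (by omega))⟩
  · obtain ⟨m, hm, a, b⟩ := hT.2.2.2.2 (by omega)
    exact ⟨m, by omega, fun h => b (h2 (by omega)), fun h => a (h1 (by omega))⟩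

/-- The type of `G(p,q)` when `p` or `q` is even. -/
theorem exists_lieIso_G_of_even {p q : ℕ} (hp : 1 ≤ p) (hq : 1 ≤ q) (h : p % 2 = 0 ∨ q % 2 = 0) :
    ((p : ℤ) - q ≡ 0 [ZMOD 8] → ∃ m, p + q = 2 * m + 4 ∧
      ((p : ℤ) + q ≡ 0 [ZMOD 8] → LieIso (G p q) (Onn (2 ^ m) × Onn (2 ^ m))) ∧
      ((p : ℤ) + q ≡ 4 [ZMOD 8] → LieIso (G p q) (SpR (2 ^ m) × SpR (2 ^ m)))) ∧
    (PM8 ((p : ℤ) - q) 1 → ∃ m, p + q = 2 * m + 3 ∧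
      (PM8 ((p : ℤ) + q) 1 → LieIso (G p q) (Onn (2 ^ m))) ∧
      (PM8 ((p : ℤ) + q) 3 → LieIso (G p q) (SpR (2 ^ m)))) ∧
    (PM8 ((p : ℤ) - q) 2 → ∃ m, p + q = 2 * m + 4 ∧ LieIso (G p q) (Unn (2 ^ m))) ∧
    (PM8 ((p : ℤ) - q) 3 → ∃ m, p + q = 2 * m + 5 ∧
      (PM8 ((p : ℤ) + q) 1 → LieIso (G p q) (OStar (2 * 2 ^ m))) ∧
      (PM8 ((p : ℤ) + q) 3 → LieIso (G p q) (Spnn (2 ^ m)))) ∧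
    ((p : ℤ) - q ≡ 4 [ZMOD 8] → ∃ m, p + q = 2 * m + 6 ∧
      ((p : ℤ) + q ≡ 0 [ZMOD 8] → LieIso (G p q) (OStar (2 * 2 ^ m) × OStar (2 * 2 ^ m))) ∧
      ((p : ℤ) + q ≡ 4 [ZMOD 8] → LieIso (G p q) (Spnn (2 ^ m) × Spnn (2 ^ m)))) := by
  rcases h with h | h
  · obtain ⟨k, rfl⟩ : ∃ k, p = k + 2 := ⟨p - 2, by omega⟩
    exact exists_lieIso_G_of_hasFormType (hasFormType_G_of_even_left hq (Nat.even_iff.2 h))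
      (.inr (by push_cast; ring)) (by omega) (.inl rfl) h
      (fun h' => prodSign_neg_one_eq_one (.inl (by omega)))
      (fun h' => prodSign_neg_one_eq_neg_one (.inl (by omega)))
  · obtain ⟨k, rfl⟩ : ∃ k, q = k + 2 := ⟨q - 2, by omega⟩
    exact exists_lieIso_G_of_hasFormType (hasFormType_G_of_even_right hp (Nat.even_iff.2 h))
      (.inl (by push_cast; ring)) (by omega) (.inr rfl) h
      (fun h' => prodSign_neg_one_eq_one (.inl (by omega)))
      (fun h' => prodSign_neg_one_eq_neg_one (.inl (by omega)))

theorem hasCliffordType_evenStar_of_pos {p q : ℕ} (hp : 1 ≤ p) (hq : 1 ≤ q) :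
    HasCliffordType ((p : ℤ) - q + 1) (p + q - 1) (evenStar p q) := by
  obtain ⟨q, rfl⟩ := Nat.exists_eq_add_of_le' hq
  convert hasCliffordType_evenStar hp using 1
  · push_cast; ring
  · omega

theorem G_eq_inf_JPlus {p q : ℕ} (hp : Odd p) :
    G p q = (ClEven p q).toSubmonoid ⊓ AutJ (JPlus p q) :=
  G_eq_inf (by norm_num) (JPlus_mul_clGen_of_odd hp) (JPlus_mul_JPlus p q)
    (prodSign_mul_self (by norm_num) _)

theorem G_eq_inf_JMinus {p q : ℕ} (hq : Odd q) :
    G p q = (ClEven p q).toSubmonoid ⊓ AutJ (JMinus p q) :=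
  G_eq_inf (by norm_num) (JMinus_mul_clGen_of_odd hq) (JMinus_mul_JMinus p q)
    (prodSign_mul_self (by norm_num) _)

end IndefClifford

end

/-! ### Assembling the tables -/

open IndefClifford in
theorem mainTheorem9 (p q : ℕ) (hp : 1 ≤ p) (hq : 1 ≤ q) :
    -- The structure of `G(p,q)` and of `C_even(p,q)`.
    (((p : ℤ) - q ≡ 0 [ZMOD 8] →
        (∃ m : ℕ, p + q = 2 * m + 2 ∧
          AlgIso (ClEven p q) (Mat (2 ^ m) ℝ × Mat (2 ^ m) ℝ) ∧
          (PM8 ((p : ℤ) + q) 2 → LieIso (G p q) (GLR (2 ^ m)))) ∧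
        ((p : ℤ) + q ≡ 0 [ZMOD 8] → ∃ m n : ℕ, p + q = 2 * m + 4 ∧ n = 2 ^ m ∧
          LieIso (G p q) (Onn n × Onn n)) ∧
        ((p : ℤ) + q ≡ 4 [ZMOD 8] → ∃ m n : ℕ, p + q = 2 * m + 4 ∧ n = 2 ^ m ∧
          LieIso (G p q) (SpR n × SpR n))) ∧
      (PM8 ((p : ℤ) - q) 1 → ∃ m n : ℕ, p + q = 2 * m + 3 ∧ n = 2 ^ m ∧
        AlgIso (ClEven p q) (Mat (2 * n) ℝ) ∧
        (PM8 ((p : ℤ) + q) 1 → LieIso (G p q) (Onn n)) ∧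
        (PM8 ((p : ℤ) + q) 3 → LieIso (G p q) (SpR n))) ∧
      (PM8 ((p : ℤ) - q) 2 → ∃ m n : ℕ, p + q = 2 * m + 4 ∧ n = 2 ^ m ∧
        AlgIso (ClEven p q) (Mat (2 * n) ℂ) ∧
        ((p : ℤ) + q ≡ 0 [ZMOD 8] → LieIso (G p q) (OC (2 * n))) ∧
        (PM8 ((p : ℤ) + q) 2 → LieIso (G p q) (Unn n)) ∧
        ((p : ℤ) + q ≡ 4 [ZMOD 8] → LieIso (G p q) (SpC n))) ∧
      (PM8 ((p : ℤ) - q) 3 → ∃ m n : ℕ, p + q = 2 * m + 5 ∧ n = 2 ^ m ∧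
        AlgIso (ClEven p q) (Mat (2 * n) ℍ[ℝ]) ∧
        (PM8 ((p : ℤ) + q) 1 → LieIso (G p q) (OStar (2 * n))) ∧
        (PM8 ((p : ℤ) + q) 3 → LieIso (G p q) (Spnn n))) ∧
      ((p : ℤ) - q ≡ 4 [ZMOD 8] → ∃ m n : ℕ, p + q = 2 * m + 6 ∧ n = 2 ^ m ∧
        AlgIso (ClEven p q) (Mat (2 * n) ℍ[ℝ] × Mat (2 * n) ℍ[ℝ]) ∧
        ((p : ℤ) + q ≡ 0 [ZMOD 8] → LieIso (G p q) (OStar (2 * n) × OStar (2 * n))) ∧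
        (PM8 ((p : ℤ) + q) 2 → LieIso (G p q) (GLH (2 * n))) ∧
        ((p : ℤ) + q ≡ 4 [ZMOD 8] → LieIso (G p q) (Spnn n × Spnn n)))) ∧
    -- The structure of `C(p,q) ∩ Aut(J₊)` and of `C(p,q) ∩ Aut(J₋)`.
    AutTable p q (AutJ (JPlus p q))
      (p % 4 = 0 ∨ p % 4 = 1) (p % 4 = 2 ∨ p % 4 = 3) ∧
    AutTable p q (AutJ (JMinus p q))
      ((q + 1) % 4 = 0 ∨ (q + 1) % 4 = 1) ((q + 1) % 4 = 2 ∨ (q + 1) % 4 = 3) ∧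
    -- The case where `p` and `q` are odd.
    (Odd p → Odd q →
      G p q = (ClEven p q).toSubmonoid ⊓ AutJ (JPlus p q) ∧
      G p q = (ClEven p q).toSubmonoid ⊓ AutJ (JMinus p q) ∧
      ((p : ℤ) - q ≡ 0 [ZMOD 8] → PM8 ((p : ℤ) + q) 2 ∧
        ∃ m n : ℕ, p + q = 2 * m + 2 ∧ n = 2 ^ m ∧ LieIso (G p q) (GLR n)) ∧
      ((p : ℤ) - q ≡ 4 [ZMOD 8] → PM8 ((p : ℤ) + q) 2 ∧
        ∃ m n : ℕ, p + q = 2 * m + 4 ∧ n = 2 ^ m ∧ LieIso (G p q) (GLH n)) ∧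
      (PM8 ((p : ℤ) - q) 2 → (p : ℤ) + q ≡ 0 [ZMOD 8] →
        ∃ m n : ℕ, p + q = 2 * m + 2 ∧ n = 2 ^ m ∧ LieIso (G p q) (OC n)) ∧
      (PM8 ((p : ℤ) - q) 2 → (p : ℤ) + q ≡ 4 [ZMOD 8] →
        ∃ m n : ℕ, p + q = 2 * m + 4 ∧ n = 2 ^ m ∧ LieIso (G p q) (SpC n))) := by
  have hc := hasCliffordType_evenStar_of_pos hp hq
  have odd_of {n : ℕ} (h : n % 2 = 1) : Odd n := Nat.odd_iff.2 h
  refine ⟨⟨fun h => ?_, fun h => ?_, fun h => ?_, fun h => ?_, fun h => ?_⟩,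
    autTable_plus hp hq, autTable_minus hp hq, fun hp' hq' => ⟨G_eq_inf_JPlus hp',
      G_eq_inf_JMinus hq', fun h => ?_, fun h => ?_, fun h h' => ?_, fun h h' => ?_⟩⟩
  · have h8 : ((p : ℤ) - q) % 8 = 0 := h
    -- Here 2^m is the 2n of the table; it is not written as a double because m = 0 when p = q = 1.
    obtain ⟨m, hm, e⟩ := hc.2.1 (by omega)
    -- The residue of 2p = (p - q) + (p + q) mod 8 fixes the parity of p, which decides between the
    -- odd and the even analysis of G.
    refine ⟨⟨m, by omega, algIso_clEven e, fun h' => ?_⟩, fun h' => ?_, fun h' => ?_⟩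
    · simp only [PM8, Int.ModEq] at h'
      exact lieIso_G_units (odd_of (by omega)) (odd_of (by omega)) (by omega) e
    · have h8' : ((p : ℤ) + q) % 8 = 0 := h'
      obtain ⟨k, hk, a, -⟩ := (exists_lieIso_G_of_even hp hq (by omega)).1 h
      exact ⟨k, _, hk, rfl, a h'⟩
    · have h8' : ((p : ℤ) + q) % 8 = 4 := h'
      obtain ⟨k, hk, -, a⟩ := (exists_lieIso_G_of_even hp hq (by omega)).1 h
      exact ⟨k, _, hk, rfl, a h'⟩
  · have h8 := h
    simp only [PM8, Int.ModEq] at h8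
    obtain ⟨m, hm, e⟩ := hc.1 (by omega)
    obtain ⟨k, hk, a, b⟩ := (exists_lieIso_G_of_even hp hq (by omega)).2.1 h
    obtain rfl : m = k + 1 := by omega
    rw [pow_succ'] at e
    exact ⟨k, _, hk, rfl, algIso_clEven e, a, b⟩
  · have h8 := h
    simp only [PM8, Int.ModEq] at h8
    obtain ⟨m, hm, e⟩ := hc.2.2.1 (by omega)
    obtain ⟨k, rfl⟩ : ∃ k, m = k + 1 := ⟨m - 1, by omega⟩
    have hk : p + q = 2 * k + 4 := by omega
    have hO := fun (h1 : p % 2 = 1) (h2 : q % 2 = 1) =>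
      lieIso_G_complex (odd_of h1) (odd_of h2) (by omega) hk
    rw [pow_succ'] at e
    refine ⟨k, _, hk, rfl, algIso_clEven e, fun h' => ?_, fun h' => ?_, fun h' => ?_⟩ <;>
      simp only [PM8, Int.ModEq] at h'
    · exact (hO (by omega) (by omega)).1 (by omega)
    · obtain ⟨j, hj, a⟩ := (exists_lieIso_G_of_even hp hq (by omega)).2.2.1 h
      obtain rfl : j = k := by omega
      exact a
    · exact (hO (by omega) (by omega)).2 (by omega)
  · have h8 := h
    simp only [PM8, Int.ModEq] at h8
    obtain ⟨m, hm, e⟩ := hc.2.2.2.1 (by omega)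
    obtain ⟨k, hk, a, b⟩ := (exists_lieIso_G_of_even hp hq (by omega)).2.2.2.1 h
    obtain rfl : m = k + 1 := by omega
    rw [pow_succ'] at e
    exact ⟨k, _, hk, rfl, algIso_clEven e, a, b⟩
  · have h8 : ((p : ℤ) - q) % 8 = 4 := h
    obtain ⟨m, hm, e⟩ := hc.2.2.2.2 (by omega)
    obtain ⟨k, rfl⟩ : ∃ k, m = k + 1 := ⟨m - 1, by omega⟩
    have hk : p + q = 2 * k + 6 := by omega
    rw [pow_succ'] at e
    refine ⟨k, _, hk, rfl, algIso_clEven e, fun h' => ?_, fun h' => ?_, fun h' => ?_⟩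
    · have h8' : ((p : ℤ) + q) % 8 = 0 := h'
      obtain ⟨j, hj, a, -⟩ := (exists_lieIso_G_of_even hp hq (by omega)).2.2.2.2 h
      obtain rfl : j = k := by omega
      exact a h'
    · simp only [PM8, Int.ModEq] at h'
      exact lieIso_G_units (odd_of (by omega)) (odd_of (by omega)) (by omega) e
    · have h8' : ((p : ℤ) + q) % 8 = 4 := h'
      obtain ⟨j, hj, -, a⟩ := (exists_lieIso_G_of_even hp hq (by omega)).2.2.2.2 h
      obtain rfl : j = k := by omega
      exact a h'
  · have h8 : ((p : ℤ) - q) % 8 = 0 := h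
    have := Nat.odd_iff.1 hp'
    obtain ⟨m, hm, e⟩ := hc.2.1 (by omega)
    exact ⟨by simp only [PM8, Int.ModEq]; omega, m, _, by omega, rfl,
      lieIso_G_units hp' hq' (by omega) e⟩
  · have h8 : ((p : ℤ) - q) % 8 = 4 := h
    have := Nat.odd_iff.1 hp'
    obtain ⟨m, hm, e⟩ := hc.2.2.2.2 (by omega)
    exact ⟨by simp only [PM8, Int.ModEq]; omega, m, _, by omega, rfl,
      lieIso_G_units hp' hq' (by omega) e⟩
  · simp only [PM8, Int.ModEq] at h h'
    obtain ⟨k, hk⟩ : ∃ k, p + q = 2 * k + 4 := ⟨(p + q - 4) / 2, by omega⟩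
    -- With α = 2 in place of 4, n is twice the n of (A).
    refine ⟨k + 1, _, by omega, rfl, ?_⟩
    rw [pow_succ']
    exact (lieIso_G_complex hp' hq' (by omega) hk).1 (by omega)
  · simp only [PM8, Int.ModEq] at h h'
    obtain ⟨k, hk⟩ : ∃ k, p + q = 2 * k + 4 := ⟨(p + q - 4) / 2, by omega⟩
    exact ⟨k, _, hk, rfl, (lieIso_G_complex hp' hq' (by omega) hk).2 (by omega)⟩
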